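/- Let $\mathbb{k}$ be a field of characteristic $0$ and let $\delta,\varepsilon\in\{1,-1\}$. Write $\mathbb{k}^{+1}$ for the trivial and $\mathbb{k}^{-1}$ for the sign representation of a symmetric group $\mathfrak{S}_t$, and $\mathbf{t}=\{1,\dots,t\}$, $\mathbf 2\times\mathbf t$ for the set of $t$ ordered directed pairs $((1,i),(2,i))$. **Categories.** * $(\mathbb{k}\overrightarrow{\mathsf{ub}})_\varepsilon$ is the $\mathbb{k}$-linear category whose objects are finite sets and with $$\mathrm{Hom}(A,B)=\bigoplus_t \mathbb{k}\,\mathrm{Bij}(A\amalg(\mathbf 2\times\mathbf t),B)\otimes_{\mathbb{k}\mathfrak S_t}\mathbb{k}^{\varepsilon}.$$ * $(\mathbb{k}\mathsf{ub})_{(\delta;\varepsilon)}$ is defined in the same way with $\mathfrak S_2\wr\mathfrak S_t$ in place of $\mathfrak S_t$, acting on $\mathbb{k}$ by $\mathbb{k}^\delta$ on each copy of $\mathfrak S_2$ and by $\mathbb{k}^\varepsilon$ on $\mathfrak S_t$. * $(\mathbb{k}\mathsf{uwb})_\varepsilon$ has as objects the pairs of finite sets and $$\mathrm{Hom}((X,Y),(U,V))=\bigoplus_n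 \mathbb{k}\big(\mathrm{Bij}(X\amalg\mathbf n,U)\times\mathrm{Bij}(Y\amalg\mathbf n,V)\big)\otimes_{\mathbb{k}\mathfrak S_n}\mathbb{k}^\varepsilon .$$ In each case composition is induced by composing bijections and concatenating the lists of pairs. $[f]$ denotes the class of $f$. The opposite categories are $(\mathbb{k}\overrightarrow{\mathsf{db}})_\varepsilon$, $(\mathbb{k}\mathsf{db})_{(\delta;\varepsilon)}$ and $(\mathbb{k}\mathsf{dwb})_\varepsilon$. A module is a $\mathbb{k}$-linear functor to $\mathbb{k}$-vector spaces; a right module over an upward category ($\mathsf{u}$) is the same as a module over the opposite downward category ($\mathsf{d}$). **Functors.** * $\mathsf d\Upsilon_\varepsilon:(\mathbb{k}\mathsf{dwb})_\varepsilon\to(\mathbb{k}\overrightarrow{\mathsf{db}})_\varepsilon$ is induced by the disjoint union $(X,Y)\mapsto X\amalg Y$ (with $\mathbf n\amalg\mathbf n=\mathbf 2\times\mathbf n$). * $(\mathsf d\Upsilon_\varepsilon)_*$ is the right adjoint of the restriction functor $\mathsf d\Upsilon_\varepsilon^*$ on modules. On objects, $(\mathsf d\Upsilon_\varepsilon)_*G(X)=\bigoplus_{X=X_1\amalg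 X_2}G(X_1,X_2)$. * $\mathsf{dmp}_{(\delta;\varepsilon)}:(\mathbb{k}\overrightarrow{\mathsf{db}})_\varepsilon\to(\mathbb{k}\mathsf{db})_{(\delta;\varepsilon)}$ is the canonical quotient functor (identity on objects). * $\mathsf{Tr}_{(\delta;\varepsilon)}:(\mathbb{k}\mathsf{db})_{(\delta;\varepsilon)}\to(\mathbb{k}\overrightarrow{\mathsf{db}})_\varepsilon$ is the opposite of the functor between upward categories which is the identity on objects and sends $[f]$, for $f$ of degree $t$, to $\sum_{c\in\mathfrak S_2^{t}}\delta(c)[f\cdot c]$. Here $c$ changes the directions of the pairs and $\delta(c)$ is its character under $\mathbb{k}^\delta$ on each factor; in degree $1$ this is $[f]+\delta[f']$, where $f'$ has the opposite directed pair. * $\mathsf d\upsilon_{(\delta;\varepsilon)}=\mathsf{dmp}_{(\delta;\varepsilon)}\circ\mathsf d\Upsilon_\varepsilon$ and $\mathsf d\mathcal J_{(\delta;\varepsilon)}=\mathsf{Tr}_{(\delta;\varepsilon)}^*\circ(\mathsf d\Upsilon_\varepsilon)_*$. **Koszul complexes.** * For a right $(\mathbb{k}\mathsf{uwb})_\varepsilon$-module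 $G$ and a $(\mathbb{k}\mathsf{dwb})_{-\varepsilon}$-module $F$, $$G\otimes_{\mathbb{k}(\mathsf{FB}\times\mathsf{FB})}F=\bigoplus_{m,n}G(\mathbf m,\mathbf n)\otimes_{\mathbb{k}(\mathfrak S_m\times\mathfrak S_n)}F(\mathbf m,\mathbf n).$$ Its differential, from the $(m+1,n+1)$ to the $(m,n)$ component, is $x\otimes y\mapsto\sum_{i\in\mathbf{m+1},\,j\in\mathbf{n+1}}x[\beta_{i,j}]\otimes[\beta_{i,j}^{\mathrm{op}}]y$, where $\beta_{i,j}:(\mathbf m,\mathbf n)\to(\mathbf{m+1},\mathbf{n+1})$ has walled pair $(i,j)$ and is order preserving on $\mathbf m$ and $\mathbf n$. * For a right $(\mathbb{k}\overrightarrow{\mathsf{ub}})_\varepsilon$-module $N$ and a $(\mathbb{k}\overrightarrow{\mathsf{db}})_{-\varepsilon}$-module $M$, $N\otimes_{\mathbb{k}\mathsf{FB}}M=\bigoplus_tN(\mathbf t)\otimes_{\mathbb{k}\mathfrak S_t}M(\mathbf t)$. Its differential, from the component $t+2$ to the component $t$, is $x\otimes y\mapsto\sum_{i\ne j}x[\alpha_{(ij)}]\otimes[\alpha_{(ij)}^{\mathrm{op}}]y$,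 where $\alpha_{(ij)}:\mathbf t\to\mathbf{t+2}$ has directed pair $(i,j)$ and is order preserving on $\mathbf t$. * For a right $(\mathbb{k}\mathsf{ub})_{(\delta;\varepsilon)}$-module $N$ and a $(\mathbb{k}\mathsf{db})_{(\delta;-\varepsilon)}$-module $B$, the complex $N\otimes_{\mathbb{k}\mathsf{FB}}B$ is defined in the same way, with the sum over $i<j$ only. All three are complexes graded by $\mathbb N$ (by $m+n$, respectively by $t$), with differentials of degree $-2$. **Theorem.** 1. For $G$ a right $(\mathbb{k}\mathsf{uwb})_\varepsilon$-module and $M$ a $(\mathbb{k}\overrightarrow{\mathsf{db}})_{-\varepsilon}$-module, there is an isomorphism of Koszul complexes, natural in $G$ and $M$, $$G\otimes_{\mathbb{k}(\mathsf{FB}\times\mathsf{FB})}\mathsf d\Upsilon_{-\varepsilon}^*M\;\cong\;(\mathsf d\Upsilon_\varepsilon)_*G\otimes_{\mathbb{k}\mathsf{FB}}M.$$ 2. For $N$ a right $(\mathbb{k}\overrightarrow{\mathsf{ub}})_{\varepsilon}$-module and $B$ a $(\mathbb{k}\mathsf{db})_{(\delta;-\varepsilon)}$-module, there is an isomorphism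 of Koszul complexes, natural in $N$ and $B$, $$N\otimes_{\mathbb{k}\mathsf{FB}}\mathsf{dmp}_{(\delta;-\varepsilon)}^*B\;\cong\;\mathsf{Tr}_{(\delta;\varepsilon)}^*N\otimes_{\mathbb{k}\mathsf{FB}}B,$$ where the left hand side is formed in the directed and the right hand side in the undirected setting. 3. For $G$ a $(\mathbb{k}\mathsf{dwb})_\varepsilon$-module and $B$ a $(\mathbb{k}\mathsf{db})_{(\delta;-\varepsilon)}$-module, there is an isomorphism of Koszul complexes, natural in $G$ and $B$, $$\mathsf d\mathcal J_{(\delta;\varepsilon)}G\otimes_{\mathbb{k}\mathsf{FB}}B\;\cong\;G\otimes_{\mathbb{k}(\mathsf{FB}\times\mathsf{FB})}\mathsf d\upsilon_{(\delta;-\varepsilon)}^*B.$$ -/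

import Mathlib

open CategoryTheory Opposite

universe u v w w'

noncomputable section

namespace Brauer

/-- The opposite of a `k`-linear category is `k`-linear. -/
instance linearOpposite (k : Type*) [Semiring k] (C : Type*) [Category* C] [Preadditive C]
    [Linear k C] : Linear k Cᵒᵖ where
  homModule X Y := Equiv.module k (opEquiv X Y)
  smul_comp _ _ _ c f g := Quiver.Hom.unop_inj (Linear.comp_smul _ _ _ g.unop c f.unop)
  comp_smul _ _ _ f c g := Quiver.Hom.unop_inj (Linear.smul_comp _ _ _ c g.unop f.unop)


/-! ### Twisted linearizations -/

/-- The character `triv` (for `ε = 1`) or `sgn` (for `ε = -1`) of a symmetric group. -/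
def signChar (ε : ℤˣ) (α : Type*) [Fintype α] [DecidableEq α] : Equiv.Perm α →* ℤˣ :=
  if ε = 1 then 1 else Equiv.Perm.sign

/-- Twisting data on a category: `rel s f f'` says that `f'` is to be identified with `s • f`
in the twisted linearization. -/
structure Twist (C : Type w) [Category.{w'} C] where
  rel : ∀ {X Y : C}, ℤˣ → (X ⟶ Y) → (X ⟶ Y) → Prop
  rel_comp : ∀ {X Y Z : C} {s : ℤˣ} {f f' : X ⟶ Y} (g : Y ⟶ Z),
    rel s f f' → rel s (f ≫ g) (f' ≫ g)
  comp_rel : ∀ {X Y Z : C} {s : ℤˣ} (f : X ⟶ Y) {g g' : Y ⟶ Z},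
    rel s g g' → rel s (f ≫ g) (f ≫ g')

/-- The `k`-linear category with the objects of `C`, whose morphisms are the free `k`-modules on
those of `C`, modulo the relations `f' = s • f` for `rel s f f'`. -/
structure Twisted (k : Type u) {C : Type w} [Category.{w'} C] (T : Twist C) where
  ob : C

namespace Twisted

variable {k : Type u} [Field k] {C : Type w} [Category.{w'} C] {T : Twist C}

/-- The relations. -/
def relations (k : Type u) [Field k] {C : Type w} [Category.{w'} C] (T : Twist C) (X Y : C) :
    Submodule k ((X ⟶ Y) →₀ k) :=
  Submodule.span k {z | ∃ (s : ℤˣ) (f f' : X ⟶ Y), T.rel s f f' ∧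
    z = Finsupp.single f' (1 : k) - Finsupp.single f ((s : ℤ) : k)}

/-- Morphisms of the twisted linearization. -/
abbrev Hom (k : Type u) [Field k] {C : Type w} [Category.{w'} C] (T : Twist C) (X Y : C) :
    Type (max u w') :=
  ((X ⟶ Y) →₀ k) ⧸ relations k T X Y

/-- The class `[f]` of a morphism `f`. -/
def cls (k : Type u) [Field k] {C : Type w} [Category.{w'} C] (T : Twist C) {X Y : C}
    (f : X ⟶ Y) : Hom k T X Y :=
  (relations k T X Y).mkQ (Finsupp.single f 1)

lemma cls_rel {X Y : C} {s : ℤˣ} {f f' : X ⟶ Y} (h : T.rel s f f') :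
    cls k T f' = ((s : ℤ) : k) • cls k T f := by
  have : (relations k T X Y).mkQ
      (Finsupp.single f' (1 : k) - Finsupp.single f ((s : ℤ) : k)) = 0 := by
    rw [Submodule.mkQ_apply, Submodule.Quotient.mk_eq_zero]
    exact Submodule.subset_span ⟨s, f, f', h, rfl⟩
  rw [map_sub, sub_eq_zero] at this
  rw [cls, this, cls, ← map_smul, Finsupp.smul_single, smul_eq_mul, mul_one]

lemma hom_induction {X Y : C} {p : Hom k T X Y → Prop} (f : Hom k T X Y)
    (h0 : p 0) (hcls : ∀ g, p (cls k T g)) (hadd : ∀ a b, p a → p b → p (a + b))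
    (hsmul : ∀ (c : k) a, p a → p (c • a)) : p f := by
  obtain ⟨f, rfl⟩ := Submodule.mkQ_surjective _ f
  induction f using Finsupp.induction_linear with
  | zero => rw [map_zero]; exact h0
  | add a b ha hb => rw [map_add]; exact hadd _ _ ha hb
  | single g c =>
    have := hsmul c _ (hcls g)
    rwa [cls, ← map_smul, Finsupp.smul_single, smul_eq_mul, mul_one] at this

/-- Extend a function on morphisms of `C` that is compatible with the relations. -/
def liftHom {X Y : C} {M : Type*} [AddCommGroup M] [Module k M] (φ : (X ⟶ Y) → M)
    (h : ∀ s f f', T.rel s f f' → φ f' = ((s : ℤ) : k) • φ f) : Hom k T X Y →ₗ[k] M :=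
  (relations k T X Y).liftQ (Finsupp.linearCombination k φ) (by
    refine Submodule.span_le.2 ?_
    rintro _ ⟨s, f, f', hr, rfl⟩
    simp [h s f f' hr])

@[simp]
lemma liftHom_cls {X Y : C} {M : Type*} [AddCommGroup M] [Module k M] (φ : (X ⟶ Y) → M)
    (h : ∀ s f f', T.rel s f f' → φ f' = ((s : ℤ) : k) • φ f) (f : X ⟶ Y) :
    liftHom (T := T) φ h (cls k T f) = φ f := by
  unfold liftHom cls
  erw [Submodule.liftQ_apply]
  simp

lemma hom_ext {X Y : C} {M : Type*} [AddCommGroup M] [Module k M] {φ ψ : Hom k T X Y →ₗ[k] M}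
    (h : ∀ f, φ (cls k T f) = ψ (cls k T f)) : φ = ψ := by
  refine Submodule.linearMap_qext _ (Finsupp.lhom_ext' fun f => LinearMap.ext_ring ?_)
  exact h f

/-- Composition, in diagrammatic order. -/
def compHom (X Y Z : C) : Hom k T X Y →ₗ[k] Hom k T Y Z →ₗ[k] Hom k T X Z :=
  liftHom (fun f => liftHom (fun g => cls k T (f ≫ g))
      (fun _ _ _ h => cls_rel (T.comp_rel f h)))
    (fun s f f' h => hom_ext fun g => by simp [cls_rel (T.rel_comp g h)])

@[simp]
lemma compHom_cls {X Y Z : C} (f : X ⟶ Y) (g : Y ⟶ Z) :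
    compHom X Y Z (cls k T f) (cls k T g) = cls k T (f ≫ g) := by
  simp [compHom]

instance : Category (Twisted k T) where
  Hom X Y := Hom k T X.ob Y.ob
  id X := cls k T (𝟙 X.ob)
  comp {X Y Z} f g := compHom X.ob Y.ob Z.ob f g
  id_comp {X Y} f := by
    have : compHom X.ob X.ob Y.ob (cls k T (𝟙 X.ob)) = LinearMap.id :=
      hom_ext fun f => by simp
    exact LinearMap.congr_fun this f
  comp_id {X Y} f := by
    have : (compHom X.ob Y.ob Y.ob).flip (cls k T (𝟙 Y.ob)) = LinearMap.id :=
      hom_ext fun f => by simp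
    exact LinearMap.congr_fun this f
  assoc {W X Y Z} f g h := by
    change compHom _ _ _ (compHom _ _ _ f g) h = compHom _ _ _ f (compHom _ _ _ g h)
    induction f using hom_induction with
    | h0 => simp only [map_zero, LinearMap.zero_apply]
    | hadd a b ha hb => simp only [map_add, LinearMap.add_apply, ha, hb]
    | hsmul c a ha => simp only [map_smul, LinearMap.smul_apply, ha]
    | hcls f =>
    induction g using hom_induction with
    | h0 => simp only [map_zero, LinearMap.zero_apply]
    | hadd a b ha hb => simp only [map_add, LinearMap.add_apply, ha, hb]
    | hsmul c a ha => simp only [map_smul, LinearMap.smul_apply, ha]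
    | hcls g =>
    induction h using hom_induction with
    | h0 => simp only [map_zero]
    | hadd a b ha hb => simp only [map_add, ha, hb]
    | hsmul c a ha => simp only [map_smul, ha]
    | hcls h => simp only [compHom_cls, Category.assoc]

instance : Preadditive (Twisted k T) where
  homGroup X Y := inferInstanceAs (AddCommGroup (Hom k T X.ob Y.ob))
  add_comp X Y Z f f' g := LinearMap.map_add₂ (compHom X.ob Y.ob Z.ob) f f' g
  comp_add X Y Z f g g' := (compHom X.ob Y.ob Z.ob f).map_add g g'

instance : Linear k (Twisted k T) where
  homModule X Y := inferInstanceAs (Module k (Hom k T X.ob Y.ob))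
  smul_comp X Y Z c f g := LinearMap.map_smul₂ (compHom X.ob Y.ob Z.ob) c f g
  comp_smul X Y Z f c g := (compHom X.ob Y.ob Z.ob f).map_smul c g

/-- The functor `f ↦ [f]` from `C` to its twisted linearization. -/
def of (k : Type u) [Field k] {C : Type w} [Category.{w'} C] (T : Twist C) : C ⥤ Twisted k T where
  obj X := ⟨X⟩
  map f := cls k T f
  map_id _ := rfl
  map_comp f g := (compHom_cls f g).symm

lemma of_rel {X Y : C} {s : ℤˣ} {f f' : X ⟶ Y} (h : T.rel s f f') :
    (of k T).map f' = ((s : ℤ) : k) • (of k T).map f :=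
  cls_rel h

/-- Morphisms are linear combinations of classes. -/
lemma induction {X Y : C} {p : ((of k T).obj X ⟶ (of k T).obj Y) → Prop}
    (f : (of k T).obj X ⟶ (of k T).obj Y) (h0 : p 0)
    (hof : ∀ g : X ⟶ Y, p ((of k T).map g)) (hadd : ∀ a b, p a → p b → p (a + b))
    (hsmul : ∀ (c : k) a, p a → p (c • a)) : p f :=
  hom_induction f h0 hof hadd hsmul

section
variable {D : Type*} [Category* D] [Preadditive D] [Linear k D] (F : C ⥤ D)
    (h : ∀ (X Y : C) (s : ℤˣ) (f f' : X ⟶ Y), T.rel s f f' →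
      F.map f' = ((s : ℤ) : k) • F.map f)

/-- The action on morphisms of the functor `lift` below. -/
def liftMap (X Y : C) : ((of k T).obj X ⟶ (of k T).obj Y) →ₗ[k] (F.obj X ⟶ F.obj Y) :=
  liftHom (T := T) (fun g : X ⟶ Y => F.map g) (h X Y)

@[simp]
lemma liftMap_of {X Y : C} (f : X ⟶ Y) : liftMap F h X Y ((of k T).map f) = F.map f :=
  liftHom_cls _ _ f

lemma liftMap_comp {X Y Z : C} (f : (of k T).obj X ⟶ (of k T).obj Y)
    (g : (of k T).obj Y ⟶ (of k T).obj Z) :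
    liftMap F h X Z (f ≫ g) = liftMap F h X Y f ≫ liftMap F h Y Z g := by
  induction f using induction with
  | h0 => simp
  | hadd a b ha hb => simp only [map_add, Preadditive.add_comp, ha, hb]
  | hsmul c a ha => simp only [map_smul, Linear.smul_comp, ha]
  | hof f =>
  induction g using induction with
  | h0 => simp
  | hadd a b ha hb => simp only [map_add, Preadditive.comp_add, ha, hb]
  | hsmul c a ha => simp only [map_smul, Linear.comp_smul, ha]
  | hof g => rw [← Functor.map_comp, liftMap_of, liftMap_of, liftMap_of, Functor.map_comp]

/-- The `k`-linear functor induced by a functor on `C` that is compatible with the relations. -/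
def lift : Twisted k T ⥤ D where
  obj X := F.obj X.ob
  map {X Y} f := liftMap F h X.ob Y.ob f
  map_id X := (liftMap_of F h (𝟙 X.ob)).trans (F.map_id _)
  map_comp f g := liftMap_comp F h f g

instance lift_additive : (lift F h).Additive where
  map_add {X Y _ _} := map_add (liftMap F h X.ob Y.ob) _ _

instance lift_linear : (lift F h).Linear k where
  map_smul {X Y} _ _ := map_smul (liftMap F h X.ob Y.ob) _ _

@[simp]
lemma lift_map_of {X Y : C} (f : X ⟶ Y) : (lift F h).map ((of k T).map f) = F.map f :=
  liftMap_of F h f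

end

/-- Naturality of transformations between contravariant linear functors on a twisted linearization
may be checked on classes. -/
lemma natural_op {D : Type*} [Category* D] [Preadditive D] [Linear k D]
    {F G : (Twisted k T)ᵒᵖ ⥤ D} (hF : F.Additive ∧ F.Linear k) (hG : G.Additive ∧ G.Linear k)
    (τ : ∀ X, F.obj X ⟶ G.obj X)
    (h : ∀ {X Y : C} (f : X ⟶ Y),
      F.map ((of k T).map f).op ≫ τ _ = τ _ ≫ G.map ((of k T).map f).op)
    {X Y : (Twisted k T)ᵒᵖ} (f : X ⟶ Y) : F.map f ≫ τ Y = τ X ≫ G.map f := by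
  obtain ⟨_, _⟩ := hF
  obtain ⟨_, _⟩ := hG
  suffices H : ∀ (X Y : C) (f : (of k T).obj X ⟶ (of k T).obj Y),
      F.map f.op ≫ τ _ = τ _ ≫ G.map f.op from H Y.unop.ob X.unop.ob f.unop
  intro X Y f
  induction f using induction with
  | h0 => simp
  | hadd a b ha hb =>
    simp only [op_add, Functor.map_add, Preadditive.add_comp, Preadditive.comp_add, ha, hb]
  | hsmul c a ha =>
    have : (c • a).op = c • a.op := rfl
    simp only [this, Functor.map_smul, Linear.smul_comp, Linear.comp_smul, ha]
  | hof f => exact h f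

end Twisted

/-! ### The ordered directed upward Brauer category -/

/-- Finite sets, as objects of the ordered directed upward Brauer category. -/
structure DubOrd where
  carrier : Type
  [finite : Finite carrier]

attribute [instance] DubOrd.finite

namespace DubOrd

/-- A morphism of degree `t` from `A` to `B` is a bijection `A ⨿ (2 × t) ≃ B`; the directed pairs
are the `(f (1, i), f (2, i))`, ordered by `i`. (The two elements of `2` are `0, 1 : Fin 2`.) -/
structure Hom (A B : Type) where
  deg : ℕ
  equiv : A ⊕ (Fin 2 × Fin deg) ≃ B

namespace Hom

variable {A B C D : Type}

lemma ext' {f g : Hom A B} (h : f.deg = g.deg)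
    (h₁ : ∀ a, f.equiv (Sum.inl a) = g.equiv (Sum.inl a))
    (h₂ : ∀ c i, f.equiv (Sum.inr (c, i)) = g.equiv (Sum.inr (c, Fin.cast h i))) : f = g := by
  obtain ⟨s, f⟩ := f
  obtain ⟨t, g⟩ := g
  obtain rfl : s = t := h
  congr 1
  ext (a | ⟨c, i⟩)
  · exact h₁ a
  · exact h₂ c i

/-- The degree zero morphism given by a bijection. -/
def ofEquiv (e : A ≃ B) : Hom A B where
  deg := 0
  equiv := (Equiv.sumEmpty A (Fin 2 × Fin 0)).trans e

/-- `2 × (s + t) = (2 × s) ⨿ (2 × t)`. -/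
def splitPairs (s t : ℕ) : Fin 2 × Fin (s + t) ≃ (Fin 2 × Fin s) ⊕ (Fin 2 × Fin t) :=
  ((Equiv.refl _).prodCongr finSumFinEquiv.symm).trans (Equiv.prodSumDistrib _ _ _)

lemma splitPairs_castAdd (s t : ℕ) (c : Fin 2) (i : Fin s) :
    splitPairs s t (c, Fin.castAdd t i) = Sum.inl (c, i) := by
  simp only [splitPairs, Equiv.trans_apply, Equiv.prodCongr_apply, Prod.map_apply,
    finSumFinEquiv_symm_apply_castAdd, Equiv.prodSumDistrib_apply_left]
  rfl

lemma splitPairs_natAdd (s t : ℕ) (c : Fin 2) (i : Fin t) :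
    splitPairs s t (c, Fin.natAdd s i) = Sum.inr (c, i) := by
  simp only [splitPairs, Equiv.trans_apply, Equiv.prodCongr_apply, Prod.map_apply,
    finSumFinEquiv_symm_apply_natAdd, Equiv.prodSumDistrib_apply_right]
  rfl

/-- Composition (in diagrammatic order): the directed pairs of `f` come first. -/
def comp (f : Hom A B) (g : Hom B C) : Hom A C where
  deg := f.deg + g.deg
  equiv := (((Equiv.refl A).sumCongr (splitPairs f.deg g.deg)).trans
    (Equiv.sumAssoc _ _ _).symm).trans ((f.equiv.sumCongr (Equiv.refl _)).trans g.equiv)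

@[simp] lemma ofEquiv_deg (e : A ≃ B) : (ofEquiv e).deg = 0 := rfl

@[simp] lemma ofEquiv_inl (e : A ≃ B) (a : A) : (ofEquiv e).equiv (Sum.inl a) = e a := rfl

@[simp] lemma comp_deg (f : Hom A B) (g : Hom B C) : (f.comp g).deg = f.deg + g.deg := rfl

@[simp] lemma comp_inl (f : Hom A B) (g : Hom B C) (a : A) :
    (f.comp g).equiv (Sum.inl a) = g.equiv (Sum.inl (f.equiv (Sum.inl a))) := rfl

@[simp] lemma comp_castAdd (f : Hom A B) (g : Hom B C) (c : Fin 2) (i : Fin f.deg) :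
    (f.comp g).equiv (Sum.inr (c, Fin.castAdd g.deg i)) =
      g.equiv (Sum.inl (f.equiv (Sum.inr (c, i)))) := by
  change g.equiv ((f.equiv.sumCongr (Equiv.refl _)) ((Equiv.sumAssoc _ _ _).symm
    (Sum.inr (splitPairs f.deg g.deg (c, Fin.castAdd g.deg i))))) = _
  rw [splitPairs_castAdd]
  rfl

@[simp] lemma comp_natAdd (f : Hom A B) (g : Hom B C) (c : Fin 2) (i : Fin g.deg) :
    (f.comp g).equiv (Sum.inr (c, Fin.natAdd f.deg i)) = g.equiv (Sum.inr (c, i)) := by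
  change g.equiv ((f.equiv.sumCongr (Equiv.refl _)) ((Equiv.sumAssoc _ _ _).symm
    (Sum.inr (splitPairs f.deg g.deg (c, Fin.natAdd f.deg i))))) = _
  rw [splitPairs_natAdd]
  rfl

lemma ext_comp {f : Hom A B} {g : Hom B C} {h : Hom A C} (hd : f.deg + g.deg = h.deg)
    (h₁ : ∀ a, (f.comp g).equiv (Sum.inl a) = h.equiv (Sum.inl a))
    (h₂ : ∀ c i, g.equiv (Sum.inl (f.equiv (Sum.inr (c, i)))) =
      h.equiv (Sum.inr (c, Fin.cast hd (Fin.castAdd g.deg i))))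
    (h₃ : ∀ c i, g.equiv (Sum.inr (c, i)) =
      h.equiv (Sum.inr (c, Fin.cast hd (Fin.natAdd f.deg i)))) : f.comp g = h := by
  refine ext' hd h₁ fun c i => ?_
  refine Fin.addCases (fun i => ?_) (fun i => ?_) i
  · rw [comp_castAdd, h₂]; rfl
  · rw [comp_natAdd, h₃]; rfl

/-- The permutation of `2 × t` given by `σ` in `𝔖_t` and a family `c` in `𝔖_2 ^ t`. -/
def wreath {t : ℕ} (σ : Equiv.Perm (Fin t)) (c : Fin t → Equiv.Perm (Fin 2)) :
    Equiv.Perm (Fin 2 × Fin t) where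
  toFun p := (c p.2 p.1, σ p.2)
  invFun p := ((c (σ.symm p.2)).symm p.1, σ.symm p.2)
  left_inv p := by simp
  right_inv p := by simp

/-- The right action of the wreath product `𝔖_2 ≀ 𝔖_t` on morphisms of degree `t`. -/
def act (f : Hom A B) (σ : Equiv.Perm (Fin f.deg)) (c : Fin f.deg → Equiv.Perm (Fin 2)) :
    Hom A B where
  deg := f.deg
  equiv := ((Equiv.refl A).sumCongr (wreath σ c)).trans f.equiv

@[simp] lemma act_deg (f : Hom A B) (σ c) : (f.act σ c).deg = f.deg := rfl

@[simp] lemma act_inl (f : Hom A B) (σ c) (a : A) :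
    (f.act σ c).equiv (Sum.inl a) = f.equiv (Sum.inl a) := rfl

@[simp] lemma act_inr (f : Hom A B) (σ c) (d : Fin 2) (i : Fin f.deg) :
    (f.act σ c).equiv (Sum.inr (d, i)) = f.equiv (Sum.inr (c i d, σ i)) := rfl

/-- `σ ⨿ τ` as a permutation of `s + t`. -/
def sumPerm {s t : ℕ} (σ : Equiv.Perm (Fin s)) (τ : Equiv.Perm (Fin t)) :
    Equiv.Perm (Fin (s + t)) :=
  finSumFinEquiv.permCongr (σ.sumCongr τ)

@[simp] lemma sumPerm_castAdd {s t : ℕ} (σ : Equiv.Perm (Fin s)) (τ : Equiv.Perm (Fin t))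
    (i : Fin s) : sumPerm σ τ (Fin.castAdd t i) = Fin.castAdd t (σ i) := by
  simp [sumPerm, Equiv.permCongr_apply]

@[simp] lemma sumPerm_natAdd {s t : ℕ} (σ : Equiv.Perm (Fin s)) (τ : Equiv.Perm (Fin t))
    (i : Fin t) : sumPerm σ τ (Fin.natAdd s i) = Fin.natAdd s (τ i) := by
  simp [sumPerm, Equiv.permCongr_apply]

lemma signChar_sumPerm (ε : ℤˣ) {s t : ℕ} (σ : Equiv.Perm (Fin s)) (τ : Equiv.Perm (Fin t)) :
    signChar ε _ (sumPerm σ τ) = signChar ε _ σ * signChar ε _ τ := by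
  unfold signChar
  split
  · simp
  · rw [sumPerm, Equiv.Perm.sign_permCongr, Equiv.Perm.sign_sumCongr]

/-- The character `(k^δ; k^ε)` of the wreath product. -/
def wreathChar (δ ε : ℤˣ) {t : ℕ} (σ : Equiv.Perm (Fin t)) (c : Fin t → Equiv.Perm (Fin 2)) :
    ℤˣ :=
  (∏ i, signChar δ (Fin 2) (c i)) * signChar ε (Fin t) σ

lemma wreathChar_one (δ ε : ℤˣ) {t : ℕ} :
    wreathChar δ ε (1 : Equiv.Perm (Fin t)) (fun _ => 1) = 1 := by
  simp [wreathChar]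

lemma wreathChar_append (δ ε : ℤˣ) {s t : ℕ} (σ : Equiv.Perm (Fin s)) (τ : Equiv.Perm (Fin t))
    (c d) : wreathChar δ ε (sumPerm σ τ) (Fin.append c d) =
      wreathChar δ ε σ c * wreathChar δ ε τ d := by
  simp only [wreathChar, signChar_sumPerm, Fin.prod_univ_add, Fin.append_left, Fin.append_right]
  exact mul_mul_mul_comm _ _ _ _

lemma act_comp_act (f : Hom A B) (g : Hom B C) (σ τ c d) :
    (f.act σ c).comp (g.act τ d) = (f.comp g).act (sumPerm σ τ) (Fin.append c d) :=
  ext_comp rfl (fun _ => rfl)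
    (fun (a : Fin 2) (i : Fin f.deg) =>
      (comp_castAdd f g (c i a) (σ i)).symm.trans <|
        congrArg (fun p => (f.comp g).equiv (Sum.inr p)) <|
          show ((c i a, Fin.castAdd g.deg (σ i)) : Fin 2 × Fin (f.deg + g.deg)) =
            (Fin.append c d (Fin.castAdd g.deg i) a, sumPerm σ τ (Fin.castAdd g.deg i)) by
          rw [sumPerm_castAdd, Fin.append_left])
    (fun (a : Fin 2) (i : Fin g.deg) =>
      (comp_natAdd f g (d i a) (τ i)).symm.trans <|
        congrArg (fun p => (f.comp g).equiv (Sum.inr p)) <|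
          show ((d i a, Fin.natAdd f.deg (τ i)) : Fin 2 × Fin (f.deg + g.deg)) =
            (Fin.append c d (Fin.natAdd f.deg i) a, sumPerm σ τ (Fin.natAdd f.deg i)) by
          rw [sumPerm_natAdd, Fin.append_right])

lemma act_one (f : Hom A B) : f.act 1 (fun _ => 1) = f :=
  ext' rfl (fun _ => rfl) (fun _ _ => rfl)

lemma act_act (f : Hom A B) (σ : Equiv.Perm (Fin f.deg)) (c)
    (τ : Equiv.Perm (Fin f.deg)) (d : Fin f.deg → Equiv.Perm (Fin 2)) :
    (f.act σ c).act τ d = f.act (σ * τ) (fun i => c (τ i) * d i) :=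
  ext' rfl (fun _ => rfl) (fun _ _ => rfl)

end Hom

instance : Category DubOrd where
  Hom A B := Hom A.carrier B.carrier
  id A := Hom.ofEquiv (Equiv.refl A.carrier)
  comp f g := Hom.comp f g
  id_comp f := Hom.ext_comp (Nat.zero_add _) (fun _ => rfl) (fun _ i => i.elim0)
    (fun c i => congrArg (fun j => f.equiv (Sum.inr (c, j))) (Fin.ext (by simp)))
  comp_id f := Hom.ext_comp rfl (fun _ => rfl) (fun c i => rfl) (fun _ i => i.elim0)
  assoc f g h := by
    refine Hom.ext_comp (Nat.add_assoc _ _ _) (fun _ => rfl) (fun c i => ?_) (fun c i => ?_)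
    · refine Fin.addCases (fun i => ?_) (fun i => ?_) i
      · rw [Hom.comp_castAdd]
        exact (Hom.comp_castAdd f (g.comp h) c i).symm
      · rw [Hom.comp_natAdd]
        exact ((Hom.comp_natAdd f (g.comp h) c (Fin.castAdd h.deg i)).trans
          (Hom.comp_castAdd g h c i)).symm
    · refine ((Hom.comp_natAdd f (g.comp h) c (Fin.natAdd g.deg i)).trans
          (Hom.comp_natAdd g h c i)).symm.trans ?_
      exact congrArg (fun j => (f.comp (g.comp h)).equiv (Sum.inr (c, j)))
        (Fin.ext (by simp [Nat.add_assoc]))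

/-- A bijection as a (degree zero) isomorphism. -/
def isoOfEquiv {A B : DubOrd} (e : A.carrier ≃ B.carrier) : A ≅ B where
  hom := Hom.ofEquiv e
  inv := Hom.ofEquiv e.symm
  hom_inv_id := Hom.ext_comp rfl (fun a => e.symm_apply_apply a) (fun _ i => i.elim0)
    (fun _ i => i.elim0)
  inv_hom_id := Hom.ext_comp rfl (fun a => e.apply_symm_apply a) (fun _ i => i.elim0)
    (fun _ i => i.elim0)

/-- Reordering the directed pairs by `σ` is multiplication by `triv` or `sgn`, according to `ε`. -/
def twist (ε : ℤˣ) : Twist DubOrd where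
  rel {A B} s f f' := ∃ σ : Equiv.Perm (Fin (Hom.deg f)),
    s = signChar ε _ σ ∧ f' = Hom.act (A := A.carrier) (B := B.carrier) f σ (fun _ => 1)
  rel_comp {A B C s f f'} g := by
    rintro ⟨σ, rfl, rfl⟩
    refine ⟨Hom.sumPerm σ (1 : Equiv.Perm (Fin (Hom.deg g))), ?_, ?_⟩
    · exact ((Hom.signChar_sumPerm ε σ _).trans (by rw [map_one, mul_one])).symm
    · have := Hom.act_comp_act (A := A.carrier) f g σ 1 (fun _ => 1) (fun _ => 1)
      rw [Hom.act_one] at this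
      refine this.trans (congrArg (Hom.act _ _) ?_)
      funext i
      exact Fin.addCases (fun i => by simp) (fun i => by simp) i
  comp_rel {A B C s} f {g g'} := by
    rintro ⟨σ, rfl, rfl⟩
    refine ⟨Hom.sumPerm (1 : Equiv.Perm (Fin (Hom.deg f))) σ, ?_, ?_⟩
    · exact ((Hom.signChar_sumPerm ε _ σ).trans (by rw [map_one, one_mul])).symm
    · have := Hom.act_comp_act (A := A.carrier) f g 1 σ (fun _ => 1) (fun _ => 1)
      rw [Hom.act_one] at this
      refine this.trans (congrArg (Hom.act _ _) ?_)
      funext i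
      exact Fin.addCases (fun i => by simp) (fun i => by simp) i

/-- The twist for undirected pairs: `𝔖_2 ≀ 𝔖_t` acts through its character `(k^δ; k^ε)`. -/
def twist₂ (δ ε : ℤˣ) : Twist DubOrd where
  rel {A B} s f f' := ∃ (σ : Equiv.Perm (Fin (Hom.deg f)))
    (c : Fin (Hom.deg f) → Equiv.Perm (Fin 2)),
    s = Hom.wreathChar δ ε σ c ∧
      f' = Hom.act (A := A.carrier) (B := B.carrier) f σ c
  rel_comp {A B C s f f'} g := by
    rintro ⟨σ, c, rfl, rfl⟩
    refine ⟨Hom.sumPerm σ (1 : Equiv.Perm (Fin (Hom.deg g))),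
      Fin.append c (fun _ : Fin (Hom.deg g) => 1), ?_, ?_⟩
    · exact ((Hom.wreathChar_append δ ε σ _ c _).trans (by rw [Hom.wreathChar_one, mul_one])).symm
    · have := Hom.act_comp_act (A := A.carrier) f g σ 1 c (fun _ => 1)
      rwa [Hom.act_one] at this
  comp_rel {A B C s} f {g g'} := by
    rintro ⟨σ, c, rfl, rfl⟩
    refine ⟨Hom.sumPerm (1 : Equiv.Perm (Fin (Hom.deg f))) σ,
      Fin.append (fun _ : Fin (Hom.deg f) => 1) c, ?_, ?_⟩
    · exact ((Hom.wreathChar_append δ ε _ σ _ c).trans (by rw [Hom.wreathChar_one, one_mul])).symm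
    · have := Hom.act_comp_act (A := A.carrier) f g 1 σ (fun _ => 1) c
      rwa [Hom.act_one] at this

end DubOrd

/-! ### The ordered upward walled Brauer category -/

/-- Pairs of finite sets, as objects of the ordered upward walled Brauer category. -/
structure UwbOrd where
  left : Type
  right : Type
  [finite_left : Finite left]
  [finite_right : Finite right]

attribute [instance] UwbOrd.finite_left UwbOrd.finite_right

namespace UwbOrd

/-- A morphism of degree `n` from `(X, Y)` to `(U, V)` is a pair of bijections `X ⨿ n ≃ U` and
`Y ⨿ n ≃ V`; the walled pairs are the `(l i, r i)`, ordered by `i`. -/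
structure Hom (X Y U V : Type) where
  deg : ℕ
  l : X ⊕ Fin deg ≃ U
  r : Y ⊕ Fin deg ≃ V

namespace Hom

variable {X Y U V Z W : Type}

lemma ext' {f g : Hom X Y U V} (h : f.deg = g.deg)
    (h₁ : ∀ a, f.l (Sum.inl a) = g.l (Sum.inl a))
    (h₂ : ∀ a, f.r (Sum.inl a) = g.r (Sum.inl a))
    (h₃ : ∀ i, f.l (Sum.inr i) = g.l (Sum.inr (Fin.cast h i)))
    (h₄ : ∀ i, f.r (Sum.inr i) = g.r (Sum.inr (Fin.cast h i))) : f = g := by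
  obtain ⟨s, f, f'⟩ := f
  obtain ⟨t, g, g'⟩ := g
  obtain rfl : s = t := h
  congr 1
  · ext (a | i)
    · exact h₁ a
    · exact h₃ i
  · ext (a | i)
    · exact h₂ a
    · exact h₄ i

/-- The degree zero morphism given by a pair of bijections. -/
def ofEquiv (e : X ≃ U) (e' : Y ≃ V) : Hom X Y U V where
  deg := 0
  l := (Equiv.sumEmpty X (Fin 0)).trans e
  r := (Equiv.sumEmpty Y (Fin 0)).trans e'

/-- Composition of the bijections. -/
def compAux {s t : ℕ} (f : X ⊕ Fin s ≃ U) (g : U ⊕ Fin t ≃ Z) : X ⊕ Fin (s + t) ≃ Z :=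
  (((Equiv.refl X).sumCongr finSumFinEquiv.symm).trans (Equiv.sumAssoc _ _ _).symm).trans
    ((f.sumCongr (Equiv.refl _)).trans g)

/-- Composition (in diagrammatic order): the walled pairs of `f` come first. -/
def comp (f : Hom X Y U V) (g : Hom U V Z W) : Hom X Y Z W where
  deg := f.deg + g.deg
  l := compAux f.l g.l
  r := compAux f.r g.r

lemma compAux_castAdd {s t : ℕ} (f : X ⊕ Fin s ≃ U) (g : U ⊕ Fin t ≃ Z) (i : Fin s) :
    compAux f g (Sum.inr (Fin.castAdd t i)) = g (Sum.inl (f (Sum.inr i))) := by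
  change g ((f.sumCongr (Equiv.refl _)) ((Equiv.sumAssoc _ _ _).symm
    (Sum.inr (finSumFinEquiv.symm (Fin.castAdd t i))))) = _
  rw [finSumFinEquiv_symm_apply_castAdd]
  rfl

lemma compAux_natAdd {s t : ℕ} (f : X ⊕ Fin s ≃ U) (g : U ⊕ Fin t ≃ Z) (i : Fin t) :
    compAux f g (Sum.inr (Fin.natAdd s i)) = g (Sum.inr i) := by
  change g ((f.sumCongr (Equiv.refl _)) ((Equiv.sumAssoc _ _ _).symm
    (Sum.inr (finSumFinEquiv.symm (Fin.natAdd s i))))) = _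
  rw [finSumFinEquiv_symm_apply_natAdd]
  rfl

lemma ext_comp {f : Hom X Y U V} {g : Hom U V Z W} {h : Hom X Y Z W}
    (hd : f.deg + g.deg = h.deg)
    (h₁ : ∀ a, (f.comp g).l (Sum.inl a) = h.l (Sum.inl a))
    (h₂ : ∀ a, (f.comp g).r (Sum.inl a) = h.r (Sum.inl a))
    (h₃ : ∀ i, g.l (Sum.inl (f.l (Sum.inr i))) =
      h.l (Sum.inr (Fin.cast hd (Fin.castAdd g.deg i))))
    (h₄ : ∀ i, g.r (Sum.inl (f.r (Sum.inr i))) =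
      h.r (Sum.inr (Fin.cast hd (Fin.castAdd g.deg i))))
    (h₅ : ∀ i, g.l (Sum.inr i) = h.l (Sum.inr (Fin.cast hd (Fin.natAdd f.deg i))))
    (h₆ : ∀ i, g.r (Sum.inr i) = h.r (Sum.inr (Fin.cast hd (Fin.natAdd f.deg i)))) :
    f.comp g = h := by
  refine ext' hd h₁ h₂ (fun i => ?_) (fun i => ?_)
  · exact Fin.addCases (fun i => (compAux_castAdd f.l g.l i).trans (h₃ i))
      (fun i => (compAux_natAdd f.l g.l i).trans (h₅ i)) i
  · exact Fin.addCases (fun i => (compAux_castAdd f.r g.r i).trans (h₄ i))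
      (fun i => (compAux_natAdd f.r g.r i).trans (h₆ i)) i

lemma compAux_assoc {r s t : ℕ} (f : X ⊕ Fin r ≃ Y) (g : Y ⊕ Fin s ≃ U) (h : U ⊕ Fin t ≃ V)
    (i : Fin (r + s + t)) :
    compAux (compAux f g) h (Sum.inr i) =
      compAux f (compAux g h) (Sum.inr (Fin.cast (Nat.add_assoc r s t) i)) := by
  refine Fin.addCases (fun i => ?_) (fun i => ?_) i
  · refine Fin.addCases (fun i => ?_) (fun i => ?_) i
    · rw [compAux_castAdd, compAux_castAdd]
      exact (compAux_castAdd f (compAux g h) i).symm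
    · rw [compAux_castAdd, compAux_natAdd]
      exact ((compAux_natAdd f (compAux g h) (Fin.castAdd t i)).trans
        (compAux_castAdd g h i)).symm
  · rw [compAux_natAdd]
    refine ((compAux_natAdd f (compAux g h) (Fin.natAdd s i)).trans
      (compAux_natAdd g h i)).symm.trans ?_
    exact congrArg (fun j => compAux f (compAux g h) (Sum.inr j))
      (Fin.ext (Nat.add_assoc _ _ _).symm)

/-- The right (diagonal) action of `𝔖_n` on morphisms of degree `n`. -/
def act (f : Hom X Y U V) (σ : Equiv.Perm (Fin f.deg)) : Hom X Y U V where
  deg := f.deg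
  l := ((Equiv.refl X).sumCongr σ).trans f.l
  r := ((Equiv.refl Y).sumCongr σ).trans f.r

lemma act_one (f : Hom X Y U V) : f.act 1 = f :=
  ext' rfl (fun _ => rfl) (fun _ => rfl) (fun _ => rfl) (fun _ => rfl)

lemma act_comp_act (f : Hom X Y U V) (g : Hom U V Z W) (σ τ) :
    (f.act σ).comp (g.act τ) = (f.comp g).act (DubOrd.Hom.sumPerm σ τ) :=
  ext_comp rfl (fun _ => rfl) (fun _ => rfl)
    (fun (i : Fin f.deg) => (compAux_castAdd f.l g.l (σ i)).symm.trans <|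
      congrArg (fun p => (f.comp g).l (Sum.inr p)) (DubOrd.Hom.sumPerm_castAdd σ τ i).symm)
    (fun (i : Fin f.deg) => (compAux_castAdd f.r g.r (σ i)).symm.trans <|
      congrArg (fun p => (f.comp g).r (Sum.inr p)) (DubOrd.Hom.sumPerm_castAdd σ τ i).symm)
    (fun (i : Fin g.deg) => (compAux_natAdd f.l g.l (τ i)).symm.trans <|
      congrArg (fun p => (f.comp g).l (Sum.inr p)) (DubOrd.Hom.sumPerm_natAdd σ τ i).symm)
    (fun (i : Fin g.deg) => (compAux_natAdd f.r g.r (τ i)).symm.trans <|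
      congrArg (fun p => (f.comp g).r (Sum.inr p)) (DubOrd.Hom.sumPerm_natAdd σ τ i).symm)

end Hom

instance : Category UwbOrd where
  Hom A B := Hom A.left A.right B.left B.right
  id A := Hom.ofEquiv (Equiv.refl A.left) (Equiv.refl A.right)
  comp f g := Hom.comp f g
  id_comp f := Hom.ext_comp (Nat.zero_add _) (fun _ => rfl) (fun _ => rfl)
    (fun i => i.elim0) (fun i => i.elim0)
    (fun _ => congrArg (fun j => f.l (Sum.inr j)) (Fin.ext (Nat.zero_add _).symm))
    (fun _ => congrArg (fun j => f.r (Sum.inr j)) (Fin.ext (Nat.zero_add _).symm))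
  comp_id _ := Hom.ext_comp rfl (fun _ => rfl) (fun _ => rfl) (fun _ => rfl) (fun _ => rfl)
    (fun i => i.elim0) (fun i => i.elim0)
  assoc f g h := Hom.ext' (Nat.add_assoc _ _ _) (fun _ => rfl) (fun _ => rfl)
    (Hom.compAux_assoc f.l g.l h.l) (Hom.compAux_assoc f.r g.r h.r)

/-- A pair of bijections as a (degree zero) isomorphism. -/
def isoOfEquiv {A B : UwbOrd} (e : A.left ≃ B.left) (e' : A.right ≃ B.right) : A ≅ B where
  hom := Hom.ofEquiv e e'
  inv := Hom.ofEquiv e.symm e'.symm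
  hom_inv_id := Hom.ext_comp rfl (fun a => e.symm_apply_apply a) (fun a => e'.symm_apply_apply a)
    (fun i => i.elim0) (fun i => i.elim0) (fun i => i.elim0) (fun i => i.elim0)
  inv_hom_id := Hom.ext_comp rfl (fun a => e.apply_symm_apply a) (fun a => e'.apply_symm_apply a)
    (fun i => i.elim0) (fun i => i.elim0) (fun i => i.elim0) (fun i => i.elim0)

/-- Reordering the walled pairs by `σ` is multiplication by `triv` or `sgn`, according to `ε`. -/
def twist (ε : ℤˣ) : Twist UwbOrd where
  rel {A B} s f f' := ∃ σ : Equiv.Perm (Fin (Hom.deg f)), s = signChar ε _ σ ∧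
    f' = Hom.act (X := A.left) (Y := A.right) (U := B.left) (V := B.right) f σ
  rel_comp {A B C s f f'} g := by
    rintro ⟨σ, rfl, rfl⟩
    refine ⟨DubOrd.Hom.sumPerm σ (1 : Equiv.Perm (Fin (Hom.deg g))), ?_, ?_⟩
    · exact ((DubOrd.Hom.signChar_sumPerm ε σ _).trans (by rw [map_one, mul_one])).symm
    · have := Hom.act_comp_act (X := A.left) (Y := A.right) f g σ 1
      rwa [Hom.act_one] at this
  comp_rel {A B C s} f {g g'} := by
    rintro ⟨σ, rfl, rfl⟩
    refine ⟨DubOrd.Hom.sumPerm (1 : Equiv.Perm (Fin (Hom.deg f))) σ, ?_, ?_⟩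
    · exact ((DubOrd.Hom.signChar_sumPerm ε _ σ).trans (by rw [map_one, one_mul])).symm
    · have := Hom.act_comp_act (X := A.left) (Y := A.right) f g 1 σ
      rwa [Hom.act_one] at this

/-- The disjoint union of the two bijections of a morphism, using `n ⨿ n = 2 × n`. -/
def unwEquiv {X Y U V : Type} {n : ℕ} (l : X ⊕ Fin n ≃ U) (r : Y ⊕ Fin n ≃ V) :
    (X ⊕ Y) ⊕ (Fin 2 × Fin n) ≃ U ⊕ V :=
  (((Equiv.refl (X ⊕ Y)).sumCongr
    ((finTwoEquiv.prodCongr (Equiv.refl (Fin n))).trans (Equiv.boolProdEquivSum (Fin n)))).trans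
    (Equiv.sumSumSumComm X Y (Fin n) (Fin n))).trans (l.sumCongr r)

end UwbOrd

/-- The unwalling functor, given by the disjoint union. -/
def unW : UwbOrd ⥤ DubOrd where
  obj A := ⟨A.left ⊕ A.right⟩
  map f := ⟨f.deg, UwbOrd.unwEquiv f.l f.r⟩
  map_id A := by
    refine DubOrd.Hom.ext' rfl (fun a => ?_) (fun _ i => i.elim0)
    rcases a with a | a <;> rfl
  map_comp {A B C} f g := by
    refine (DubOrd.Hom.ext_comp (A := A.left ⊕ A.right) (f := ⟨f.deg, UwbOrd.unwEquiv f.l f.r⟩)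
      (g := ⟨g.deg, UwbOrd.unwEquiv g.l g.r⟩) rfl (fun a => ?_) (fun c i => ?_)
      (fun c i => ?_)).symm
    · rcases a with a | a <;> rfl
    · revert c
      exact Fin.forall_fin_two.2
        ⟨congrArg Sum.inl (UwbOrd.Hom.compAux_castAdd f.l g.l i).symm,
          congrArg Sum.inr (UwbOrd.Hom.compAux_castAdd f.r g.r i).symm⟩
    · revert c
      exact Fin.forall_fin_two.2
        ⟨congrArg Sum.inl (UwbOrd.Hom.compAux_natAdd f.l g.l i).symm,
          congrArg Sum.inr (UwbOrd.Hom.compAux_natAdd f.r g.r i).symm⟩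


lemma unW_rel (ε : ℤˣ) {A B : UwbOrd} {s : ℤˣ} {f f' : A ⟶ B} (h : (UwbOrd.twist ε).rel s f f') :
    (DubOrd.twist ε).rel s (unW.map f) (unW.map f') := by
  obtain ⟨σ, rfl, rfl⟩ := h
  refine ⟨σ, rfl, DubOrd.Hom.ext' rfl (fun a => ?_) (fun c i => ?_)⟩
  · rcases a with a | a <;> rfl
  · revert c
    exact Fin.forall_fin_two.2 ⟨rfl, rfl⟩

/-! ### The twisted `k`-linear categories and the functors relating them -/

variable (k : Type u) [Field k]

/-- The twisted upward walled Brauer category. -/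
abbrev Uwb (ε : ℤˣ) := Twisted k (UwbOrd.twist ε)

/-- The twisted directed upward Brauer category. -/
abbrev Dub (ε : ℤˣ) := Twisted k (DubOrd.twist ε)

/-- The twisted (undirected) upward Brauer category. -/
abbrev Ub (δ ε : ℤˣ) := Twisted k (DubOrd.twist₂ δ ε)

/-- The twisted downward categories are the opposites. -/
abbrev Dwb (ε : ℤˣ) := (Uwb k ε)ᵒᵖ

/-- The twisted directed downward Brauer category. -/
abbrev Ddb (ε : ℤˣ) := (Dub k ε)ᵒᵖ

/-- The twisted (undirected) downward Brauer category. -/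
abbrev Db (δ ε : ℤˣ) := (Ub k δ ε)ᵒᵖ

/-- The functor `Υ`, induced by the disjoint union. -/
def Upsilon (ε : ℤˣ) : Uwb k ε ⥤ Dub k ε :=
  Twisted.lift (unW ⋙ Twisted.of k (DubOrd.twist ε))
    (fun _ _ _ _ _ h => Twisted.of_rel (unW_rel ε h))

instance (ε : ℤˣ) : (Upsilon k ε).Additive := by unfold Upsilon; infer_instance
instance (ε : ℤˣ) : (Upsilon k ε).Linear k := by unfold Upsilon; infer_instance

/-- The canonical projection from directed to undirected. -/
def mp (δ ε : ℤˣ) : Dub k ε ⥤ Ub k δ ε :=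
  Twisted.lift (Twisted.of k (DubOrd.twist₂ δ ε)) (fun A B s f f' h => by
    obtain ⟨σ, rfl, rfl⟩ := h
    exact Twisted.of_rel ⟨σ, fun _ => 1, by simp [DubOrd.Hom.wreathChar], rfl⟩)

instance (δ ε : ℤˣ) : (mp k δ ε).Additive := by unfold mp; infer_instance
instance (δ ε : ℤˣ) : (mp k δ ε).Linear k := by unfold mp; infer_instance

/-- The signed sum of a morphism over all changes of direction of its pairs. -/
def trSum (δ ε : ℤˣ) {A B : DubOrd} (f : DubOrd.Hom A.carrier B.carrier) :
    (Twisted.of k (DubOrd.twist ε)).obj A ⟶ (Twisted.of k (DubOrd.twist ε)).obj B :=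
  ∑ c : Fin f.deg → Equiv.Perm (Fin 2), (((∏ i, signChar δ (Fin 2) (c i) : ℤˣ) : ℤ) : k) •
    (Twisted.of k (DubOrd.twist ε)).map (X := A) (Y := B) (f.act 1 c)

lemma trSum_id (δ ε : ℤˣ) (A : DubOrd) :
    trSum k δ ε (A := A) (B := A) (DubOrd.Hom.ofEquiv (Equiv.refl A.carrier)) = 𝟙 _ := by
  have : Subsingleton (Fin (DubOrd.Hom.ofEquiv (Equiv.refl A.carrier)).deg →
    Equiv.Perm (Fin 2)) := inferInstanceAs (Subsingleton (Fin 0 → Equiv.Perm (Fin 2)))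
  have hp : (∏ _i : Fin (DubOrd.Hom.ofEquiv (Equiv.refl A.carrier)).deg, (1 : ℤˣ)) = 1 := by simp
  rw [trSum, Fintype.sum_subsingleton _ (fun _ => 1)]
  simp only [map_one, hp]
  rw [DubOrd.Hom.act_one, Units.val_one, Int.cast_one, one_smul]
  exact (Twisted.of k (DubOrd.twist ε)).map_id A

lemma trSum_comp (δ ε : ℤˣ) {A B C : DubOrd} (f : DubOrd.Hom A.carrier B.carrier)
    (g : DubOrd.Hom B.carrier C.carrier) :
    trSum k δ ε (A := A) (B := C) (f.comp g) =
      trSum k δ ε (A := A) (B := B) f ≫ trSum k δ ε (A := B) (B := C) g := by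
  simp only [trSum, Preadditive.sum_comp, Preadditive.comp_sum]
  refine ((Fintype.sum_equiv (Fin.appendEquiv f.deg g.deg) (fun p =>
    ((((∏ i, signChar δ (Fin 2) (p.1 i) : ℤˣ) : ℤ) : k) •
      (Twisted.of k (DubOrd.twist ε)).map (X := A) (Y := B) (f.act 1 p.1)) ≫
    ((((∏ i, signChar δ (Fin 2) (p.2 i) : ℤˣ) : ℤ) : k) •
      (Twisted.of k (DubOrd.twist ε)).map (X := B) (Y := C) (g.act 1 p.2))) _ fun p => ?_).symm.trans
    (Fintype.sum_prod_type _)).trans ?_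
  swap
  · first | rfl | exact Finset.sum_comm
  obtain ⟨c, d⟩ := p
  rw [Linear.smul_comp, Linear.comp_smul, smul_smul, ← Functor.map_comp]
  have h := DubOrd.Hom.act_comp_act f g 1 1 c d
  have h1 : DubOrd.Hom.sumPerm (1 : Equiv.Perm (Fin f.deg)) (1 : Equiv.Perm (Fin g.deg)) = 1 := by
    ext i
    exact Fin.addCases (fun i => by simp) (fun i => by simp) i
  rw [h1] at h
  refine congrArg₂ (fun (x : k) y => x • (Twisted.of k (DubOrd.twist ε)).map (X := A) (Y := C) y)
    ?_ h
  rw [← Int.cast_mul, ← Units.val_mul]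
  refine congrArg (fun x : ℤˣ => ((x : ℤ) : k)) ?_
  refine Eq.symm ((Fin.prod_univ_add _).trans ?_)
  simp [Fin.appendEquiv]

lemma trSum_act (δ ε : ℤˣ) {A B : DubOrd} (f : DubOrd.Hom A.carrier B.carrier)
    (σ : Equiv.Perm (Fin f.deg)) (c₀ : Fin f.deg → Equiv.Perm (Fin 2)) :
    trSum k δ ε (A := A) (B := B) (f.act σ c₀) =
      ((DubOrd.Hom.wreathChar δ ε σ c₀ : ℤ) : k) • trSum k δ ε (A := A) (B := B) f := by
  let E : (Fin f.deg → Equiv.Perm (Fin 2)) ≃ (Fin f.deg → Equiv.Perm (Fin 2)) :=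
    (Equiv.arrowCongr σ.symm (Equiv.refl _)).trans (Equiv.piCongrRight fun i => Equiv.mulLeft (c₀ i)⁻¹)
  have hE : ∀ e i, E e i = (c₀ i)⁻¹ * e (σ i) := fun e i => rfl
  rw [trSum, trSum, Finset.smul_sum]
  refine (Fintype.sum_equiv E _ _ fun e => ?_).symm
  have h1 : (f.act σ c₀).act 1 (E e) = (f.act 1 e).act σ (fun _ => 1) := by
    refine DubOrd.Hom.ext' rfl (fun _ => rfl) (fun a i => ?_)
    change f.equiv (Sum.inr ((c₀ i) (((c₀ i)⁻¹ * e (σ i)) a), σ i)) =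
      f.equiv (Sum.inr (e (σ i) a, σ i))
    simp
  have h2 : (DubOrd.twist ε).rel (X := A) (Y := B) (signChar ε _ σ) (f.act 1 e)
    ((f.act 1 e).act σ (fun _ => 1)) := ⟨σ, rfl, rfl⟩
  rw [h1, Twisted.of_rel h2, smul_smul, smul_smul]
  congr 1
  rw [← Int.cast_mul, ← Int.cast_mul, ← Units.val_mul, ← Units.val_mul]
  refine congrArg (fun x : ℤˣ => ((x : ℤ) : k)) ?_
  have h3 : (∏ i, signChar δ (Fin 2) (E e i)) =
      (∏ i, signChar δ (Fin 2) (c₀ i)) * ∏ i, signChar δ (Fin 2) (e i) := by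
    simp only [hE, map_mul, map_inv, Finset.prod_mul_distrib, Int.units_inv_eq_self]
    congr 1
    exact Equiv.prod_comp σ (fun i => signChar δ (Fin 2) (e i))
  refine Eq.trans ?_ (congrArg (· * signChar ε (Fin f.deg) σ) h3).symm
  rw [DubOrd.Hom.wreathChar]
  exact mul_right_comm _ _ _

/-- The functor underlying the transfer. -/
def trOrd (δ ε : ℤˣ) : DubOrd ⥤ Dub k ε where
  obj A := (Twisted.of k (DubOrd.twist ε)).obj A
  map {A B} f := trSum k δ ε (A := A) (B := B) f
  map_id A := trSum_id k δ ε A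
  map_comp f g := trSum_comp k δ ε f g

lemma trOrd_rel (δ ε : ℤˣ) {A B : DubOrd} {s : ℤˣ} {f f' : A ⟶ B}
    (h : (DubOrd.twist₂ δ ε).rel s f f') :
    (trOrd k δ ε).map f' = ((s : ℤ) : k) • (trOrd k δ ε).map f := by
  obtain ⟨σ, c, rfl, rfl⟩ := h
  exact trSum_act k δ ε (A := A) (B := B) f σ c

/-- The transfer functor. -/
def Tr (δ ε : ℤˣ) : Ub k δ ε ⥤ Dub k ε :=
  Twisted.lift (trOrd k δ ε) (fun _ _ _ _ _ h => trOrd_rel k δ ε h)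

instance (δ ε : ℤˣ) : (Tr k δ ε).Additive := by unfold Tr; infer_instance
instance (δ ε : ℤˣ) : (Tr k δ ε).Linear k := by unfold Tr; infer_instance

/-! ### Modules over linear categories -/

/-- Being a `k`-linear functor. -/
def isLinear (A : Type*) [Category* A] [Preadditive A] [Linear k A] :
    ObjectProperty (A ⥤ ModuleCat.{v} k) :=
  fun F => F.Additive ∧ F.Linear k

/-- The category of (left) `A`-modules: `k`-linear functors from `A` to `k`-modules. A right module
over an upward category is a left module over the opposite downward category. -/
abbrev LMod (A : Type*) [Category* A] [Preadditive A] [Linear k A] :=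
  (isLinear.{u, v} k A).FullSubcategory

instance op_linear {A B : Type*} [Category* A] [Preadditive A] [Linear k A] [Category* B]
    [Preadditive B] [Linear k B] (Φ : A ⥤ B) [Φ.Linear k] : Φ.op.Linear k where
  map_smul f r := Quiver.Hom.unop_inj (Φ.map_smul r f.unop)

/-- Restriction of modules along a `k`-linear functor. -/
def res {A B : Type*} [Category* A] [Preadditive A] [Linear k A] [Category* B]
    [Preadditive B] [Linear k B] (Φ : A ⥤ B) [Φ.Additive] [Φ.Linear k] :
    LMod.{u, v} k B ⥤ LMod.{u, v} k A where
  obj M := ⟨Φ ⋙ M.obj, by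
    obtain ⟨_, _⟩ := M.property
    exact ⟨inferInstance, inferInstance⟩⟩
  map τ := ⟨Functor.whiskerLeft Φ τ.hom⟩

/-! ### The right adjoint of restriction along the unwalling functor -/

/-- The objects of a decomposition of `X` into two subsets, given as the two fibres of
`p : X → Fin 2`. -/
def piece {X : Type} (p : X → Fin 2) (c : Fin 2) : Type := {x // p x = c}

instance {X : Type} [Finite X] (p : X → Fin 2) (c : Fin 2) : Finite (piece p c) :=
  inferInstanceAs (Finite {x // p x = c})

/-- The object `(X₁, X₂)` for a decomposition `X = X₁ ⨿ X₂`. -/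
def decomp {X : DubOrd} (p : X.carrier → Fin 2) : UwbOrd := ⟨piece p 0, piece p 1⟩

namespace DubOrd.Hom

variable {X Y Z : Type}

/-- The decomposition of `Y` induced by a decomposition of `X` and a morphism `f : X ⟶ Y`: the
first (second) elements of the directed pairs of `f` go to the first (second) part. -/
def push (f : Hom X Y) (p : X → Fin 2) : Y → Fin 2 := fun y => Sum.elim p Prod.fst (f.equiv.symm y)

/-- `q` is the decomposition induced by `p` and `f`. -/
def IsPush (f : Hom X Y) (p : X → Fin 2) (q : Y → Fin 2) : Prop :=
  ∀ z, q (f.equiv z) = Sum.elim p Prod.fst z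

lemma isPush_push (f : Hom X Y) (p : X → Fin 2) : f.IsPush p (f.push p) := by
  intro z
  simp [push]

lemma IsPush.eq {f : Hom X Y} {p : X → Fin 2} {q q' : Y → Fin 2} (h : f.IsPush p q)
    (h' : f.IsPush p q') : q = q' := by
  funext y
  obtain ⟨z, rfl⟩ := f.equiv.surjective y
  rw [h, h']

lemma IsPush.comp {f : Hom X Y} {g : Hom Y Z} {p : X → Fin 2} {q : Y → Fin 2} {r : Z → Fin 2}
    (h : f.IsPush p q) (h' : g.IsPush q r) : (f.comp g).IsPush p r := by
  rintro (a | ⟨c, i⟩)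
  · rw [comp_inl, h', Sum.elim_inl, h]
    rfl
  · refine Fin.addCases (fun i => ?_) (fun i => ?_) i
    · rw [comp_castAdd, h', Sum.elim_inl, h]
      rfl
    · rw [comp_natAdd, h']
      rfl

/-- The bijection between parts induced by `f`. -/
def pieceMap (f : Hom X Y) {p : X → Fin 2} {q : Y → Fin 2} (h : f.IsPush p q) (c : Fin 2) :
    piece p c ⊕ Fin f.deg → piece q c :=
  Sum.elim (fun x => ⟨f.equiv (Sum.inl x.1), (h _).trans x.2⟩)
    (fun i => ⟨f.equiv (Sum.inr (c, i)), h _⟩)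

lemma pieceMap_bijective (f : Hom X Y) {p : X → Fin 2} {q : Y → Fin 2} (h : f.IsPush p q)
    (c : Fin 2) : Function.Bijective (f.pieceMap h c) := by
  constructor
  · rintro (⟨a, ha⟩ | i) (⟨b, hb⟩ | j) hab
    · have := f.equiv.injective (congrArg Subtype.val hab)
      simp only [Sum.inl.injEq] at this
      subst this
      rfl
    · have := f.equiv.injective (congrArg Subtype.val hab)
      simp at this
    · have := f.equiv.injective (congrArg Subtype.val hab)
      simp at this
    · have := f.equiv.injective (congrArg Subtype.val hab)
      simpa using this
  · rintro ⟨y, hy⟩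
    obtain ⟨z, rfl⟩ := f.equiv.surjective y
    rw [h] at hy
    rcases z with a | ⟨d, i⟩
    · exact ⟨Sum.inl ⟨a, hy⟩, rfl⟩
    · obtain rfl : d = c := hy
      exact ⟨Sum.inr i, rfl⟩

/-- The morphism of `UwbOrd` lifting `f`. -/
def lift (f : Hom X Y) {p : X → Fin 2} {q : Y → Fin 2} (h : f.IsPush p q) :
    UwbOrd.Hom (piece p 0) (piece p 1) (piece q 0) (piece q 1) where
  deg := f.deg
  l := Equiv.ofBijective _ (f.pieceMap_bijective h 0)
  r := Equiv.ofBijective _ (f.pieceMap_bijective h 1)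

lemma lift_comp {f : Hom X Y} {g : Hom Y Z} {p : X → Fin 2} {q : Y → Fin 2} {r : Z → Fin 2}
    (h : f.IsPush p q) (h' : g.IsPush q r) (h'' : (f.comp g).IsPush p r) :
    (f.lift h).comp (g.lift h') = (f.comp g).lift h'' :=
  UwbOrd.Hom.ext_comp rfl (fun _ => rfl) (fun _ => rfl)
    (fun i => Subtype.ext (comp_castAdd f g 0 i).symm)
    (fun i => Subtype.ext (comp_castAdd f g 1 i).symm)
    (fun i => Subtype.ext (comp_natAdd f g 0 i).symm)
    (fun i => Subtype.ext (comp_natAdd f g 1 i).symm)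

lemma isPush_act {f : Hom X Y} {p : X → Fin 2} {q : Y → Fin 2} (h : f.IsPush p q)
    (σ : Equiv.Perm (Fin f.deg)) : (f.act σ (fun _ => 1)).IsPush p q := by
  rintro (a | ⟨c, i⟩)
  · exact h (Sum.inl a)
  · exact h (Sum.inr (c, σ i))

lemma lift_act {f : Hom X Y} {p : X → Fin 2} {q : Y → Fin 2} (h : f.IsPush p q)
    (σ : Equiv.Perm (Fin f.deg)) :
    (f.act σ (fun _ => 1)).lift (isPush_act h σ) = (f.lift h).act σ :=
  UwbOrd.Hom.ext' rfl (fun _ => rfl) (fun _ => rfl) (fun _ => rfl) (fun _ => rfl)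

lemma lift_id {p : X → Fin 2} (h : (ofEquiv (Equiv.refl X)).IsPush p p) :
    (ofEquiv (Equiv.refl X)).lift h = UwbOrd.Hom.ofEquiv (Equiv.refl _) (Equiv.refl _) :=
  UwbOrd.Hom.ext' rfl (fun _ => rfl) (fun _ => rfl) (fun i => i.elim0) (fun i => i.elim0)

end DubOrd.Hom

variable {k}

/-- The action of (the class of) a morphism `f` on a contravariant functor. -/
abbrev opMap {C : Type w} [Category.{w'} C] {T : Twist C} (F : (Twisted k T)ᵒᵖ ⥤ ModuleCat.{v} k)
    {X Y : C} (f : X ⟶ Y) :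
    F.obj (op ((Twisted.of k T).obj Y)) →ₗ[k] F.obj (op ((Twisted.of k T).obj X)) :=
  (F.map ((Twisted.of k T).map f).op).hom

lemma opMap_comp {C : Type w} [Category.{w'} C] {T : Twist C}
    (F : (Twisted k T)ᵒᵖ ⥤ ModuleCat.{v} k) {X Y Z : C} (f : X ⟶ Y) (g : Y ⟶ Z) (y) :
    opMap F (f ≫ g) y = opMap F f (opMap F g y) := by
  simp [opMap]

lemma opMap_id {C : Type w} [Category.{w'} C] {T : Twist C}
    (F : (Twisted k T)ᵒᵖ ⥤ ModuleCat.{v} k) {X : C} (y) : opMap F (𝟙 X) y = y := by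
  simp [opMap]

lemma opMap_rel {C : Type w} [Category.{w'} C] {T : Twist C}
    {F : (Twisted k T)ᵒᵖ ⥤ ModuleCat.{v} k} (hF : isLinear k _ F) {X Y : C} {s : ℤˣ}
    {f f' : X ⟶ Y} (h : T.rel s f f') : opMap F f' = ((s : ℤ) : k) • opMap F f := by
  obtain ⟨_, _⟩ := hF
  rw [opMap, Twisted.of_rel h]
  exact congrArg ModuleCat.Hom.hom (F.map_smul ((s : ℤ) : k) ((Twisted.of k T).map f).op)

section
variable {ε : ℤˣ} (F : LMod.{u, v} k (Dwb k ε))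

/-- The underlying object of the right adjoint: `X ↦ ⨁ F (X₁, X₂)`, over the (finitely many)
decompositions `X = X₁ ⨿ X₂`. -/
abbrev coindObj (X : DubOrd) : Type v :=
  ∀ p : X.carrier → Fin 2, F.obj.obj (op ((Twisted.of k (UwbOrd.twist ε)).obj (decomp p)))

/-- The action of a morphism: it maps the component of `(Y₁, Y₂)` to that of `(X₁, X₂)` if the
first elements of the directed pairs of `f` lie in `Y₁`, the second elements in `Y₂`, and
`X₁`, `X₂` are the preimages of `Y₁`, `Y₂`; all other components are zero. -/
def coindMap {X Y : DubOrd} (f : DubOrd.Hom X.carrier Y.carrier) :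
    coindObj F Y →ₗ[k] coindObj F X :=
  LinearMap.pi fun p => (opMap F.obj (X := decomp p) (Y := decomp (f.push p))
    (f.lift (f.isPush_push p))).comp (LinearMap.proj (f.push p))

lemma coindMap_apply {X Y : DubOrd} (f : DubOrd.Hom X.carrier Y.carrier) (y : coindObj F Y)
    (p : X.carrier → Fin 2) (q : Y.carrier → Fin 2) (h : f.IsPush p q) :
    coindMap F f y p = opMap F.obj (X := decomp p) (Y := decomp q) (f.lift h) (y q) := by
  obtain rfl := (f.isPush_push p).eq h
  rfl

/-- The functor underlying the right adjoint. -/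
def coindOrd : DubOrd ⥤ (ModuleCat.{v} k)ᵒᵖ where
  obj X := op (ModuleCat.of k (coindObj F X))
  map f := (ModuleCat.ofHom (coindMap F f)).op
  map_id X := by
    refine Quiver.Hom.unop_inj (ModuleCat.hom_ext (LinearMap.ext fun y => funext fun p => ?_))
    have h : (DubOrd.Hom.ofEquiv (Equiv.refl X.carrier)).IsPush p p := by
      rintro (a | ⟨_, i⟩)
      · rfl
      · exact i.elim0
    refine (coindMap_apply F _ y p p h).trans ?_
    rw [DubOrd.Hom.lift_id h]
    exact opMap_id F.obj _
  map_comp {X Y Z} f g := by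
    refine Quiver.Hom.unop_inj (ModuleCat.hom_ext (LinearMap.ext fun y => funext fun p => ?_))
    have hf := DubOrd.Hom.isPush_push f p
    have hg := DubOrd.Hom.isPush_push g (DubOrd.Hom.push f p)
    refine (coindMap_apply F _ y p _ (hf.comp hg)).trans ?_
    rw [← DubOrd.Hom.lift_comp hf hg]
    exact opMap_comp F.obj (X := decomp p) (Y := decomp (DubOrd.Hom.push f p)) _ _ _

lemma coindMap_act {X Y : DubOrd} (f : DubOrd.Hom X.carrier Y.carrier)
    (σ : Equiv.Perm (Fin f.deg)) :
    coindMap F (X := X) (Y := Y) (f.act σ (fun _ => 1)) =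
      ((signChar ε _ σ : ℤ) : k) • coindMap F (X := X) (Y := Y) f := by
  refine LinearMap.ext fun y => funext fun p => ?_
  have hf := DubOrd.Hom.isPush_push f p
  refine (coindMap_apply F _ y p _ (DubOrd.Hom.isPush_act hf σ)).trans ?_
  rw [DubOrd.Hom.lift_act]
  have := opMap_rel (X := decomp p) (Y := decomp (f.push p)) (k := k) F.property
    (f := f.lift hf) (s := signChar ε _ σ) ⟨σ, rfl, rfl⟩
  refine (LinearMap.congr_fun this _).trans ?_
  rfl

lemma coindOrd_rel {X Y : DubOrd} {s : ℤˣ} {f f' : X ⟶ Y} (h : (DubOrd.twist ε).rel s f f') :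
    (coindOrd F).map f' = ((s : ℤ) : k) • (coindOrd F).map f := by
  obtain ⟨σ, rfl, rfl⟩ := h
  exact Quiver.Hom.unop_inj (ModuleCat.hom_ext (coindMap_act F (X := X) (Y := Y) f σ))

/-- The value of the right adjoint on `F`. -/
def coindFunctor : Ddb k ε ⥤ ModuleCat.{v} k :=
  (Twisted.lift (coindOrd F) (fun _ _ _ _ _ h => coindOrd_rel F h)).leftOp

lemma coindFunctor_linear : isLinear k _ (coindFunctor F) := by
  constructor
  · refine ⟨fun {X Y f g} => Quiver.Hom.op_inj ?_⟩
    exact (Twisted.lift (coindOrd F) (fun _ _ _ _ _ h => coindOrd_rel F h)).map_add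
  · refine ⟨fun {X Y} f r => Quiver.Hom.op_inj ?_⟩
    exact (Twisted.lift (coindOrd F) (fun _ _ _ _ _ h => coindOrd_rel F h)).map_smul r f.unop

lemma coindFunctor_map {X Y : DubOrd} (f : X ⟶ Y) :
    (coindFunctor F).map ((Twisted.of k (DubOrd.twist ε)).map f).op =
      ModuleCat.ofHom (coindMap F f) :=
  congrArg Quiver.Hom.unop
    (Twisted.lift_map_of (coindOrd F) (fun _ _ _ _ _ h => coindOrd_rel F h) f)

end

/-- The components of the image of a morphism under the right adjoint. -/
def coindApp {ε : ℤˣ} {F G : LMod.{u, v} k (Dwb k ε)} (τ : F ⟶ G) (X : DubOrd) :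
    coindObj F X →ₗ[k] coindObj G X :=
  LinearMap.pi fun p => (τ.hom.app (op ((Twisted.of k (UwbOrd.twist ε)).obj (decomp p)))).hom.comp
    (LinearMap.proj p)

lemma coindApp_coindMap {ε : ℤˣ} {F G : LMod.{u, v} k (Dwb k ε)} (τ : F ⟶ G) {X Y : DubOrd}
    (f : DubOrd.Hom X.carrier Y.carrier) (y : coindObj F Y) :
    coindApp τ X (coindMap F f y) = coindMap G f (coindApp τ Y y) := by
  funext p
  have h := f.isPush_push p
  exact LinearMap.congr_fun (congrArg ModuleCat.Hom.hom (τ.hom.naturality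
    ((Twisted.of k (UwbOrd.twist ε)).map (X := decomp p) (Y := decomp (f.push p))
      (f.lift h)).op)) (y (f.push p))

/-- The image of a morphism under the right adjoint. -/
def coindHom {ε : ℤˣ} {F G : LMod.{u, v} k (Dwb k ε)} (τ : F ⟶ G) :
    coindFunctor F ⟶ coindFunctor G where
  app X := ModuleCat.ofHom (coindApp τ X.unop.ob)
  naturality X Y f := by
    refine Twisted.natural_op (coindFunctor_linear F) (coindFunctor_linear G)
      (fun X => ModuleCat.ofHom (coindApp τ X.unop.ob)) (fun {X Y} f => ?_) f
    rw [coindFunctor_map, coindFunctor_map]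
    exact ModuleCat.hom_ext (LinearMap.ext fun y => coindApp_coindMap τ f y)

variable (k) in
/-- The functor `(dΥ)_*`, right adjoint to restriction along the unwalling functor. -/
def coind (ε : ℤˣ) : LMod.{u, v} k (Dwb k ε) ⥤ LMod.{u, v} k (Ddb k ε) where
  obj F := ⟨coindFunctor F, coindFunctor_linear F⟩
  map τ := ⟨coindHom τ⟩
  map_id F := rfl
  map_comp σ τ := rfl

/-- The bijection `X₁ ⨿ X₂ ≃ X`. -/
def pieceEquiv {X : Type} (p : X → Fin 2) : piece p 0 ⊕ piece p 1 ≃ X :=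
  Equiv.ofBijective (Sum.elim Subtype.val Subtype.val) (by
    constructor
    · rintro (⟨a, ha⟩ | ⟨a, ha⟩) (⟨b, hb⟩ | ⟨b, hb⟩) (h : a = b)
      · subst h; rfl
      · subst h; simp [ha] at hb
      · subst h; simp [ha] at hb
      · subst h; rfl
    · intro x
      rcases Fin.exists_fin_two.1 ⟨p x, rfl⟩ with h | h
      · exact ⟨Sum.inl ⟨x, h⟩, rfl⟩
      · exact ⟨Sum.inr ⟨x, h⟩, rfl⟩)

/-- The decomposition of `A ⨿ B` into `A` and `B`. -/
def inlInr (A B : Type) : A ⊕ B → Fin 2 := Sum.elim (fun _ => 0) (fun _ => 1)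

/-- The first part of `A ⨿ B` is `A`. -/
def pieceInl (A B : Type) : A ≃ piece (inlInr A B) 0 :=
  Equiv.ofBijective (fun a => ⟨Sum.inl a, rfl⟩) ⟨fun _ _ h =>
    Sum.inl_injective (congrArg Subtype.val h), by
      rintro ⟨a | b, h⟩
      · exact ⟨a, rfl⟩
      · simp [inlInr] at h⟩

/-- The second part of `A ⨿ B` is `B`. -/
def pieceInr (A B : Type) : B ≃ piece (inlInr A B) 1 :=
  Equiv.ofBijective (fun b => ⟨Sum.inr b, rfl⟩) ⟨fun _ _ h =>
    Sum.inr_injective (congrArg Subtype.val h), by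
      rintro ⟨a | b, h⟩
      · simp [inlInr] at h
      · exact ⟨b, rfl⟩⟩

/-- The isomorphism `X₁ ⨿ X₂ ≅ X`. -/
abbrev eHom {X : DubOrd} (p : X.carrier → Fin 2) : unW.obj (decomp p) ⟶ X :=
  DubOrd.Hom.ofEquiv (pieceEquiv p)

/-- The isomorphism of `A` with the pair associated to the decomposition of its disjoint union. -/
abbrev jHom (A : UwbOrd) : A ⟶ decomp (X := unW.obj A) (inlInr A.left A.right) :=
  UwbOrd.Hom.ofEquiv (pieceInl A.left A.right) (pieceInr A.left A.right)

lemma eHom_comp {X Y : DubOrd} (f : DubOrd.Hom X.carrier Y.carrier) {p : X.carrier → Fin 2}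
    {q : Y.carrier → Fin 2} (h : f.IsPush p q) :
    eHom p ≫ (f : X ⟶ Y) =
      unW.map (X := decomp p) (Y := decomp q) (f.lift h) ≫ eHom q := by
  refine DubOrd.Hom.ext_comp (f := eHom p) (g := f) ?_ (fun a => ?_) (fun _ i => i.elim0)
    (fun c i => ?_)
  · exact (Nat.zero_add _).trans (Nat.add_zero _).symm
  · rcases a with a | a <;> rfl
  · have e : Fin.cast ((Nat.zero_add _).trans (Nat.add_zero _).symm) (Fin.natAdd 0 i) =
      Fin.castAdd 0 i := Fin.ext (Nat.zero_add _)
    have := DubOrd.Hom.comp_castAdd (unW.map (X := decomp p) (Y := decomp q) (f.lift h))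
      (eHom q) c i
    refine Eq.trans ?_ ((this.symm.trans ?_))
    · revert c
      exact Fin.forall_fin_two.2 ⟨fun _ => rfl, fun _ => rfl⟩
    · exact congrArg (fun j => (DubOrd.Hom.comp (unW.map (X := decomp p) (Y := decomp q)
        (f.lift h)) (eHom q)).equiv (Sum.inr (c, j))) e.symm

lemma isPush_unW {A B : UwbOrd} (g : A ⟶ B) :
    DubOrd.Hom.IsPush (unW.map g) (inlInr A.left A.right) (inlInr B.left B.right) := by
  rintro ((a | a) | ⟨c, i⟩)
  · rfl
  · rfl
  · revert c
    exact Fin.forall_fin_two.2 ⟨rfl, rfl⟩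

lemma jHom_comp {A B : UwbOrd} (g : A ⟶ B) :
    jHom A ≫ DubOrd.Hom.lift (unW.map g) (isPush_unW g) = g ≫ jHom B := by
  refine UwbOrd.Hom.ext_comp (f := jHom A)
    (g := DubOrd.Hom.lift (unW.map g) (isPush_unW g)) (Nat.zero_add _) (fun _ => rfl)
    (fun _ => rfl) (fun i => i.elim0) (fun i => i.elim0) (fun i => ?_) (fun i => ?_)
  · have := UwbOrd.Hom.compAux_castAdd (UwbOrd.Hom.l g) (UwbOrd.Hom.l (jHom B)) i
    refine Eq.trans (Eq.trans rfl this.symm) ?_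
    exact congrArg (fun j => UwbOrd.Hom.compAux (UwbOrd.Hom.l g) (UwbOrd.Hom.l (jHom B))
      (Sum.inr j)) (Fin.ext (Nat.zero_add _).symm)
  · have := UwbOrd.Hom.compAux_castAdd (UwbOrd.Hom.r g) (UwbOrd.Hom.r (jHom B)) i
    refine Eq.trans (Eq.trans rfl this.symm) ?_
    exact congrArg (fun j => UwbOrd.Hom.compAux (UwbOrd.Hom.r g) (UwbOrd.Hom.r (jHom B))
      (Sum.inr j)) (Fin.ext (Nat.zero_add _).symm)

lemma jHom_eHom (A : UwbOrd) :
    unW.map (jHom A) ≫ eHom (X := unW.obj A) (inlInr A.left A.right) = 𝟙 (unW.obj A) := by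
  refine DubOrd.Hom.ext_comp (f := unW.map (jHom A))
    (g := eHom (X := unW.obj A) (inlInr A.left A.right)) rfl (fun a => ?_) (fun _ i => i.elim0)
    (fun _ i => i.elim0)
  rcases a with a | a <;> rfl

lemma isPush_eHom {X : DubOrd} (p : X.carrier → Fin 2) :
    DubOrd.Hom.IsPush (eHom p) (inlInr (piece p 0) (piece p 1)) p := by
  rintro ((a | a) | ⟨c, i⟩)
  · exact a.2
  · exact a.2
  · exact i.elim0

lemma jHom_lift {X : DubOrd} (p : X.carrier → Fin 2) :
    jHom (decomp p) ≫ DubOrd.Hom.lift (eHom p) (isPush_eHom p) = 𝟙 (decomp p) :=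
  UwbOrd.Hom.ext_comp (f := jHom (decomp p))
    (g := DubOrd.Hom.lift (eHom p) (isPush_eHom p)) rfl (fun _ => rfl) (fun _ => rfl)
    (fun i => i.elim0) (fun i => i.elim0) (fun i => i.elim0) (fun i => i.elim0)

section
variable {ε : ℤˣ}

/-- The components of the unit. -/
def unitApp (N : LMod.{u, v} k (Ddb k ε)) (X : DubOrd) :
    N.obj.obj (op ((Twisted.of k (DubOrd.twist ε)).obj X)) →ₗ[k]
      coindObj ((res k (Upsilon k ε).op).obj N) X :=
  LinearMap.pi fun p => opMap N.obj (eHom p)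

lemma opMap_res (N : LMod.{u, v} k (Ddb k ε)) {A B : UwbOrd} (g : A ⟶ B) (n) :
    opMap ((res k (Upsilon k ε).op).obj N).obj g n = opMap N.obj (unW.map g) n := by
  have : (Upsilon k ε).map ((Twisted.of k (UwbOrd.twist ε)).map g) =
      (Twisted.of k (DubOrd.twist ε)).map (unW.map g) :=
    Twisted.lift_map_of _ _ _
  exact LinearMap.congr_fun (congrArg (fun h => (N.obj.map (Quiver.Hom.op h)).hom) this) n

lemma unitApp_natural (N : LMod.{u, v} k (Ddb k ε)) {X Y : DubOrd} (f : X ⟶ Y) (n) :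
    unitApp N X (opMap N.obj f n) = coindMap _ f (unitApp N Y n) := by
  funext p
  have h := DubOrd.Hom.isPush_push f p
  refine Eq.trans ?_ (opMap_res N (A := decomp p) (B := decomp (DubOrd.Hom.push f p))
    (DubOrd.Hom.lift f h) _).symm
  exact (opMap_comp N.obj (eHom p) f n).symm.trans
    ((congrArg (fun g => opMap N.obj g n) (eHom_comp f h)).trans (opMap_comp N.obj _ _ n))

/-- The unit at `N`. -/
def unitHom (N : LMod.{u, v} k (Ddb k ε)) :
    N ⟶ (res k (Upsilon k ε).op ⋙ coind k ε).obj N :=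
  ⟨{  app X := ModuleCat.ofHom (unitApp N X.unop.ob)
      naturality X Y f := by
        refine Twisted.natural_op N.property (coindFunctor_linear _)
          (fun X => ModuleCat.ofHom (unitApp N X.unop.ob)) (fun {X Y} f => ?_) f
        rw [coindFunctor_map]
        exact ModuleCat.hom_ext (LinearMap.ext fun n => unitApp_natural N f n) }⟩

/-- The components of the counit. -/
def counitApp (F : LMod.{u, v} k (Dwb k ε)) (A : UwbOrd) :
    coindObj F (unW.obj A) →ₗ[k] F.obj.obj (op ((Twisted.of k (UwbOrd.twist ε)).obj A)) :=
  (opMap F.obj (jHom A)).comp (LinearMap.proj (inlInr A.left A.right))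

lemma counitApp_natural (F : LMod.{u, v} k (Dwb k ε)) {A B : UwbOrd} (g : A ⟶ B)
    (y : coindObj F (unW.obj B)) :
    counitApp F A (coindMap F (unW.map g) y) = opMap F.obj g (counitApp F B y) := by
  change opMap F.obj (jHom A) (coindMap F (unW.map g) y (inlInr A.left A.right)) =
    opMap F.obj g (opMap F.obj (jHom B) (y (inlInr B.left B.right)))
  rw [coindMap_apply F _ _ _ _ (isPush_unW g)]
  refine (opMap_comp F.obj (jHom A) _ _).symm.trans ?_
  rw [jHom_comp]
  exact opMap_comp F.obj _ _ _

/-- The counit at `F`. -/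
def counitHom (F : LMod.{u, v} k (Dwb k ε)) :
    (coind k ε ⋙ res k (Upsilon k ε).op).obj F ⟶ F :=
  ⟨{  app X := ModuleCat.ofHom (counitApp F X.unop.ob)
      naturality X Y f := by
        refine Twisted.natural_op ((coind k ε ⋙ res k (Upsilon k ε).op).obj F).property F.property
          (fun X => ModuleCat.ofHom (counitApp F X.unop.ob)) (fun {X Y} f => ?_) f
        refine ModuleCat.hom_ext (LinearMap.ext fun y => ?_)
        refine Eq.trans (congrArg (counitApp F X) ?_) (counitApp_natural F f y)
        refine (opMap_res ((coind k ε).obj F) f y).trans ?_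
        exact LinearMap.congr_fun (congrArg ModuleCat.Hom.hom (coindFunctor_map F _)) y }⟩

end

variable (k) in
/-- The functor `(dΥ)_*` is right adjoint to the restriction functor `dΥ^*`. -/
def coindAdjunction (ε : ℤˣ) : res.{u, v} k (Upsilon k ε).op ⊣ coind k ε :=
  Adjunction.mkOfUnitCounit
    { unit :=
        { app := unitHom
          naturality := fun N N' τ => by
            refine ObjectProperty.hom_ext _ (NatTrans.ext (funext fun X =>
              ModuleCat.hom_ext (LinearMap.ext fun n => funext fun p => ?_)))
            exact LinearMap.congr_fun (congrArg ModuleCat.Hom.hom (τ.hom.naturality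
              ((Twisted.of k (DubOrd.twist ε)).map (eHom (X := X.unop.ob) p)).op).symm) n }
      counit :=
        { app := counitHom
          naturality := fun F F' τ => by
            refine ObjectProperty.hom_ext _ (NatTrans.ext (funext fun X =>
              ModuleCat.hom_ext (LinearMap.ext fun y => ?_)))
            exact LinearMap.congr_fun (congrArg ModuleCat.Hom.hom (τ.hom.naturality
              ((Twisted.of k (UwbOrd.twist ε)).map (jHom X.unop.ob)).op).symm)
              (y (inlInr _ _)) }
      left_triangle := by
        refine NatTrans.ext (funext fun N => ObjectProperty.hom_ext _ (NatTrans.ext (funext fun X =>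
          ModuleCat.hom_ext (LinearMap.ext fun n => ?_))))
        refine (opMap_res N (jHom X.unop.ob) _).trans ?_
        refine (opMap_comp N.obj (unW.map (jHom X.unop.ob))
          (eHom (X := unW.obj X.unop.ob) (inlInr _ _)) n).symm.trans ?_
        rw [jHom_eHom]
        exact opMap_id N.obj n
      right_triangle := by
        refine NatTrans.ext (funext fun F => ObjectProperty.hom_ext _ (NatTrans.ext (funext fun X =>
          ModuleCat.hom_ext (LinearMap.ext fun y => funext fun p => ?_))))
        have h1 := LinearMap.congr_fun (congrArg ModuleCat.Hom.hom (coindFunctor_map F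
          (eHom (X := X.unop.ob) p))) y
        refine (congrArg (counitApp F (decomp p)) h1).trans ?_
        refine (congrArg (opMap F.obj (jHom (decomp p)))
          (coindMap_apply F _ y _ p (isPush_eHom p))).trans ?_
        refine (opMap_comp F.obj (jHom (decomp p)) _ _).symm.trans ?_
        rw [jHom_lift]
        exact opMap_id F.obj _ }

/-! ### Tensor products over the groupoids of bijections -/

lemma signChar_mul_neg (ε : ℤˣ) (α : Type*) [Fintype α] [DecidableEq α] (σ : Equiv.Perm α) :
    signChar ε α σ * signChar (-ε) α σ = Equiv.Perm.sign σ := by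
  rcases Int.units_eq_one_or ε with rfl | rfl
  · simp [signChar]
  · simp [signChar]

section Tensor

variable {O : Type w} [Category.{w'} O] {T T' : Twist O}
  (G : LMod.{u, v} k (Twisted k T)ᵒᵖ) (F : LMod.{u, v} k (Twisted k T')ᵒᵖ)

/-- `G(A) ⊗ F(A)`, over `k`. -/
abbrev Ten (A : O) : Type v :=
  TensorProduct k (G.obj.obj (op ((Twisted.of k T).obj A)) : Type v)
    (F.obj.obj (op ((Twisted.of k T').obj A)) : Type v)

/-- The relations `(x · s) ⊗ y = x ⊗ (s · y)` for the automorphisms `s` of `A`, where `G` is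
considered as a right module over the upward category, and `s` acts on the downward module `F`
as the opposite of its inverse. -/
def balanced (A : O) : Submodule k (Ten G F A) :=
  Submodule.span k {z | ∃ (s : A ≅ A) (x : G.obj.obj (op ((Twisted.of k T).obj A)))
    (y : F.obj.obj (op ((Twisted.of k T').obj A))),
    z = opMap G.obj s.hom x ⊗ₜ[k] y - x ⊗ₜ[k] opMap F.obj s.inv y}

/-- `G(A) ⊗ F(A)`, over the group algebra of the automorphism group of `A`. -/
abbrev Co (A : O) : Type v := Ten G F A ⧸ balanced G F A

/-- The map `x ⊗ y ↦ x [f] ⊗ [fᵒᵖ] y` for a morphism `f : A ⟶ B`. -/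
def opTen {A B : O} (f : A ⟶ B) : Ten G F B →ₗ[k] Co G F A :=
  (balanced G F A).mkQ.comp (TensorProduct.map (opMap G.obj f) (opMap F.obj f))

lemma opTen_tmul {A B : O} (f : A ⟶ B) (x : G.obj.obj (op ((Twisted.of k T).obj B)))
    (y : F.obj.obj (op ((Twisted.of k T').obj B))) :
    opTen G F f (x ⊗ₜ[k] y) = (balanced G F A).mkQ (opMap G.obj f x ⊗ₜ[k] opMap F.obj f y) := rfl

lemma mkQ_balanced {A : O} (s : A ≅ A) (x : G.obj.obj (op ((Twisted.of k T).obj A)))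
    (y : F.obj.obj (op ((Twisted.of k T').obj A))) :
    (balanced G F A).mkQ (opMap G.obj s.hom x ⊗ₜ[k] y) =
      (balanced G F A).mkQ (x ⊗ₜ[k] opMap F.obj s.inv y) := by
  rw [← sub_eq_zero, ← map_sub, Submodule.mkQ_apply, Submodule.Quotient.mk_eq_zero]
  exact Submodule.subset_span ⟨s, x, y, rfl⟩

lemma opTen_iso_comp {A B : O} (s : A ≅ A) (f : A ⟶ B) :
    opTen G F (s.hom ≫ f) = opTen G F f := by
  refine TensorProduct.ext' fun x y => ?_
  rw [opTen_tmul, opTen_tmul, opMap_comp, mkQ_balanced, ← opMap_comp, s.inv_hom_id_assoc]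

lemma opTen_rel {A B : O} {r r' : ℤˣ} {f f' : A ⟶ B} (h : T.rel r f f') (h' : T'.rel r' f f') :
    opTen G F f' = (((r * r' : ℤˣ) : ℤ) : k) • opTen G F f := by
  refine TensorProduct.ext' fun x y => ?_
  rw [opTen_tmul, opMap_rel G.property h, opMap_rel F.property h', LinearMap.smul_apply,
    LinearMap.smul_apply, TensorProduct.smul_tmul_smul, map_smul, LinearMap.smul_apply, opTen_tmul]
  push_cast
  rfl

/-- The map `x ⊗ y ↦ ∑ x [aᵢ] ⊗ [aᵢᵒᵖ] y` for a finite family of morphisms. -/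
def sumTen {A B : O} {I : Type*} [Fintype I] (a : I → (A ⟶ B)) : Ten G F B →ₗ[k] Co G F A :=
  ∑ i, opTen G F (a i)

/-- A family `a` of morphisms represents the full family `m`, if the sum over `m` is a non-zero
multiple of that over `a`. -/
def Represents {A B : O} {I E : Type*} [Fintype I] [Fintype E] (a : I → (A ⟶ B))
    (m : E → (A ⟶ B)) : Prop :=
  ∃ c : k, c ≠ 0 ∧ c • sumTen G F a = sumTen G F m

lemma sumTen_balanced {A B : O} {E : Type*} [Fintype E] (m : E → (A ⟶ B))
    (hm : ∀ s : B ≅ B, ∃ σ : Equiv.Perm E, ∀ e, m (σ e) = m e ≫ s.hom) :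
    balanced G F B ≤ LinearMap.ker (sumTen G F m) := by
  refine Submodule.span_le.2 ?_
  rintro _ ⟨s, x, y, rfl⟩
  rw [SetLike.mem_coe, LinearMap.mem_ker, map_sub, sub_eq_zero]
  obtain ⟨σ, hσ⟩ := hm s
  have h : ∀ e, opTen G F (m e) (opMap G.obj s.hom x ⊗ₜ[k] y) =
      opTen G F (m (σ e)) (x ⊗ₜ[k] opMap F.obj s.inv y) := fun e => by
    rw [hσ, opTen_tmul, opTen_tmul, opMap_comp G.obj, ← opMap_comp F.obj, Category.assoc,
      s.hom_inv_id, Category.comp_id]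
  simp only [sumTen, LinearMap.sum_apply, h]
  exact Equiv.sum_comp σ fun e => opTen G F (m e) (x ⊗ₜ[k] opMap F.obj s.inv y)

lemma Represents.balanced {A B : O} {I E : Type*} [Fintype I] [Fintype E] {a : I → (A ⟶ B)}
    {m : E → (A ⟶ B)} (h : Represents G F a m)
    (hm : ∀ s : B ≅ B, ∃ σ : Equiv.Perm E, ∀ e, m (σ e) = m e ≫ s.hom) :
    balanced G F B ≤ LinearMap.ker (sumTen G F a) := by
  obtain ⟨c, hc, h⟩ := h
  intro z hz
  have h1 : sumTen G F m z = 0 := sumTen_balanced G F m hm hz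
  rw [← h, LinearMap.smul_apply] at h1
  exact (smul_eq_zero.1 h1).resolve_left hc

variable {G F} in
/-- The map induced on the tensor product over the automorphism group. -/
def coMap {A B : O} (φ : Ten G F B →ₗ[k] Co G F A) (h : Brauer.balanced G F B ≤ LinearMap.ker φ) :
    Co G F B →ₗ[k] Co G F A :=
  (balanced G F B).liftQ φ h

lemma coMap_mkQ {A B : O} (φ : Ten G F B →ₗ[k] Co G F A)
    (h : Brauer.balanced G F B ≤ LinearMap.ker φ) (z) :
    coMap φ h ((balanced G F B).mkQ z) = φ z := rfl

/-- Two successive sums over full families cancel. -/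
lemma coMap_comp_zero [CharZero k] {A B C : O} {I E I' E' : Type*} [Fintype I] [Fintype E]
    [Fintype I'] [Fintype E'] {a : I → (A ⟶ B)} {m : E → (A ⟶ B)} {a' : I' → (B ⟶ C)}
    {m' : E' → (B ⟶ C)} (h : Represents G F a m) (h' : Represents G F a' m')
    (hm : ∀ s : B ≅ B, ∃ σ : Equiv.Perm E, ∀ e, m (σ e) = m e ≫ s.hom)
    (hs : ∀ e, ∃ σ : Equiv.Perm E', ∀ e', ∃ r r' : ℤˣ, r * r' = -1 ∧
      T.rel r (m e ≫ m' e') (m e ≫ m' (σ e')) ∧ T'.rel r' (m e ≫ m' e') (m e ≫ m' (σ e')))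
    (hb) (hb') :
    (coMap (sumTen G F a) hb).comp (coMap (sumTen G F a') hb') = 0 := by
  have key : ∀ (e' : E') (z : Ten G F C), coMap (sumTen G F m) (sumTen_balanced G F m hm)
      (opTen G F (m' e') z) = ∑ e, opTen G F (m e ≫ m' e') z := by
    intro e' z
    induction z using TensorProduct.induction_on with
    | zero => simp
    | add x y hx hy => simp only [map_add, hx, hy, Finset.sum_add_distrib]
    | tmul x y =>
      rw [opTen_tmul, coMap_mkQ, sumTen, LinearMap.sum_apply]
      refine Finset.sum_congr rfl fun e _ => ?_
      rw [opTen_tmul, opTen_tmul, opMap_comp, opMap_comp]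
  have zero : ∀ (e : E) (z : Ten G F C), ∑ e', opTen G F (m e ≫ m' e') z = 0 := by
    intro e z
    obtain ⟨σ, hσ⟩ := hs e
    have h1 : ∀ e', opTen G F (m e ≫ m' (σ e')) z = - opTen G F (m e ≫ m' e') z := fun e' => by
      obtain ⟨r, r', hr, h2, h3⟩ := hσ e'
      rw [opTen_rel G F h2 h3, hr]
      simp
    have h2 := Equiv.sum_comp σ fun e' => opTen G F (m e ≫ m' e') z
    simp only [h1, Finset.sum_neg_distrib] at h2
    have h3 : (2 : k) • ∑ e', opTen G F (m e ≫ m' e') z = 0 := by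
      rw [two_smul]
      nth_rw 1 [← h2]
      exact neg_add_cancel _
    exact (smul_eq_zero.1 h3).resolve_left two_ne_zero
  obtain ⟨c, hc, hca⟩ := h
  obtain ⟨c', hc', hca'⟩ := h'
  refine LinearMap.ext fun w => ?_
  obtain ⟨z, rfl⟩ := Submodule.mkQ_surjective _ w
  have e1 : ∀ w, c • coMap (sumTen G F a) hb w =
      coMap (sumTen G F m) (sumTen_balanced G F m hm) w := fun w => by
    obtain ⟨w, rfl⟩ := Submodule.mkQ_surjective _ w
    exact LinearMap.congr_fun hca w
  have e2 : c' • sumTen G F a' z = sumTen G F m' z := LinearMap.congr_fun hca' z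
  have e3 : c • c' • coMap (sumTen G F a) hb (sumTen G F a' z) = 0 := by
    have e4 : sumTen G F m' z = ∑ e', opTen G F (m' e') z := by
      simp only [sumTen, LinearMap.sum_apply]
    rw [← map_smul, e2, e1, e4, map_sum]
    simp only [key]
    rw [Finset.sum_comm]
    exact Finset.sum_eq_zero fun e _ => zero e z
  exact (smul_eq_zero.1 ((smul_eq_zero.1 e3).resolve_left hc)).resolve_left hc'

variable {G F} in
/-- The map induced by morphisms `G ⟶ G'` and `F ⟶ F'`. -/
def tenFun {G' : LMod.{u, v} k (Twisted k T)ᵒᵖ} {F' : LMod.{u, v} k (Twisted k T')ᵒᵖ}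
    (τ : G ⟶ G') (ρ : F ⟶ F') (A : O) : Ten G F A →ₗ[k] Ten G' F' A :=
  TensorProduct.map (τ.hom.app (op ((Twisted.of k T).obj A))).hom
    (ρ.hom.app (op ((Twisted.of k T').obj A))).hom

section
variable {G F} {G' G'' : LMod.{u, v} k (Twisted k T)ᵒᵖ} {F' F'' : LMod.{u, v} k (Twisted k T')ᵒᵖ}
  (τ : G ⟶ G') (ρ : F ⟶ F')

lemma opMap_app {A B : O} (f : A ⟶ B) (x : G.obj.obj (op ((Twisted.of k T).obj B))) :
    (τ.hom.app (op ((Twisted.of k T).obj A))).hom (opMap G.obj f x) =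
      opMap G'.obj f ((τ.hom.app (op ((Twisted.of k T).obj B))).hom x) :=
  LinearMap.congr_fun (congrArg ModuleCat.Hom.hom
    (τ.hom.naturality ((Twisted.of k T).map f).op)) x

lemma tenFun_balanced (A : O) :
    balanced G F A ≤ LinearMap.ker ((balanced G' F' A).mkQ.comp (tenFun τ ρ A)) := by
  refine Submodule.span_le.2 ?_
  rintro _ ⟨s, x, y, rfl⟩
  rw [SetLike.mem_coe, LinearMap.mem_ker, map_sub, sub_eq_zero]
  simp only [LinearMap.comp_apply, tenFun, TensorProduct.map_tmul, opMap_app]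
  exact mkQ_balanced G' F' s _ _

/-- The map induced on the tensor products over the automorphism group. -/
def coFun (A : O) : Co G F A →ₗ[k] Co G' F' A :=
  (balanced G F A).liftQ _ (tenFun_balanced τ ρ A)

lemma coFun_opTen {A B : O} (f : A ⟶ B) (z : Ten G F B) :
    coFun τ ρ A (opTen G F f z) = opTen G' F' f (tenFun τ ρ B z) := by
  induction z using TensorProduct.induction_on with
  | zero => simp
  | add x y hx hy => simp only [map_add, hx, hy]
  | tmul x y =>
    refine congrArg (balanced G' F' A).mkQ (Eq.trans (TensorProduct.map_tmul _ _ _ _) ?_)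
    rw [opMap_app, opMap_app]
    rfl

lemma coFun_coMap {A B : O} {I : Type*} [Fintype I] (a : I → (A ⟶ B)) (h h') (w : Co G F B) :
    coFun τ ρ A (coMap (sumTen G F a) h w) = coMap (sumTen G' F' a) h' (coFun τ ρ B w) := by
  obtain ⟨z, rfl⟩ := Submodule.mkQ_surjective _ w
  change coFun τ ρ A (sumTen G F a z) = sumTen G' F' a (tenFun τ ρ B z)
  simp only [sumTen, LinearMap.sum_apply, map_sum, coFun_opTen]

lemma coFun_id (A : O) : coFun (𝟙 G) (𝟙 F) A = LinearMap.id := by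
  refine LinearMap.ext fun w => ?_
  obtain ⟨z, rfl⟩ := Submodule.mkQ_surjective _ w
  change (balanced G F A).mkQ (tenFun (𝟙 G) (𝟙 F) A z) = _
  refine congrArg _ (LinearMap.congr_fun (?_ : tenFun (𝟙 G) (𝟙 F) A = LinearMap.id) z)
  exact TensorProduct.ext' fun x y => rfl

lemma coFun_comp (τ' : G' ⟶ G'') (ρ' : F' ⟶ F'') (A : O) :
    coFun (τ ≫ τ') (ρ ≫ ρ') A = (coFun τ' ρ' A).comp (coFun τ ρ A) := by
  refine LinearMap.ext fun w => ?_
  obtain ⟨z, rfl⟩ := Submodule.mkQ_surjective _ w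
  change (balanced G'' F'' A).mkQ (tenFun (τ ≫ τ') (ρ ≫ ρ') A z) =
    (balanced G'' F'' A).mkQ (tenFun τ' ρ' A (tenFun τ ρ A z))
  refine congrArg _ (LinearMap.congr_fun
    (?_ : tenFun (τ ≫ τ') (ρ ≫ ρ') A = (tenFun τ' ρ' A).comp (tenFun τ ρ A)) z)
  exact TensorProduct.ext' fun x y => rfl

end

end Tensor

/-! ### The generators in degree one -/

lemma represents_of_bijective [CharZero k] {O : Type w} [Category.{w'} O] {T T' : Twist O}
    (G : LMod.{u, v} k (Twisted k T)ᵒᵖ) (F : LMod.{u, v} k (Twisted k T')ᵒᵖ) {A B : O}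
    {S I E : Type*} [Fintype S] [Nonempty S] [Fintype I] [Fintype E] (t : S → (A ≅ A))
    (a : I → (A ⟶ B)) (m : E → (A ⟶ B)) (f : S × I → E) (hf : Function.Bijective f)
    (h : ∀ p, m (f p) = (t p.1).hom ≫ a p.2) : Represents G F a m := by
  refine ⟨Fintype.card S, Nat.cast_ne_zero.2 Fintype.card_ne_zero, ?_⟩
  have h1 : ∀ p : S × I, opTen G F (a p.2) = opTen G F (m (f p)) := fun p => by
    rw [h, opTen_iso_comp]
  have h2 : ∑ p : S × I, opTen G F (m (f p)) = sumTen G F m :=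
    Equiv.sum_comp (Equiv.ofBijective f hf) fun e => opTen G F (m e)
  rw [← h2]
  simp only [← h1]
  rw [Fintype.sum_prod_type]
  simp [sumTen, Nat.cast_smul_eq_nsmul]

lemma exists_perm {A P B : Type*} [Finite A] [Finite P] (e e' : A ⊕ P ≃ B)
    (h : ∀ i, e (Sum.inr i) = e' (Sum.inr i)) :
    ∃ σ : Equiv.Perm A, e = (σ.sumCongr (Equiv.refl P)).trans e' := by
  have hr : ∀ i, (e.trans e'.symm) (Sum.inr i) = Sum.inr i := fun i => by simp [h]
  have hl : Set.MapsTo (e.trans e'.symm) (Set.range Sum.inl) (Set.range Sum.inl) := by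
    refine (Equiv.Perm.perm_mapsTo_inl_iff_mapsTo_inr _).2 ?_
    rintro _ ⟨i, rfl⟩
    exact ⟨i, (hr i).symm⟩
  obtain ⟨⟨σ, τ⟩, hσ⟩ := Equiv.Perm.mem_sumCongrHom_range_of_perm_mapsTo_inl hl
  refine ⟨σ, Equiv.ext fun z => ?_⟩
  have h1 : ∀ z, e z = e' (Equiv.Perm.sumCongrHom A P (σ, τ) z) := fun z => by
    rw [hσ]; simp
  rcases z with a | i
  · exact h1 (Sum.inl a)
  · exact h i

/-- Exchange of the two copies of `P` in `(A ⨿ P) ⨿ P`. -/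
def exchange (A P : Type*) : (A ⊕ P) ⊕ P ≃ (A ⊕ P) ⊕ P :=
  ((Equiv.sumAssoc A P P).trans ((Equiv.refl A).sumCongr (Equiv.sumComm P P))).trans
    (Equiv.sumAssoc A P P).symm

/-- The exchange, transported along a bijection. -/
def exchangeAlong {A P B : Type*} (e : A ⊕ P ≃ B) : B ⊕ P ≃ B ⊕ P :=
  ((e.symm.sumCongr (Equiv.refl P)).trans (exchange A P)).trans (e.sumCongr (Equiv.refl P))

lemma exchangeAlong_inl {A P B : Type*} (e : A ⊕ P ≃ B) (a : A) :
    exchangeAlong e (Sum.inl (e (Sum.inl a))) = Sum.inl (e (Sum.inl a)) := by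
  simp [exchangeAlong, exchange]

lemma exchangeAlong_inr {A P B : Type*} (e : A ⊕ P ≃ B) (i : P) :
    exchangeAlong e (Sum.inl (e (Sum.inr i))) = Sum.inr i := by
  simp [exchangeAlong, exchange]

lemma exchangeAlong_inr' {A P B : Type*} (e : A ⊕ P ≃ B) (i : P) :
    exchangeAlong e (Sum.inr i) = Sum.inl (e (Sum.inr i)) := by
  simp [exchangeAlong, exchange]

namespace DubOrd

/-- The finite set with `n` elements, as an object. -/
abbrev fin (n : ℕ) : DubOrd := ⟨Fin n⟩

/-- Isomorphisms are bijections. -/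
lemma eq_isoOfEquiv {A B : DubOrd} (s : A ≅ B) :
    ∃ e : A.carrier ≃ B.carrier, s = isoOfEquiv e := by
  have h : Hom.deg s.hom + Hom.deg s.inv = 0 := congrArg Hom.deg s.hom_inv_id
  obtain ⟨d, e, hd⟩ : ∃ (d : ℕ) (e : A.carrier ⊕ (Fin 2 × Fin d) ≃ B.carrier),
    s.hom = Hom.mk d e := ⟨_, _, rfl⟩
  obtain rfl : d = 0 := by
    rw [hd] at h
    exact (Nat.add_eq_zero_iff.1 h).1
  refine ⟨(Equiv.sumEmpty _ _).symm.trans e, Iso.ext (hd.trans ?_)⟩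
  exact Hom.ext' rfl (fun _ => rfl) (fun _ i => i.elim0)

/-- The degree one morphism given by a bijection. -/
abbrev one {A B : DubOrd} (e : A.carrier ⊕ (Fin 2 × Fin 1) ≃ B.carrier) : A ⟶ B := Hom.mk 1 e

/-- The bijection underlying `α_{(i j)}`, for `p = (i, j)`: the complement of `{i, j}` is identified
with `n` by the order preserving bijection, and the directed pair is `(i, j)`. -/
def alphaEquiv {n N : ℕ} (h : n + 2 = N) (p : Fin N × Fin N) (hp : p.1 ≠ p.2) :
    Fin n ⊕ (Fin 2 × Fin 1) ≃ Fin N :=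
  Equiv.ofBijective (Sum.elim
    (({p.1, p.2}ᶜ : Finset (Fin N)).orderEmbOfFin (by
      rw [Finset.card_compl, Finset.card_pair hp, Fintype.card_fin]
      omega))
    (fun c => if c.1 = 0 then p.1 else p.2)) (by
      refine (Fintype.bijective_iff_injective_and_card _).2 ⟨?_, by simp [h]⟩
      refine Function.Injective.sumElim (RelEmbedding.injective _) ?_ ?_
      · rintro ⟨c, i⟩ ⟨d, j⟩ hcd
        refine Prod.ext ?_ (Subsingleton.elim i j)
        rcases Fin.exists_fin_two.1 ⟨c, rfl⟩ with rfl | rfl <;>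
          rcases Fin.exists_fin_two.1 ⟨d, rfl⟩ with rfl | rfl
        · rfl
        · exact absurd hcd hp
        · exact absurd hcd.symm hp
        · rfl
      · intro a c hac
        have := Finset.orderEmbOfFin_mem ({p.1, p.2}ᶜ : Finset (Fin N)) (by
          rw [Finset.card_compl, Finset.card_pair hp, Fintype.card_fin]
          omega) a
        rw [hac] at this
        split at this <;> simp at this)

/-- The morphism `α_{(i j)}`. -/
def alpha {n N : ℕ} (h : n + 2 = N) (p : Fin N × Fin N) (hp : p.1 ≠ p.2) : fin n ⟶ fin N :=
  one (alphaEquiv h p hp)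

lemma one_post {A B : DubOrd} (s : B ≅ B) :
    ∃ σ : Equiv.Perm (A.carrier ⊕ (Fin 2 × Fin 1) ≃ B.carrier),
      ∀ e, one (A := A) (σ e) = one e ≫ s.hom := by
  obtain ⟨e, rfl⟩ := eq_isoOfEquiv s
  refine ⟨(Equiv.refl _).equivCongr e, fun f => ?_⟩
  exact Hom.ext' (f := one (A := A) (B := B) (f.trans e))
    (g := (one (A := A) (B := B) f).comp (Hom.ofEquiv e)) rfl (fun _ => rfl) (fun c i =>
      (Hom.comp_castAdd (one (A := A) (B := B) f) (Hom.ofEquiv e) c i).symm)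

lemma one_swap {A B C : DubOrd} (e : A.carrier ⊕ (Fin 2 × Fin 1) ≃ B.carrier)
    (e' : B.carrier ⊕ (Fin 2 × Fin 1) ≃ C.carrier) :
    (one e ≫ one ((exchangeAlong e).trans e') : A ⟶ C) =
      Hom.act (A := A.carrier) (B := C.carrier) (one e ≫ one e')
        (Equiv.swap (0 : Fin 2) 1 : Equiv.Perm (Fin (1 + 1))) (fun _ => 1) := by
  refine Hom.ext_comp (f := one e) (g := one ((exchangeAlong e).trans e')) rfl (fun a => ?_)
    (fun c i => ?_) (fun c i => ?_)
  · exact congrArg e' (exchangeAlong_inl e a)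
  · refine (congrArg e' (exchangeAlong_inr e (c, i))).trans ?_
    refine (Hom.comp_natAdd (one e) (one e') c i).symm.trans ?_
    obtain rfl := Subsingleton.elim i 0
    rfl
  · refine (congrArg e' (exchangeAlong_inr' e (c, i))).trans ?_
    refine (Hom.comp_castAdd (one e) (one e') c i).symm.trans ?_
    obtain rfl := Subsingleton.elim i 0
    rfl

lemma sum_one_comp {n N : ℕ} (σ : Equiv.Perm (Fin n))
    (e : Fin n ⊕ (Fin 2 × Fin 1) ≃ Fin N) :
    one (A := fin n) (B := fin N) ((σ.sumCongr (Equiv.refl _)).trans e) =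
      (isoOfEquiv (A := fin n) (B := fin n) σ).hom ≫ one (A := fin n) (B := fin N) e := by
  refine (Hom.ext_comp (f := Hom.ofEquiv σ) (g := one (A := fin n) (B := fin N) e)
    (h := one (A := fin n) (B := fin N) ((σ.sumCongr (Equiv.refl _)).trans e)) rfl (fun _ => rfl)
    (fun _ i => i.elim0) (fun c i => ?_)).symm
  obtain rfl := Subsingleton.elim i 0
  rfl

lemma alphaEquiv_zero {n N : ℕ} (h : n + 2 = N) (p : Fin N × Fin N) (hp : p.1 ≠ p.2) (i : Fin 1) :
    alphaEquiv h p hp (Sum.inr (0, i)) = p.1 := rfl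

lemma alphaEquiv_one {n N : ℕ} (h : n + 2 = N) (p : Fin N × Fin N) (hp : p.1 ≠ p.2) (i : Fin 1) :
    alphaEquiv h p hp (Sum.inr (1, i)) = p.2 := rfl

end DubOrd

/-- The index set of the generators `α_{(i j)}`, for `i ≠ j`. -/
abbrev OrdPair (N : ℕ) := {p : Fin N × Fin N // p.1 ≠ p.2}

/-- The index set of the generators `α_{(i j)}`, for `i < j`. -/
abbrev IncPair (N : ℕ) := {p : Fin N × Fin N // p.1 < p.2}

section
variable [CharZero k] {T T' : Twist DubOrd} (G : LMod.{u, v} k (Twisted k T)ᵒᵖ)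
  (F : LMod.{u, v} k (Twisted k T')ᵒᵖ) {n N : ℕ} (h : n + 2 = N)

/-- All morphisms of degree one. -/
abbrev allOne (n N : ℕ) (e : Fin n ⊕ (Fin 2 × Fin 1) ≃ Fin N) : DubOrd.fin n ⟶ DubOrd.fin N :=
  DubOrd.one (A := DubOrd.fin n) (B := DubOrd.fin N) e

lemma represents_directed :
    Represents G F (fun p : OrdPair N => DubOrd.alpha h p.1 p.2) (allOne n N) := by
  refine represents_of_bijective G F (S := Equiv.Perm (Fin n))
    (fun σ => DubOrd.isoOfEquiv (A := DubOrd.fin n) (B := DubOrd.fin n) σ) _ _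
    (fun q => (q.1.sumCongr (Equiv.refl _)).trans (DubOrd.alphaEquiv h q.2.1 q.2.2)) ⟨?_, ?_⟩
    (fun q => DubOrd.sum_one_comp _ _)
  · rintro ⟨σ, ⟨⟨i, j⟩, hp⟩⟩ ⟨σ', ⟨⟨i', j'⟩, hp'⟩⟩ heq
    have h0 := congrArg (fun e : Fin n ⊕ (Fin 2 × Fin 1) ≃ Fin N => e (Sum.inr (0, 0))) heq
    have h1 := congrArg (fun e : Fin n ⊕ (Fin 2 × Fin 1) ≃ Fin N => e (Sum.inr (1, 0))) heq
    obtain rfl : i = i' := h0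
    obtain rfl : j = j' := h1
    have h2 : σ = σ' := Equiv.ext fun a => by
      have h3 := congrArg (fun e : Fin n ⊕ (Fin 2 × Fin 1) ≃ Fin N => e (Sum.inl a)) heq
      exact Sum.inl_injective ((DubOrd.alphaEquiv h (i, j) hp).injective h3)
    rw [h2]
  · intro e
    have hp : e (Sum.inr (0, 0)) ≠ e (Sum.inr (1, 0)) := fun h => by
      simpa using e.injective h
    obtain ⟨σ, hσ⟩ := exists_perm e
      (DubOrd.alphaEquiv h (e (Sum.inr (0, 0)), e (Sum.inr (1, 0))) hp) (by
        rintro ⟨c, i⟩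
        obtain rfl := Subsingleton.elim i 0
        rcases Fin.exists_fin_two.1 ⟨c, rfl⟩ with rfl | rfl <;> rfl)
    exact ⟨⟨σ, ⟨_, hp⟩⟩, hσ.symm⟩

/-- The differential `x ⊗ y ↦ ∑_{i ≠ j} x [α_{(i j)}] ⊗ [α_{(i j)}ᵒᵖ] y`. -/
def dirD : Co G F (DubOrd.fin N) →ₗ[k] Co G F (DubOrd.fin n) :=
  coMap (sumTen G F fun p : OrdPair N => DubOrd.alpha h p.1 p.2)
    ((represents_directed G F h).balanced G F fun s => DubOrd.one_post (A := DubOrd.fin n) s)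

end

/-- On morphisms of degree one, the transfer maps `[f]` to the sum of `[f]` and `δ [f']`, where `f'`
has the opposite directed pair. -/
lemma Tr_map_one (δ ε : ℤˣ) {A B : DubOrd} (e : A.carrier ⊕ (Fin 2 × Fin 1) ≃ B.carrier) :
    (Tr k δ ε).map ((Twisted.of k (DubOrd.twist₂ δ ε)).map (DubOrd.one e)) =
      (Twisted.of k (DubOrd.twist ε)).map (DubOrd.one e) +
        ((δ : ℤ) : k) • (Twisted.of k (DubOrd.twist ε)).map (DubOrd.one (A := A) (B := B)
          (((Equiv.refl _).sumCongr ((Equiv.swap 0 1).prodCongr (Equiv.refl _))).trans e)) := by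
  refine (Twisted.lift_map_of (trOrd k δ ε) (fun _ _ _ _ _ h => trOrd_rel k δ ε h)
    (DubOrd.one e)).trans ?_
  change ∑ c : Fin 1 → Equiv.Perm (Fin 2), (((∏ i, signChar δ (Fin 2) (c i) : ℤˣ) : ℤ) : k) •
    (Twisted.of k (DubOrd.twist ε)).map (X := A) (Y := B) ((DubOrd.one e).act 1 c) = _
  have hu : (Finset.univ : Finset (Equiv.Perm (Fin 2))) = {1, Equiv.swap 0 1} := by decide
  have hδ : signChar δ (Fin 2) (Equiv.swap 0 1) = δ := by
    rcases Int.units_eq_one_or δ with rfl | rfl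
    · simp [signChar]
    · simp only [signChar]
      rw [if_neg (by decide), Equiv.Perm.sign_swap (by simp)]
  rw [← Equiv.sum_comp (Equiv.funUnique (Fin 1) (Equiv.Perm (Fin 2))).symm, hu,
    Finset.sum_pair (by decide)]
  simp only [Fin.prod_univ_one]
  change ((((signChar δ (Fin 2) 1 : ℤˣ) : ℤ) : k)) •
      (Twisted.of k (DubOrd.twist ε)).map (X := A) (Y := B) ((DubOrd.one e).act 1 fun _ => 1) +
    ((((signChar δ (Fin 2) (Equiv.swap 0 1) : ℤˣ) : ℤ) : k)) •
      (Twisted.of k (DubOrd.twist ε)).map (X := A) (Y := B)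
        ((DubOrd.one e).act 1 fun _ => Equiv.swap 0 1) = _
  rw [hδ, map_one, DubOrd.Hom.act_one, Units.val_one, Int.cast_one, one_smul]
  rfl

lemma alpha_symm {n N : ℕ} (h : n + 2 = N) (p : Fin N × Fin N) (hp : p.1 ≠ p.2) :
    DubOrd.alpha h p.swap hp.symm =
      DubOrd.Hom.act (A := Fin n) (B := Fin N) (DubOrd.alpha h p hp) 1
        (fun _ => Equiv.swap 0 1) := by
  have hs : ({p.swap.1, p.swap.2}ᶜ : Finset (Fin N)) = {p.1, p.2}ᶜ := by
    rw [Finset.pair_comm]; rfl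
  have hc : ∀ (s t : Finset (Fin N)) (hst : s = t) (hs : s.card = n) (ht : t.card = n) (a),
      s.orderEmbOfFin hs a = t.orderEmbOfFin ht a := by
    rintro s _ rfl _ _ _
    rfl
  refine DubOrd.Hom.ext' (f := DubOrd.alpha h p.swap hp.symm) rfl (fun a => ?_) (fun c i => ?_)
  · have hq : ∀ q : Fin N × Fin N, q.1 ≠ q.2 → ({q.1, q.2}ᶜ : Finset (Fin N)).card = n :=
      fun q hq => by
        rw [Finset.card_compl, Finset.card_pair hq, Fintype.card_fin]
        omega
    exact hc _ _ hs (hq p.swap hp.symm) (hq p hp) a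
  rcases Fin.exists_fin_two.1 ⟨c, rfl⟩ with rfl | rfl <;> rfl

section
variable [CharZero k] {δ ε : ℤˣ}

/-- The sum over `i < j` represents the sum over all morphisms of degree one. -/
lemma represents_undirected (G : LMod.{u, v} k (Db k δ ε)) (F : LMod.{u, v} k (Db k δ (-ε)))
    {n N : ℕ} (h : n + 2 = N) :
    Represents G F (fun p : IncPair N => DubOrd.alpha h p.1 p.2.ne) (allOne n N) := by
  obtain ⟨c, hc, hca⟩ := represents_directed G F h
  refine ⟨c * 2, mul_ne_zero hc two_ne_zero, ?_⟩
  rw [← hca, mul_smul]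
  congr 1
  have hsw : ∀ (p : Fin N × Fin N) (hp : p.1 ≠ p.2),
      opTen G F (DubOrd.alpha h p.swap hp.symm) = opTen G F (DubOrd.alpha h p hp) := by
    intro p hp
    have h1 := opTen_rel G F (f := DubOrd.alpha h p hp) (f' := DubOrd.alpha h p.swap hp.symm)
      (r := DubOrd.Hom.wreathChar δ ε (1 : Equiv.Perm (Fin 1)) (fun _ => Equiv.swap 0 1))
      (r' := DubOrd.Hom.wreathChar δ (-ε) (1 : Equiv.Perm (Fin 1)) (fun _ => Equiv.swap 0 1))
      ⟨1, fun _ => Equiv.swap 0 1, rfl, alpha_symm h p hp⟩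
      ⟨1, fun _ => Equiv.swap 0 1, rfl, alpha_symm h p hp⟩
    rw [h1]
    simp [DubOrd.Hom.wreathChar]
  let e : IncPair N ⊕ IncPair N → OrdPair N :=
    Sum.elim (fun p => ⟨p.1, p.2.ne⟩) (fun p => ⟨p.1.swap, p.2.ne'⟩)
  have he : Function.Bijective e := by
    constructor
    · rintro (⟨p, hp⟩ | ⟨p, hp⟩) (⟨q, hq⟩ | ⟨q, hq⟩) hpq
      · have : p = q := congrArg Subtype.val hpq
        subst this; rfl
      · have : p = q.swap := congrArg Subtype.val hpq
        subst this; exact absurd hp hq.asymm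
      · have : p.swap = q := congrArg Subtype.val hpq
        subst this; exact absurd hp hq.asymm
      · have : p.swap = q.swap := congrArg Subtype.val hpq
        have : p = q := Prod.swap_injective this
        subst this; rfl
    · rintro ⟨p, hp⟩
      rcases lt_or_gt_of_ne hp with hp' | hp'
      · exact ⟨Sum.inl ⟨p, hp'⟩, rfl⟩
      · exact ⟨Sum.inr ⟨p.swap, hp'⟩, rfl⟩
  have h1 := Equiv.sum_comp (Equiv.ofBijective e he)
    fun p : OrdPair N => opTen G F (DubOrd.alpha h p.1 p.2)
  rw [sumTen, sumTen, ← h1, Fintype.sum_sum_type, two_smul]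
  refine congrArg₂ (· + ·) rfl (Finset.sum_congr rfl fun p _ => ?_)
  exact (hsw p.1 p.2.ne).symm

/-- The differential `x ⊗ y ↦ ∑_{i < j} x [α_{(i j)}] ⊗ [α_{(i j)}ᵒᵖ] y`. -/
def undD (G : LMod.{u, v} k (Db k δ ε)) (F : LMod.{u, v} k (Db k δ (-ε))) {n N : ℕ}
    (h : n + 2 = N) : Co G F (DubOrd.fin N) →ₗ[k] Co G F (DubOrd.fin n) :=
  coMap (sumTen G F fun p : IncPair N => DubOrd.alpha h p.1 p.2.ne)
    ((represents_undirected G F h).balanced G F fun s => DubOrd.one_post (A := DubOrd.fin n) s)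

lemma coFun_dirD {G G' : LMod.{u, v} k (Ddb k ε)} {F F' : LMod.{u, v} k (Ddb k (-ε))}
    (τ : G ⟶ G') (ρ : F ⟶ F') {n N : ℕ} (h : n + 2 = N) (w : Co G F (DubOrd.fin N)) :
    coFun τ ρ (DubOrd.fin n) (dirD G F h w) = dirD G' F' h (coFun τ ρ (DubOrd.fin N) w) :=
  coFun_coMap τ ρ _ _ _ w

lemma coFun_undD {G G' : LMod.{u, v} k (Db k δ ε)} {F F' : LMod.{u, v} k (Db k δ (-ε))}
    (τ : G ⟶ G') (ρ : F ⟶ F') {n N : ℕ} (h : n + 2 = N) (w : Co G F (DubOrd.fin N)) :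
    coFun τ ρ (DubOrd.fin n) (undD G F h w) = undD G' F' h (coFun τ ρ (DubOrd.fin N) w) :=
  coFun_coMap τ ρ _ _ _ w

lemma dirD_comp (G : LMod.{u, v} k (Ddb k ε)) (F : LMod.{u, v} k (Ddb k (-ε))) {n N M : ℕ}
    (h : n + 2 = N) (h' : N + 2 = M) : (dirD G F h).comp (dirD G F h') = 0 := by
  refine coMap_comp_zero G F (represents_directed G F h) (represents_directed G F h')
    (fun s => DubOrd.one_post (A := DubOrd.fin n) s) (fun e => ?_) _ _
  refine ⟨(exchangeAlong e).symm.equivCongr (Equiv.refl _), fun e' => ?_⟩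
  refine ⟨signChar ε (Fin 2) (Equiv.swap 0 1), signChar (-ε) (Fin 2) (Equiv.swap 0 1), ?_, ?_, ?_⟩
  · rw [signChar_mul_neg, Equiv.Perm.sign_swap (by simp)]
  · exact ⟨(Equiv.swap 0 1 : Equiv.Perm (Fin (1 + 1))), rfl, DubOrd.one_swap _ _⟩
  · exact ⟨(Equiv.swap 0 1 : Equiv.Perm (Fin (1 + 1))), rfl, DubOrd.one_swap _ _⟩

lemma undD_comp (G : LMod.{u, v} k (Db k δ ε)) (F : LMod.{u, v} k (Db k δ (-ε))) {n N M : ℕ}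
    (h : n + 2 = N) (h' : N + 2 = M) : (undD G F h).comp (undD G F h') = 0 := by
  refine coMap_comp_zero G F (represents_undirected G F h) (represents_undirected G F h')
    (fun s => DubOrd.one_post (A := DubOrd.fin n) s) (fun e => ?_) _ _
  refine ⟨(exchangeAlong e).symm.equivCongr (Equiv.refl _), fun e' => ?_⟩
  refine ⟨DubOrd.Hom.wreathChar δ ε (t := 2) (Equiv.swap 0 1) (fun _ => 1),
    DubOrd.Hom.wreathChar δ (-ε) (t := 2) (Equiv.swap 0 1) (fun _ => 1), ?_, ?_, ?_⟩
  · simp only [DubOrd.Hom.wreathChar, map_one, Finset.prod_const_one, one_mul]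
    rw [signChar_mul_neg, Equiv.Perm.sign_swap (by simp)]
  · exact ⟨(Equiv.swap 0 1 : Equiv.Perm (Fin (1 + 1))), fun _ => 1, rfl, DubOrd.one_swap _ _⟩
  · exact ⟨(Equiv.swap 0 1 : Equiv.Perm (Fin (1 + 1))), fun _ => 1, rfl, DubOrd.one_swap _ _⟩

end

/-! ### The Koszul complexes -/

/-- Chain complexes of `k`-modules indexed by `ℕ`, with differentials of degree `-2`. -/
abbrev Cx (k : Type u) [Field k] := HomologicalComplex (ModuleCat.{v} k) (ComplexShape.down' (2 : ℕ))

/-- The complex with the given objects and differentials. -/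
def mkCx (X : ℕ → ModuleCat.{v} k) (d : ∀ {n N : ℕ}, n + 2 = N → (X N ⟶ X n))
    (hd : ∀ {n N M : ℕ} (h : n + 2 = N) (h' : N + 2 = M), d h' ≫ d h = 0) : Cx.{u, v} k where
  X := X
  d i j := if h : j + 2 = i then d h else 0
  shape i j h := dif_neg h
  d_comp_d' i j l h h' := by
    have h : j + 2 = i := h
    have h' : l + 2 = j := h'
    rw [dif_pos h, dif_pos h']
    exact hd h' h

/-- The morphism of complexes with the given components. -/
def mkCxHom {X X' : ℕ → ModuleCat.{v} k} {d : ∀ {n N : ℕ}, n + 2 = N → (X N ⟶ X n)} {hd}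
    {d' : ∀ {n N : ℕ}, n + 2 = N → (X' N ⟶ X' n)} {hd'} (f : ∀ n, X n ⟶ X' n)
    (hf : ∀ {n N : ℕ} (h : n + 2 = N), f N ≫ d' h = d h ≫ f n) :
    mkCx X d hd ⟶ mkCx X' d' hd' where
  f := f
  comm' i j h := by
    have h : j + 2 = i := h
    simp only [mkCx, dif_pos h]
    exact hf h

section
variable (k) [CharZero k]

/-- The directed Koszul complex `G ⊗_{FB} F`, of a right module `G` over the twisted directed upward
category for `ε` and a module `F` over the twisted directed downward category for `-ε`. -/
def koszulDir (ε : ℤˣ) : LMod.{u, v} k (Ddb k ε) × LMod.{u, v} k (Ddb k (-ε)) ⥤ Cx.{u, v} k where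
  obj P := mkCx (fun t => ModuleCat.of k (Co P.1 P.2 (DubOrd.fin t)))
    (fun h => ModuleCat.ofHom (dirD P.1 P.2 h))
    (fun h h' => ModuleCat.hom_ext (dirD_comp P.1 P.2 h h'))
  map τ := mkCxHom (fun t => ModuleCat.ofHom (coFun τ.1 τ.2 (DubOrd.fin t)))
    (fun h => ModuleCat.hom_ext (LinearMap.ext fun w => (coFun_dirD τ.1 τ.2 h w).symm))
  map_id _ := HomologicalComplex.Hom.ext (funext fun t =>
    ModuleCat.hom_ext (coFun_id (DubOrd.fin t)))
  map_comp τ σ := HomologicalComplex.Hom.ext (funext fun t =>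
    ModuleCat.hom_ext (coFun_comp τ.1 τ.2 σ.1 σ.2 (DubOrd.fin t)))

/-- The undirected Koszul complex `G ⊗_{FB} F`, of a right module `G` over the twisted upward
category for `(δ; ε)` and a module `F` over the twisted downward category for `(δ; -ε)`. -/
def koszulUnd (δ ε : ℤˣ) :
    LMod.{u, v} k (Db k δ ε) × LMod.{u, v} k (Db k δ (-ε)) ⥤ Cx.{u, v} k where
  obj P := mkCx (fun t => ModuleCat.of k (Co P.1 P.2 (DubOrd.fin t)))
    (fun h => ModuleCat.ofHom (undD P.1 P.2 h))
    (fun h h' => ModuleCat.hom_ext (undD_comp P.1 P.2 h h'))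
  map τ := mkCxHom (fun t => ModuleCat.ofHom (coFun τ.1 τ.2 (DubOrd.fin t)))
    (fun h => ModuleCat.hom_ext (LinearMap.ext fun w => (coFun_undD τ.1 τ.2 h w).symm))
  map_id _ := HomologicalComplex.Hom.ext (funext fun t =>
    ModuleCat.hom_ext (coFun_id (DubOrd.fin t)))
  map_comp τ σ := HomologicalComplex.Hom.ext (funext fun t =>
    ModuleCat.hom_ext (coFun_comp τ.1 τ.2 σ.1 σ.2 (DubOrd.fin t)))

end

namespace UwbOrd

/-- The pair of finite sets with `m` and `n` elements, as an object. -/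
abbrev fin (m n : ℕ) : UwbOrd := ⟨Fin m, Fin n⟩

/-- Isomorphisms are pairs of bijections. -/
lemma eq_isoOfEquiv {A B : UwbOrd} (s : A ≅ B) :
    ∃ (e : A.left ≃ B.left) (e' : A.right ≃ B.right), s = isoOfEquiv e e' := by
  have h : Hom.deg s.hom + Hom.deg s.inv = 0 := congrArg Hom.deg s.hom_inv_id
  obtain ⟨d, e, e', hd⟩ : ∃ (d : ℕ) (e : A.left ⊕ Fin d ≃ B.left)
    (e' : A.right ⊕ Fin d ≃ B.right), s.hom = Hom.mk d e e' := ⟨_, _, _, rfl⟩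
  obtain rfl : d = 0 := by
    rw [hd] at h
    exact (Nat.add_eq_zero_iff.1 h).1
  refine ⟨(Equiv.sumEmpty _ _).symm.trans e, (Equiv.sumEmpty _ _).symm.trans e',
    Iso.ext (hd.trans ?_)⟩
  exact Hom.ext' rfl (fun _ => rfl) (fun _ => rfl) (fun i => i.elim0) (fun i => i.elim0)

/-- The data of a morphism of degree one. -/
abbrev One (A B : UwbOrd) : Type := (A.left ⊕ Fin 1 ≃ B.left) × (A.right ⊕ Fin 1 ≃ B.right)

/-- The degree one morphism given by a pair of bijections. -/
abbrev one {A B : UwbOrd} (e : One A B) : A ⟶ B := Hom.mk 1 e.1 e.2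

/-- The bijection `m ⨿ 1 ≃ m + 1`, identifying `m` with the complement of `i` by the order
preserving bijection, and `1` with `{i}`. -/
def betaEquiv {m : ℕ} (i : Fin (m + 1)) : Fin m ⊕ Fin 1 ≃ Fin (m + 1) :=
  Equiv.ofBijective (Sum.elim i.succAbove (fun _ => i)) (by
    refine (Fintype.bijective_iff_injective_and_card _).2 ⟨?_, by simp⟩
    refine Function.Injective.sumElim Fin.succAbove_right_injective
      (Function.injective_of_subsingleton _) (fun a _ => Fin.succAbove_ne i a))

/-- The morphism `β_{i, j}`, whose walled pair is `(i, j)`. -/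
def beta {m n : ℕ} (p : Fin (m + 1) × Fin (n + 1)) : fin m n ⟶ fin (m + 1) (n + 1) :=
  one (A := fin m n) (B := fin (m + 1) (n + 1)) (betaEquiv p.1, betaEquiv p.2)

lemma one_post {A B : UwbOrd} (s : B ≅ B) :
    ∃ σ : Equiv.Perm (One A B), ∀ e, one (A := A) (σ e) = one e ≫ s.hom := by
  obtain ⟨e, e', rfl⟩ := eq_isoOfEquiv s
  refine ⟨((Equiv.refl _).equivCongr e).prodCongr ((Equiv.refl _).equivCongr e'), fun f => ?_⟩
  exact Hom.ext' (f := one (A := A) (B := B) (f.1.trans e, f.2.trans e'))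
    (g := (one (A := A) (B := B) f).comp (Hom.ofEquiv e e')) rfl (fun _ => rfl) (fun _ => rfl)
    (fun i => (Hom.compAux_castAdd f.1 (Hom.ofEquiv e e').l i).symm)
    (fun i => (Hom.compAux_castAdd f.2 (Hom.ofEquiv e e').r i).symm)

lemma one_swap {A B C : UwbOrd} (e : One A B) (e' : One B C) :
    (one e ≫ one ((exchangeAlong e.1).trans e'.1, (exchangeAlong e.2).trans e'.2) : A ⟶ C) =
      Hom.act (X := A.left) (Y := A.right) (U := C.left) (V := C.right) (one e ≫ one e')
        (Equiv.swap (0 : Fin 2) 1 : Equiv.Perm (Fin (1 + 1))) := by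
  have aux : ∀ {X Y Z : Type} (f : X ⊕ Fin 1 ≃ Y) (g : Y ⊕ Fin 1 ≃ Z) (i : Fin 1),
      g (exchangeAlong f (Sum.inl (f (Sum.inr i)))) =
        Hom.compAux f g (Sum.inr (1 : Fin 2)) := by
    intro X Y Z f g i
    refine (congrArg g (exchangeAlong_inr f i)).trans ?_
    obtain rfl := Subsingleton.elim i 0
    exact (Hom.compAux_natAdd f g 0).symm
  have aux' : ∀ {X Y Z : Type} (f : X ⊕ Fin 1 ≃ Y) (g : Y ⊕ Fin 1 ≃ Z) (i : Fin 1),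
      g (exchangeAlong f (Sum.inr i)) = Hom.compAux f g (Sum.inr (0 : Fin 2)) := by
    intro X Y Z f g i
    refine (congrArg g (exchangeAlong_inr' f i)).trans ?_
    obtain rfl := Subsingleton.elim i 0
    exact (Hom.compAux_castAdd f g 0).symm
  refine Hom.ext_comp (f := one e)
    (g := one ((exchangeAlong e.1).trans e'.1, (exchangeAlong e.2).trans e'.2)) rfl
    (fun a => congrArg e'.1 (exchangeAlong_inl e.1 a))
    (fun a => congrArg e'.2 (exchangeAlong_inl e.2 a)) (fun i => ?_) (fun i => ?_) (fun i => ?_)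
    (fun i => ?_)
  · refine (aux e.1 e'.1 i).trans ?_
    obtain rfl : i = (0 : Fin 1) := Subsingleton.elim (α := Fin 1) i (0 : Fin 1)
    rfl
  · refine (aux e.2 e'.2 i).trans ?_
    obtain rfl : i = (0 : Fin 1) := Subsingleton.elim (α := Fin 1) i (0 : Fin 1)
    rfl
  · refine (aux' e.1 e'.1 i).trans ?_
    obtain rfl : i = (0 : Fin 1) := Subsingleton.elim (α := Fin 1) i (0 : Fin 1)
    rfl
  · refine (aux' e.2 e'.2 i).trans ?_
    obtain rfl : i = (0 : Fin 1) := Subsingleton.elim (α := Fin 1) i (0 : Fin 1)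
    rfl

lemma sum_one_comp {m n : ℕ} {B : UwbOrd} (σ : Equiv.Perm (Fin m)) (τ : Equiv.Perm (Fin n))
    (e : One (fin m n) B) :
    one (A := fin m n) ((σ.sumCongr (Equiv.refl _)).trans e.1,
      (τ.sumCongr (Equiv.refl _)).trans e.2) =
      (isoOfEquiv (A := fin m n) (B := fin m n) σ τ).hom ≫ one e := by
  have aux : ∀ {X Z : Type} (f : X ⊕ Fin 0 ≃ X) (g : X ⊕ Fin 1 ≃ Z) (i : Fin 1),
      g (Sum.inr i) = Hom.compAux f g (Sum.inr (Fin.natAdd 0 i)) :=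
    fun f g i => (Hom.compAux_natAdd f g i).symm
  refine (Hom.ext_comp (f := Hom.ofEquiv σ τ) (g := one e)
    (h := one (A := fin m n) ((σ.sumCongr (Equiv.refl _)).trans e.1,
      (τ.sumCongr (Equiv.refl _)).trans e.2)) rfl (fun _ => rfl) (fun _ => rfl)
    (fun i => i.elim0) (fun i => i.elim0) (fun i => ?_) (fun i => ?_)).symm
  · obtain rfl : i = (0 : Fin 1) := Subsingleton.elim (α := Fin 1) i (0 : Fin 1)
    rfl
  · obtain rfl : i = (0 : Fin 1) := Subsingleton.elim (α := Fin 1) i (0 : Fin 1)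
    rfl

end UwbOrd

section
variable [CharZero k] {ε : ℤˣ} (G : LMod.{u, v} k (Dwb k ε)) (F : LMod.{u, v} k (Dwb k (-ε)))

/-- All morphisms of degree one. -/
abbrev allOne₂ (m n : ℕ) (e : (Fin m ⊕ Fin 1 ≃ Fin (m + 1)) × (Fin n ⊕ Fin 1 ≃ Fin (n + 1))) :
    UwbOrd.fin m n ⟶ UwbOrd.fin (m + 1) (n + 1) :=
  UwbOrd.one (A := UwbOrd.fin m n) (B := UwbOrd.fin (m + 1) (n + 1)) e

lemma represents_walled (m n : ℕ) :
    Represents G F (UwbOrd.beta (m := m) (n := n)) (allOne₂ m n) := by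
  refine represents_of_bijective G F (S := Equiv.Perm (Fin m) × Equiv.Perm (Fin n))
    (fun σ => UwbOrd.isoOfEquiv (A := UwbOrd.fin m n) (B := UwbOrd.fin m n) σ.1 σ.2) _ _
    (fun q => ((q.1.1.sumCongr (Equiv.refl _)).trans (UwbOrd.betaEquiv q.2.1),
      (q.1.2.sumCongr (Equiv.refl _)).trans (UwbOrd.betaEquiv q.2.2))) ⟨?_, ?_⟩
    (fun q => UwbOrd.sum_one_comp (B := UwbOrd.fin (m + 1) (n + 1)) q.1.1 q.1.2
      (UwbOrd.betaEquiv q.2.1, UwbOrd.betaEquiv q.2.2))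
  · have inj : ∀ {r : ℕ} (σ σ' : Equiv.Perm (Fin r)) (i i' : Fin (r + 1)),
        (σ.sumCongr (Equiv.refl _)).trans (UwbOrd.betaEquiv i) =
          (σ'.sumCongr (Equiv.refl _)).trans (UwbOrd.betaEquiv i') → σ = σ' ∧ i = i' := by
      intro r σ σ' i i' heq
      have h0 := congrArg (fun e : Fin r ⊕ Fin 1 ≃ Fin (r + 1) => e (Sum.inr 0)) heq
      obtain rfl : i = i' := h0
      refine ⟨Equiv.ext fun a => ?_, rfl⟩
      have h3 := congrArg (fun e : Fin r ⊕ Fin 1 ≃ Fin (r + 1) => e (Sum.inl a)) heq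
      exact Sum.inl_injective ((UwbOrd.betaEquiv i).injective h3)
    rintro ⟨⟨σ, τ⟩, i, j⟩ ⟨⟨σ', τ'⟩, i', j'⟩ heq
    obtain ⟨rfl, rfl⟩ := inj _ _ _ _ (congrArg Prod.fst heq)
    obtain ⟨rfl, rfl⟩ := inj _ _ _ _ (congrArg Prod.snd heq)
    rfl
  · have surj : ∀ {r : ℕ} (e : Fin r ⊕ Fin 1 ≃ Fin (r + 1)), ∃ (σ : Equiv.Perm (Fin r))
        (i : Fin (r + 1)), (σ.sumCongr (Equiv.refl _)).trans (UwbOrd.betaEquiv i) = e := by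
      intro r e
      obtain ⟨σ, hσ⟩ := exists_perm e (UwbOrd.betaEquiv (e (Sum.inr 0))) (by
        intro i
        obtain rfl := Subsingleton.elim i 0
        rfl)
      exact ⟨σ, _, hσ.symm⟩
    rintro ⟨e, e'⟩
    obtain ⟨σ, i, rfl⟩ := surj e
    obtain ⟨τ, j, rfl⟩ := surj e'
    exact ⟨⟨⟨σ, τ⟩, i, j⟩, rfl⟩

/-- The component `x ⊗ y ↦ ∑_{i, j} x [β_{i, j}] ⊗ [β_{i, j}ᵒᵖ] y` of the differential. -/
def walD (m n : ℕ) :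
    Co G F (UwbOrd.fin (m + 1) (n + 1)) →ₗ[k] Co G F (UwbOrd.fin m n) :=
  coMap (sumTen G F (UwbOrd.beta (m := m) (n := n)))
    ((represents_walled G F m n).balanced G F fun s => UwbOrd.one_post (A := UwbOrd.fin m n) s)

lemma walD_comp (m n : ℕ) : (walD G F m n).comp (walD G F (m + 1) (n + 1)) = 0 := by
  refine coMap_comp_zero G F (represents_walled G F m n) (represents_walled G F (m + 1) (n + 1))
    (fun s => UwbOrd.one_post (A := UwbOrd.fin m n) s) (fun e => ?_) _ _
  refine ⟨((exchangeAlong e.1).symm.equivCongr (Equiv.refl _)).prodCongr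
    ((exchangeAlong e.2).symm.equivCongr (Equiv.refl _)), fun e' => ?_⟩
  refine ⟨signChar ε (Fin 2) (Equiv.swap 0 1), signChar (-ε) (Fin 2) (Equiv.swap 0 1), ?_, ?_, ?_⟩
  · rw [signChar_mul_neg, Equiv.Perm.sign_swap (by simp)]
  · exact ⟨(Equiv.swap 0 1 : Equiv.Perm (Fin (1 + 1))), rfl, UwbOrd.one_swap _ _⟩
  · exact ⟨(Equiv.swap 0 1 : Equiv.Perm (Fin (1 + 1))), rfl, UwbOrd.one_swap _ _⟩

/-- The direct sum of the `G(m, n) ⊗ F(m, n)`, over the group algebra of `𝔖_m × 𝔖_n`, for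
`m + n = t`. -/
abbrev WalCo (t : ℕ) : Type v :=
  ∀ p : {p : ℕ × ℕ // p.1 + p.2 = t}, Co G F (UwbOrd.fin p.1.1 p.1.2)

/-- The differential of the walled Koszul complex. -/
def walDiff {t s : ℕ} (h : t + 2 = s) : WalCo G F s →ₗ[k] WalCo G F t :=
  LinearMap.pi fun p => (walD G F p.1.1 p.1.2).comp
    (LinearMap.proj (⟨(p.1.1 + 1, p.1.2 + 1), by
      have := p.2
      dsimp only
      omega⟩ :
      {p : ℕ × ℕ // p.1 + p.2 = s}))

lemma walDiff_comp {t s r : ℕ} (h : t + 2 = s) (h' : s + 2 = r) :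
    (walDiff G F h).comp (walDiff G F h') = 0 :=
  LinearMap.ext fun z => funext fun p => LinearMap.congr_fun (walD_comp G F p.1.1 p.1.2)
    (z ⟨(p.1.1 + 1 + 1, p.1.2 + 1 + 1), by
      have := p.2
      dsimp only
      omega⟩)

variable {G F} {G' : LMod.{u, v} k (Dwb k ε)} {F' : LMod.{u, v} k (Dwb k (-ε))}

/-- The map induced by morphisms `G ⟶ G'` and `F ⟶ F'`. -/
def walFun (τ : G ⟶ G') (ρ : F ⟶ F') (t : ℕ) : WalCo G F t →ₗ[k] WalCo G' F' t :=
  LinearMap.pi fun p => (coFun τ ρ (UwbOrd.fin p.1.1 p.1.2)).comp (LinearMap.proj p)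

lemma coFun_walD (τ : G ⟶ G') (ρ : F ⟶ F') (m n : ℕ) (w) :
    coFun τ ρ (UwbOrd.fin m n) (walD G F m n w) =
      walD G' F' m n (coFun τ ρ (UwbOrd.fin (m + 1) (n + 1)) w) :=
  coFun_coMap τ ρ _ _ _ w

lemma walFun_walDiff (τ : G ⟶ G') (ρ : F ⟶ F') {t s : ℕ} (h : t + 2 = s) (z : WalCo G F s) :
    walFun τ ρ t (walDiff G F h z) = walDiff G' F' h (walFun τ ρ s z) :=
  funext fun p => coFun_walD τ ρ p.1.1 p.1.2 _

variable (k) in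
/-- The walled Koszul complex `G ⊗_{FB × FB} F`, of a right module `G` over the twisted upward
walled category for `ε` and a module `F` over the twisted downward walled category for `-ε`. -/
def koszulWal (ε : ℤˣ) : LMod.{u, v} k (Dwb k ε) × LMod.{u, v} k (Dwb k (-ε)) ⥤ Cx.{u, v} k where
  obj P := mkCx (fun t => ModuleCat.of k (WalCo P.1 P.2 t))
    (fun h => ModuleCat.ofHom (walDiff P.1 P.2 h))
    (fun h h' => ModuleCat.hom_ext (walDiff_comp P.1 P.2 h h'))
  map τ := mkCxHom (fun t => ModuleCat.ofHom (walFun τ.1 τ.2 t))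
    (fun h => ModuleCat.hom_ext (LinearMap.ext fun w => (walFun_walDiff τ.1 τ.2 h w).symm))
  map_id _ := HomologicalComplex.Hom.ext (funext fun t => ModuleCat.hom_ext
    (LinearMap.ext fun z => funext fun p => LinearMap.congr_fun (coFun_id _) (z p)))
  map_comp τ σ := HomologicalComplex.Hom.ext (funext fun t => ModuleCat.hom_ext
    (LinearMap.ext fun z => funext fun p =>
      LinearMap.congr_fun (coFun_comp τ.1 τ.2 σ.1 σ.2 _) (z p)))

end

/-! ### The functors on module categories -/

section
variable (k)

/-- The functor `dΥ` between downward categories, opposite to `Υ`. -/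
abbrev dUpsilon (ε : ℤˣ) : Dwb k ε ⥤ Ddb k ε := (Upsilon k ε).op

/-- The functor `dmp` between downward categories, opposite to the canonical projection. -/
abbrev dmp (δ ε : ℤˣ) : Ddb k ε ⥤ Db k δ ε := (mp k δ ε).op

/-- The transfer functor between downward categories. -/
abbrev dTr (δ ε : ℤˣ) : Db k δ ε ⥤ Ddb k ε := (Tr k δ ε).op

/-- The composite `dυ = dmp ∘ dΥ`. -/
abbrev dups (δ ε : ℤˣ) : Dwb k ε ⥤ Db k δ ε := dUpsilon k ε ⋙ dmp k δ ε

/-- The composite `dJ = dTr^* ∘ (dΥ)_*`. -/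
def dJ (δ ε : ℤˣ) : LMod.{u, v} k (Dwb k ε) ⥤ LMod.{u, v} k (Db k δ ε) :=
  coind k ε ⋙ res k (dTr k δ ε)

end

end Brauer

end

open Brauer

/-! Directed versus undirected. The projection and the transfer are the identity on objects and on
bijections, so both tensor products over the symmetric groups are literally the same space
(`balanced_res_dmp`). Only the differentials need comparison. In the sum over `i ≠ j`, group
`α_(ij)` with `α_(ji)` for `i < j`. On the undirected module `α_(ji)` acts as `δ` times `α_(ij)`
(`opMap_alpha_swap`). Moving `δ` across the tensor sign gives `(x[α_(ij)] + δ x[α_(ji)]) ⊗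
[α_(ij)ᵒᵖ] y`, whose first factor is the action of the transfer of `α_(ij)`
(`coTransfer_opTen_add`).

Walled versus directed. The coinduced module is the sum of the `G(X₁, X₂)` over all decompositions
of `X`. Induced from `𝔖_m × 𝔖_n` to `𝔖_t`, the component `G(m, n)` accounts for the decompositions
into parts of sizes `m` and `n`, so Frobenius reciprocity identifies the tensor products. Two
explicit maps realize this identification. The map `wallCo` averages: it sends `x ⊗ y` to `1/(m!
n!)` times the sum, over all bijections `e : m ⨿ n ≃ t`, of `x[e] ⊗ [eᵒᵖ] y`, with the counit of the
adjunction applied to the first factor. It involves no choices. The map `inclCo` places `G(m, n)` as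
one component of the coinduced module, along a chosen bijection.

The average commutes with the differentials because both composites are `1/(m! n!)` times one sum,
`sumCrossOne`, over all degree one morphisms `m ⨿ n ⟶ t + 2`. On one side each such morphism factors
uniquely as a bijection followed by some `α_(ij)` (`wallCo_dirD`). On the other side it factors
through every one of the `(m+1)(n+1)` morphisms `β_(i,j)`, and this multiplicity turns `1/((m+1)!
(n+1)!)` into `1/(m! n!)` (`walD_wallCo`).

The average is inverse to the inclusions. After inclusion, a bijection contributes only if it
respects the two parts (`crossTen_inclCoind_of_not`). The surviving ones form `𝔖_m × 𝔖_n`, each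
returning the original class (`crossTen_inclCoind_sumCongr`), and `m! n!` cancels. The inclusions
are jointly surjective, since every decomposition is isomorphic to a standard one
(`inclSum_surjective`).

The composite statement applies the directed-undirected comparison to the coinduced module of `G`,
then the walled-directed comparison to the restriction of `B` along `dmp`. -/

noncomputable section

namespace Brauer

/-! ### Transfer: comparison of directed and undirected pairs -/

section Undirected

variable {k : Type u} [Field k]

/-- With no pairs there is a single, empty family of direction changes, of sign `1`. Hence the
transfer does not alter the actions of the symmetric groups. -/
lemma trSum_ofEquiv (δ ε : ℤˣ) {A B : DubOrd} (e : A.carrier ≃ B.carrier) :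
    trSum k δ ε (A := A) (B := B) (DubOrd.Hom.ofEquiv e) =
      (Twisted.of k (DubOrd.twist ε)).map (X := A) (Y := B) (DubOrd.Hom.ofEquiv e) := by
  have : Subsingleton (Fin (DubOrd.Hom.ofEquiv e).deg → Equiv.Perm (Fin 2)) :=
    inferInstanceAs (Subsingleton (Fin 0 → Equiv.Perm (Fin 2)))
  have hp : (∏ _i : Fin (DubOrd.Hom.ofEquiv e).deg, (1 : ℤˣ)) = 1 := by simp
  rw [trSum, Fintype.sum_subsingleton _ (fun _ => 1)]
  simp only [map_one, hp]
  rw [DubOrd.Hom.act_one, Units.val_one, Int.cast_one, one_smul]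

lemma opMap_res_dmp (δ ε : ℤˣ) (B : LMod.{u, v} k (Db k δ ε)) {X Y : DubOrd} (f : X ⟶ Y)
    (y : B.obj.obj (op ((Twisted.of k (DubOrd.twist₂ δ ε)).obj Y))) :
    opMap ((res k (dmp k δ ε)).obj B).obj f y = opMap B.obj f y := by
  have : (mp k δ ε).map ((Twisted.of k (DubOrd.twist ε)).map f) =
      (Twisted.of k (DubOrd.twist₂ δ ε)).map f :=
    Twisted.lift_map_of _ _ _
  exact LinearMap.congr_fun (congrArg (fun h => (B.obj.map (Quiver.Hom.op h)).hom) this) y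

lemma opMap_res_dTr_ofEquiv (δ ε : ℤˣ) (N : LMod.{u, v} k (Ddb k ε)) {X Y : DubOrd}
    (e : X.carrier ≃ Y.carrier)
    (x : N.obj.obj (op ((Twisted.of k (DubOrd.twist ε)).obj Y))) :
    opMap ((res k (dTr k δ ε)).obj N).obj (X := X) (Y := Y) (DubOrd.Hom.ofEquiv e) x =
      opMap N.obj (X := X) (Y := Y) (DubOrd.Hom.ofEquiv e) x := by
  have : (Tr k δ ε).map ((Twisted.of k (DubOrd.twist₂ δ ε)).map (X := X) (Y := Y)
        (DubOrd.Hom.ofEquiv e)) =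
      (Twisted.of k (DubOrd.twist ε)).map (X := X) (Y := Y) (DubOrd.Hom.ofEquiv e) :=
    (Twisted.lift_map_of _ _ _).trans (trSum_ofEquiv δ ε e)
  exact LinearMap.congr_fun (congrArg (fun h => (N.obj.map (Quiver.Hom.op h)).hom) this) x

/-- A directed pair and its opposite, on the transferred module. -/
lemma opMap_res_dTr_alpha (δ ε : ℤˣ) (N : LMod.{u, v} k (Ddb k ε)) {n m : ℕ} (h : n + 2 = m)
    (p : Fin m × Fin m) (hp : p.1 ≠ p.2)
    (x : N.obj.obj (op ((Twisted.of k (DubOrd.twist ε)).obj (DubOrd.fin m)))) :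
    opMap ((res k (dTr k δ ε)).obj N).obj (DubOrd.alpha h p hp) x =
      opMap N.obj (DubOrd.alpha h p hp) x +
        ((δ : ℤ) : k) • opMap N.obj (DubOrd.alpha h p.swap hp.symm) x := by
  obtain ⟨_, _⟩ := N.property
  have h1 := Tr_map_one (k := k) δ ε (A := DubOrd.fin n) (B := DubOrd.fin m)
    (DubOrd.alphaEquiv h p hp)
  -- Reversing the pair of `α_(ij)` yields exactly `α_(ji)`: the complement of `{i, j}`, with its
  -- order preserving numbering, is unchanged.
  have h2 : DubOrd.one (A := DubOrd.fin n) (B := DubOrd.fin m)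
      (((Equiv.refl _).sumCongr ((Equiv.swap 0 1).prodCongr (Equiv.refl _))).trans
        (DubOrd.alphaEquiv h p hp)) = DubOrd.alpha h p.swap hp.symm :=
    (DubOrd.Hom.ext' rfl (fun _ => rfl) (fun _ _ => rfl)).trans (alpha_symm h p hp).symm
  rw [h2] at h1
  have h3 : ∀ {X Y : Dub k ε} (f g : X ⟶ Y) (c : k),
      N.obj.map (f + c • g).op = N.obj.map f.op + c • N.obj.map g.op := fun f g c => by
    rw [op_add, Functor.map_add]
    exact congrArg _ (N.obj.map_smul c g.op)
  refine (LinearMap.congr_fun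
    (congrArg (fun g => (N.obj.map (Quiver.Hom.op g)).hom) h1) x).trans ?_
  exact LinearMap.congr_fun (congrArg ModuleCat.Hom.hom (h3 _ _ _)) x

variable {δ ε : ℤˣ} (N : LMod.{u, v} k (Ddb k ε)) (B : LMod.{u, v} k (Db k δ (-ε)))

/-- The relations involve only automorphisms, which are bijections, and there both functors act as
the identity; so the two spans have the same generators. The equation is well typed because both
functors are also the identity on objects. -/
lemma balanced_res_dmp (X : DubOrd) :
    balanced N ((res k (dmp k δ (-ε))).obj B) X = balanced ((res k (dTr k δ ε)).obj N) B X := by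
  refine congrArg (Submodule.span k) (Set.ext fun z => ?_)
  refine exists_congr fun s => ?_
  obtain ⟨e, rfl⟩ := DubOrd.eq_isoOfEquiv s
  refine exists_congr fun x => exists_congr fun y => ?_
  have h1 := opMap_res_dTr_ofEquiv δ ε N e x
  have h2 := opMap_res_dmp δ (-ε) B (DubOrd.isoOfEquiv e).inv y
  refine Eq.congr_right ?_
  exact congrArg₂ (fun a b => a ⊗ₜ[k] y - x ⊗ₜ[k] b) h1.symm h2

/-- The identity, as a map between the tensor products over `k`. -/
def tenTransfer (X : DubOrd) : Ten N ((res k (dmp k δ (-ε))).obj B) X ≃ₗ[k]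
    Ten ((res k (dTr k δ ε)).obj N) B X :=
  LinearEquiv.refl k _

/-- The directed tensor product with a restricted module is the undirected tensor product with the
transferred one. -/
def coTransfer (X : DubOrd) : Co N ((res k (dmp k δ (-ε))).obj B) X ≃ₗ[k]
    Co ((res k (dTr k δ ε)).obj N) B X :=
  Submodule.quotEquivOfEq _ _ (balanced_res_dmp N B X)

lemma coTransfer_mkQ (X : DubOrd) (z : Ten N ((res k (dmp k δ (-ε))).obj B) X) :
    coTransfer N B X ((balanced N ((res k (dmp k δ (-ε))).obj B) X).mkQ z) =
      (balanced ((res k (dTr k δ ε)).obj N) B X).mkQ (tenTransfer N B X z) := rfl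

lemma signChar_swap (δ : ℤˣ) : signChar δ (Fin 2) (Equiv.swap 0 1) = δ := by
  rcases Int.units_eq_one_or δ with rfl | rfl
  · simp [signChar]
  · simp only [signChar]
    rw [if_neg (by decide), Equiv.Perm.sign_swap (by simp)]

/-- The two generators differ by the wreath product element with trivial permutation and one
transposition in `𝔖_2`. Its character is `δ`; the sign `-ε` only sees the trivial permutation. -/
lemma opMap_alpha_swap {n m : ℕ} (h : n + 2 = m) (p : Fin m × Fin m) (hp : p.1 ≠ p.2) :
    opMap B.obj (DubOrd.alpha h p.swap hp.symm) =
      ((δ : ℤ) : k) • opMap B.obj (DubOrd.alpha h p hp) := by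
  have h1 := opMap_rel B.property (f := DubOrd.alpha h p hp) (f' := DubOrd.alpha h p.swap hp.symm)
    (s := DubOrd.Hom.wreathChar δ (-ε) (1 : Equiv.Perm (Fin 1)) (fun _ => Equiv.swap 0 1))
    ⟨1, fun _ => Equiv.swap 0 1, rfl, alpha_symm h p hp⟩
  have h2 : DubOrd.Hom.wreathChar δ (-ε) (1 : Equiv.Perm (Fin 1)) (fun _ => Equiv.swap 0 1) = δ := by
    simp [DubOrd.Hom.wreathChar, signChar_swap]
  rwa [h2] at h1

/-- A sum over pairs of distinct elements is a sum over increasing pairs. -/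
lemma sum_ordPair {M : Type*} [AddCommMonoid M] {m : ℕ} (φ : OrdPair m → M) :
    ∑ p, φ p = ∑ p : IncPair m, (φ ⟨p.1, p.2.ne⟩ + φ ⟨p.1.swap, p.2.ne'⟩) := by
  let e : IncPair m ⊕ IncPair m → OrdPair m :=
    Sum.elim (fun p => ⟨p.1, p.2.ne⟩) (fun p => ⟨p.1.swap, p.2.ne'⟩)
  have he : Function.Bijective e := by
    constructor
    · rintro (⟨p, hp⟩ | ⟨p, hp⟩) (⟨q, hq⟩ | ⟨q, hq⟩) hpq
      · obtain rfl : p = q := congrArg Subtype.val hpq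
        rfl
      · obtain rfl : p = q.swap := congrArg Subtype.val hpq
        exact absurd hp hq.asymm
      · obtain rfl : p.swap = q := congrArg Subtype.val hpq
        exact absurd hp hq.asymm
      · obtain rfl : p = q := Prod.swap_injective (congrArg Subtype.val hpq)
        rfl
    · rintro ⟨p, hp⟩
      rcases lt_or_gt_of_ne hp with hp' | hp'
      · exact ⟨Sum.inl ⟨p, hp'⟩, rfl⟩
      · exact ⟨Sum.inr ⟨p.swap, hp'⟩, rfl⟩
  rw [← Equiv.sum_comp (Equiv.ofBijective e he) φ, Fintype.sum_sum_type, Finset.sum_add_distrib]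
  rfl

/-- The two directed terms of one unordered pair add up to its single undirected term. Summed over
`i < j`, this is the comparison of the differentials. -/
lemma coTransfer_opTen_add {n m : ℕ} (h : n + 2 = m) (p : Fin m × Fin m) (hp : p.1 ≠ p.2)
    (z : Ten N ((res k (dmp k δ (-ε))).obj B) (DubOrd.fin m)) :
    coTransfer N B (DubOrd.fin n)
        (opTen N ((res k (dmp k δ (-ε))).obj B) (DubOrd.alpha h p hp) z +
          opTen N ((res k (dmp k δ (-ε))).obj B) (DubOrd.alpha h p.swap hp.symm) z) =
      opTen ((res k (dTr k δ ε)).obj N) B (DubOrd.alpha h p hp)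
        (tenTransfer N B (DubOrd.fin m) z) := by
  induction z using TensorProduct.induction_on with
  | zero => simp only [map_zero, add_zero]
  | add z z' hz hz' =>
    rw [map_add (opTen N _ _), map_add (opTen N _ _), add_add_add_comm,
      map_add (coTransfer N B (DubOrd.fin n)), hz, hz', map_add (tenTransfer N B (DubOrd.fin m)),
      map_add]
  | tmul x y =>
    have h1 : opMap ((res k (dmp k δ (-ε))).obj B).obj (DubOrd.alpha h p.swap hp.symm) y =
        ((δ : ℤ) : k) • opMap ((res k (dmp k δ (-ε))).obj B).obj (DubOrd.alpha h p hp) y :=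
      (opMap_res_dmp δ (-ε) B _ y).trans ((LinearMap.congr_fun (opMap_alpha_swap B h p hp) y).trans
        (congrArg (fun b => ((δ : ℤ) : k) • b)
          (opMap_res_dmp δ (-ε) B (DubOrd.alpha h p hp) y).symm))
    -- The sign `δ` crosses from the second factor to the first; both terms then share the second
    -- factor and can be added.
    rw [opTen_tmul, opTen_tmul, h1, ← TensorProduct.smul_tmul,
      ← map_add (balanced N ((res k (dmp k δ (-ε))).obj B) (DubOrd.fin n)).mkQ, coTransfer_mkQ,
      ← TensorProduct.add_tmul]
    refine congrArg (balanced ((res k (dTr k δ ε)).obj N) B (DubOrd.fin n)).mkQ ?_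
    exact congrArg₂ (fun a b => a ⊗ₜ[k] b) (opMap_res_dTr_alpha δ ε N h p hp x).symm
      (opMap_res_dmp δ (-ε) B (DubOrd.alpha h p hp) y)

variable [CharZero k]

lemma coTransfer_dirD {n m : ℕ} (h : n + 2 = m)
    (w : Co N ((res k (dmp k δ (-ε))).obj B) (DubOrd.fin m)) :
    coTransfer N B (DubOrd.fin n) (dirD N ((res k (dmp k δ (-ε))).obj B) h w) =
      undD ((res k (dTr k δ ε)).obj N) B h (coTransfer N B (DubOrd.fin m) w) := by
  obtain ⟨z, rfl⟩ := Submodule.mkQ_surjective _ w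
  rw [coTransfer_mkQ]
  simp only [dirD, undD, coMap_mkQ, sumTen, LinearMap.sum_apply]
  rw [sum_ordPair, map_sum]
  exact Finset.sum_congr rfl fun p _ => coTransfer_opTen_add N B h p.1 p.2.ne z

end Undirected

/-! ### Isomorphisms of complexes from isomorphisms in each degree -/

section Complexes

variable (k : Type u) [Field k] [CharZero k] (δ ε : ℤˣ)

/-- Differentials built by `mkCx` are case distinctions on the degrees. This lemma and the next two
evaluate them in the case where they need not vanish. -/
lemma koszulDir_d (P : LMod.{u, v} k (Ddb k ε) × LMod.{u, v} k (Ddb k (-ε))) {n m : ℕ}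
    (h : n + 2 = m) : ((koszulDir k ε).obj P).d m n = ModuleCat.ofHom (dirD P.1 P.2 h) :=
  dif_pos h

lemma koszulUnd_d (P : LMod.{u, v} k (Db k δ ε) × LMod.{u, v} k (Db k δ (-ε))) {n m : ℕ}
    (h : n + 2 = m) : ((koszulUnd k δ ε).obj P).d m n = ModuleCat.ofHom (undD P.1 P.2 h) :=
  dif_pos h

lemma koszulWal_d (P : LMod.{u, v} k (Dwb k ε) × LMod.{u, v} k (Dwb k (-ε))) {n m : ℕ}
    (h : n + 2 = m) : ((koszulWal k ε).obj P).d m n = ModuleCat.ofHom (walDiff P.1 P.2 h) :=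
  dif_pos h

/-- A natural isomorphism of complexes from natural, componentwise isomorphisms. -/
def cxNatIso {k : Type u} [Field k] {P : Type*} [Category* P] {K L : P ⥤ Cx.{u, v} k}
    (f : ∀ p t, (K.obj p).X t ≅ (L.obj p).X t)
    (hf : ∀ p {n N : ℕ}, n + 2 = N →
      (f p N).hom ≫ (L.obj p).d N n = (K.obj p).d N n ≫ (f p n).hom)
    (nat : ∀ {p q} (τ : p ⟶ q) t, (K.map τ).f t ≫ (f q t).hom = (f p t).hom ≫ (L.map τ).f t) :
    K ≅ L :=
  NatIso.ofComponents (fun p => HomologicalComplex.Hom.isoOfComponents (f p) fun _ _ h => hf p h)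
    (fun τ => HomologicalComplex.Hom.ext (funext fun t => nat τ t))

/-- The isomorphism between the directed and the undirected Koszul complexes. -/
def koszulTransferIso :
    (𝟭 (LMod.{u, v} k (Ddb k ε))).prod (res k (dmp k δ (-ε))) ⋙ koszulDir k ε ≅
      (res k (dTr k δ ε)).prod (𝟭 (LMod.{u, v} k (Db k δ (-ε)))) ⋙ koszulUnd k δ ε :=
  cxNatIso (fun P t => (coTransfer P.1 P.2 (DubOrd.fin t)).toModuleIso)
    (fun P n N h => by
      have h1 := koszulUnd_d k δ ε (((res k (dTr k δ ε)).prod (𝟭 _)).obj P) h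
      have h2 := koszulDir_d k ε (((𝟭 _).prod (res k (dmp k δ (-ε)))).obj P) h
      refine ModuleCat.hom_ext (LinearMap.ext fun w => ?_)
      refine (LinearMap.congr_fun (congrArg ModuleCat.Hom.hom h1) _).trans ?_
      refine Eq.trans ?_ (congrArg (coTransfer P.1 P.2 (DubOrd.fin n))
        (LinearMap.congr_fun (congrArg ModuleCat.Hom.hom h2) w)).symm
      exact (coTransfer_dirD P.1 P.2 h w).symm)
    -- On representatives `coTransfer` is the identity, so naturality holds by definition there.
    (fun τ t => ModuleCat.hom_ext (LinearMap.ext fun w => by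
      obtain ⟨z, rfl⟩ := Submodule.mkQ_surjective _ w
      rfl))

/-- The isomorphism for the composite functors, from that for the unwalling functor. -/
def koszulCompositeIso
    (η : (𝟭 (LMod.{u, v} k (Dwb k ε))).prod (res k (dUpsilon k (-ε))) ⋙ koszulWal k ε ≅
      (coind k ε).prod (𝟭 (LMod.{u, v} k (Ddb k (-ε)))) ⋙ koszulDir k ε) :
    (dJ k δ ε).prod (𝟭 (LMod.{u, v} k (Db k δ (-ε)))) ⋙ koszulUnd k δ ε ≅
      (𝟭 (LMod.{u, v} k (Dwb k ε))).prod (res k (dups k δ (-ε))) ⋙ koszulWal k ε :=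
  -- Coinduction changes the first variable and restriction along `dmp` the second. They therefore
  -- commute on the nose, and the two whiskered isomorphisms can be composed without an intermediate
  -- one.
  (Functor.isoWhiskerLeft ((coind k ε).prod (𝟭 (LMod.{u, v} k (Db k δ (-ε)))))
    (koszulTransferIso k δ ε)).symm ≪≫
  (Functor.isoWhiskerLeft ((𝟭 (LMod.{u, v} k (Dwb k ε))).prod (res k (dmp k δ (-ε)))) η).symm

end Complexes

/-! ### Evaluation of the coinduced module through the counit -/

section Unwalling

variable {k : Type u} [Field k] {ε : ℤˣ}

lemma opMap_coind (G : LMod.{u, v} k (Dwb k ε)) {X Y : DubOrd} (f : X ⟶ Y)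
    (x : ((coind k ε).obj G).obj.obj (op ((Twisted.of k (DubOrd.twist ε)).obj Y))) :
    opMap ((coind k ε).obj G).obj f x = coindMap G f x :=
  LinearMap.congr_fun (congrArg ModuleCat.Hom.hom (coindFunctor_map G f)) x

/-- The action of `f : A₁ ⨿ A₂ ⟶ X` on the coinduced module, followed by the counit. -/
def evalCoind (G : LMod.{u, v} k (Dwb k ε)) {A : UwbOrd} {X : DubOrd} (f : unW.obj A ⟶ X) :
    ((coind k ε).obj G).obj.obj (op ((Twisted.of k (DubOrd.twist ε)).obj X)) →ₗ[k]
      G.obj.obj (op ((Twisted.of k (UwbOrd.twist ε)).obj A)) :=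
  (counitApp G A).comp (opMap ((coind k ε).obj G).obj f)

variable (G : LMod.{u, v} k (Dwb k ε)) (M : LMod.{u, v} k (Ddb k (-ε)))

lemma evalCoind_comp {A : UwbOrd} {X Y : DubOrd} (f : unW.obj A ⟶ X) (g : X ⟶ Y) (x) :
    evalCoind G (f ≫ g) x = evalCoind G f (opMap ((coind k ε).obj G).obj g x) :=
  congrArg (counitApp G A) (opMap_comp ((coind k ε).obj G).obj f g x)

/-- This is naturality of the counit: a walled factor in front comes out as its action on `G`. -/
lemma evalCoind_unW {A B : UwbOrd} {X : DubOrd} (b : A ⟶ B) (f : unW.obj B ⟶ X) (x) :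
    evalCoind G (unW.map b ≫ f) x = opMap G.obj b (evalCoind G f x) := by
  refine (congrArg (counitApp G A) (opMap_comp ((coind k ε).obj G).obj _ f x)).trans ?_
  exact (congrArg (counitApp G A) (opMap_coind G _ _)).trans (counitApp_natural G b _)

/-- The map `x ⊗ y ↦ x [f] ⊗ [fᵒᵖ] y`, followed by the counit. -/
def crossTen {A : UwbOrd} {X : DubOrd} (f : unW.obj A ⟶ X) :
    Ten ((coind k ε).obj G) M X →ₗ[k] Co G ((res k (dUpsilon k (-ε))).obj M) A :=
  (balanced G ((res k (dUpsilon k (-ε))).obj M) A).mkQ.comp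
    (TensorProduct.map (evalCoind G f) (opMap M.obj f))

lemma crossTen_tmul {A : UwbOrd} {X : DubOrd} (f : unW.obj A ⟶ X) (x y) :
    crossTen G M f (x ⊗ₜ[k] y) = (balanced G ((res k (dUpsilon k (-ε))).obj M) A).mkQ
      (evalCoind G f x ⊗ₜ[k] opMap M.obj f y) := rfl

/-- A morphism out of `A₁ ⨿ A₂` can be factored at either end. A final factor `g` acts on the
directed tensor product, whereas an initial walled factor acts on the walled one, as in
`crossTen_unW`. The two differentials are compared through these two factorizations. -/
lemma crossTen_comp {A : UwbOrd} {X Y : DubOrd} (f : unW.obj A ⟶ X) (g : X ⟶ Y) (x y) :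
    crossTen G M (f ≫ g) (x ⊗ₜ[k] y) =
      crossTen G M f (opMap ((coind k ε).obj G).obj g x ⊗ₜ[k] opMap M.obj g y) := by
  rw [crossTen_tmul, crossTen_tmul, evalCoind_comp, opMap_comp M.obj]

lemma crossTen_unW {A B : UwbOrd} {X : DubOrd} (b : A ⟶ B) (f : unW.obj B ⟶ X) (x y) :
    crossTen G M (unW.map b ≫ f) (x ⊗ₜ[k] y) =
      opTen G ((res k (dUpsilon k (-ε))).obj M) b (evalCoind G f x ⊗ₜ[k] opMap M.obj f y) := by
  rw [crossTen_tmul, evalCoind_unW, opMap_comp M.obj]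
  exact congrArg (fun c => (balanced G ((res k (dUpsilon k (-ε))).obj M) A).mkQ
    (opMap G.obj b (evalCoind G f x) ⊗ₜ[k] c)) (opMap_res M b _).symm

end Unwalling

/-! ### Morphisms of degree at most one out of a disjoint union -/

namespace DubOrd

/-- The isomorphism `A₁ ⨿ A₂ ≅ X` given by a bijection. -/
def unwIso {A : UwbOrd} {X : DubOrd} (e : A.left ⊕ A.right ≃ X.carrier) : unW.obj A ≅ X :=
  isoOfEquiv (A := unW.obj A) e

/-- The morphism `A₁ ⨿ A₂ ⟶ X` of degree one given by a bijection. -/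
def unwOne {A : UwbOrd} {X : DubOrd} (g : (A.left ⊕ A.right) ⊕ (Fin 2 × Fin 1) ≃ X.carrier) :
    unW.obj A ⟶ X :=
  one (A := unW.obj A) g

lemma unwIso_comp {A : UwbOrd} {X Y : DubOrd} (e : A.left ⊕ A.right ≃ X.carrier)
    (u : X.carrier ≃ Y.carrier) :
    (unwIso e).hom ≫ (isoOfEquiv u).hom = (unwIso (e.trans u)).hom :=
  Hom.ext_comp (f := Hom.ofEquiv e) (g := Hom.ofEquiv u) (h := Hom.ofEquiv (e.trans u)) rfl
    (fun _ => rfl) (fun _ i => i.elim0) (fun _ i => i.elim0)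

/-- This and `unW_one_comp` identify the bijections underlying the two factorizations of a degree
one morphism, so that sums over factorizations can be reindexed by sums over bijections. -/
lemma unwIso_comp_one {A : UwbOrd} {X Y : DubOrd} (e : A.left ⊕ A.right ≃ X.carrier)
    (g : X.carrier ⊕ (Fin 2 × Fin 1) ≃ Y.carrier) :
    (unwIso e).hom ≫ one g = unwOne ((e.sumCongr (Equiv.refl _)).trans g) := by
  refine Hom.ext_comp (f := Hom.ofEquiv e) (g := one (A := X) (B := Y) g)
    (h := unwOne ((e.sumCongr (Equiv.refl _)).trans g)) rfl (fun _ => rfl)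
    (fun _ i => i.elim0) (fun c i => ?_)
  obtain rfl := Subsingleton.elim i 0
  rfl

lemma unW_one_comp {A B : UwbOrd} {X : DubOrd} (b : UwbOrd.One A B)
    (e : B.left ⊕ B.right ≃ X.carrier) :
    unW.map (UwbOrd.one b) ≫ (unwIso e).hom =
      unwOne ((UwbOrd.unwEquiv b.1 b.2).trans e) :=
  Hom.ext_comp (f := unW.map (UwbOrd.one b)) (g := Hom.ofEquiv e)
    (h := unwOne ((UwbOrd.unwEquiv b.1 b.2).trans e)) rfl (fun _ => rfl)
    (fun _ _ => rfl) (fun _ i => i.elim0)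

/-- A bijection `A ⨿ 2 ≃ N` is a directed pair in `N` and a bijection of `A` with its complement. -/
lemma alphaEquiv_bijective {A : Type} [Finite A] {n N : ℕ} (h : n + 2 = N) :
    Function.Bijective (fun q : (A ≃ Fin n) × OrdPair N =>
      (q.1.sumCongr (Equiv.refl _)).trans (alphaEquiv h q.2.1 q.2.2)) := by
  constructor
  · rintro ⟨σ, ⟨⟨i, j⟩, hp⟩⟩ ⟨σ', ⟨⟨i', j'⟩, hp'⟩⟩ heq
    have h0 := congrArg (fun e : A ⊕ (Fin 2 × Fin 1) ≃ Fin N => e (Sum.inr (0, 0))) heq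
    have h1 := congrArg (fun e : A ⊕ (Fin 2 × Fin 1) ≃ Fin N => e (Sum.inr (1, 0))) heq
    obtain rfl : i = i' := h0
    obtain rfl : j = j' := h1
    have h2 : σ = σ' := Equiv.ext fun a => by
      have h3 := congrArg (fun e : A ⊕ (Fin 2 × Fin 1) ≃ Fin N => e (Sum.inl a)) heq
      exact Sum.inl_injective ((alphaEquiv h (i, j) hp).injective h3)
    rw [h2]
  · intro e
    have hp : e (Sum.inr (0, 0)) ≠ e (Sum.inr (1, 0)) := fun h => by
      simpa using e.injective h
    -- Counting provides a reference bijection `A ≃ Fin n`. With the same directed pair, the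
    -- resulting bijection differs from `e` only by a permutation of `A`, which `exists_perm`
    -- supplies.
    have hA : Nat.card A = n := by
      have := Nat.card_congr e
      rw [Nat.card_sum] at this
      simp at this
      omega
    obtain ⟨σ, hσ⟩ := exists_perm e
      (((Finite.equivFinOfCardEq hA).sumCongr (Equiv.refl _)).trans
        (alphaEquiv h (e (Sum.inr (0, 0)), e (Sum.inr (1, 0))) hp)) (by
        rintro ⟨c, i⟩
        obtain rfl := Subsingleton.elim i 0
        rcases Fin.exists_fin_two.1 ⟨c, rfl⟩ with rfl | rfl <;> rfl)
    refine ⟨⟨σ.trans (Finite.equivFinOfCardEq hA), ⟨(_, _), hp⟩⟩, ?_⟩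
    refine Eq.trans ?_ hσ.symm
    ext (a | a) <;> rfl

end DubOrd

/-! ### The averaged map and its compatibility with the differentials -/

section Unwalling

variable {k : Type u} [Field k]

lemma dirD_mkQ [CharZero k] {T T' : Twist DubOrd} (G : LMod.{u, v} k (Twisted k T)ᵒᵖ)
    (F : LMod.{u, v} k (Twisted k T')ᵒᵖ) {n N : ℕ} (h : n + 2 = N) (z) :
    dirD G F h ((balanced G F (DubOrd.fin N)).mkQ z) =
      ∑ p : OrdPair N, opTen G F (DubOrd.alpha h p.1 p.2) z :=
  LinearMap.sum_apply _ _ _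

lemma walD_mkQ [CharZero k] {ε : ℤˣ} (G : LMod.{u, v} k (Dwb k ε)) (F : LMod.{u, v} k (Dwb k (-ε)))
    (m n : ℕ) (z) :
    walD G F m n ((balanced G F (UwbOrd.fin (m + 1) (n + 1))).mkQ z) =
      ∑ p, opTen G F (UwbOrd.beta p) z :=
  LinearMap.sum_apply _ _ _

variable {ε : ℤˣ} (G : LMod.{u, v} k (Dwb k ε)) (M : LMod.{u, v} k (Ddb k (-ε)))

/-- The isomorphism `m ⨿ n ≅ t` given by a bijection. -/
abbrev finIso {m n t : ℕ} (e : Fin m ⊕ Fin n ≃ Fin t) :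
    unW.obj (UwbOrd.fin m n) ≅ DubOrd.fin t :=
  DubOrd.unwIso (A := UwbOrd.fin m n) (X := DubOrd.fin t) e

/-- The sum over all bijections `m ⨿ n ≃ t`. -/
def sumCross (m n t : ℕ) : Ten ((coind k ε).obj G) M (DubOrd.fin t) →ₗ[k]
    Co G ((res k (dUpsilon k (-ε))).obj M) (UwbOrd.fin m n) :=
  ∑ e : Fin m ⊕ Fin n ≃ Fin t, crossTen G M (finIso e).hom

lemma sumCross_apply (m n t : ℕ) (z) : sumCross G M m n t z =
    ∑ e : Fin m ⊕ Fin n ≃ Fin t, crossTen G M (finIso e).hom z :=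
  LinearMap.sum_apply _ _ _

/-- An automorphism of `t` permutes the bijections `m ⨿ n ≃ t`, so the full sum respects the
relations. This is why the sum runs over all bijections instead of using a chosen one. -/
lemma sumCross_balanced (m n t : ℕ) :
    balanced ((coind k ε).obj G) M (DubOrd.fin t) ≤ LinearMap.ker (sumCross G M m n t) := by
  refine Submodule.span_le.2 ?_
  rintro _ ⟨s, x, y, rfl⟩
  rw [SetLike.mem_coe, LinearMap.mem_ker, map_sub, sub_eq_zero]
  obtain ⟨u, rfl⟩ := DubOrd.eq_isoOfEquiv s
  rw [sumCross_apply, sumCross_apply]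
  refine Fintype.sum_equiv ((Equiv.refl _).equivCongr u) _ _ fun e => ?_
  have h : finIso (((Equiv.refl _).equivCongr u) e) = finIso (e.trans u) := rfl
  rw [h, finIso, ← DubOrd.unwIso_comp (A := UwbOrd.fin m n) (X := DubOrd.fin t)
    (Y := DubOrd.fin t) e u, crossTen_comp, ← opMap_comp M.obj, Iso.hom_inv_id, opMap_id M.obj]

/-- The map from the tensor product with the coinduced module to the walled tensor product. -/
def wallCo (m n t : ℕ) : Co ((coind k ε).obj G) M (DubOrd.fin t) →ₗ[k]
    Co G ((res k (dUpsilon k (-ε))).obj M) (UwbOrd.fin m n) :=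
  -- Bijections in one orbit of `𝔖_m × 𝔖_n` contribute equal terms, by the relations in the target;
  -- orbits have `m! n!` elements. For `m + n ≠ t` the sum is empty and the map is zero, so `t` may
  -- be kept as an independent variable.
  ((m.factorial * n.factorial : ℕ) : k)⁻¹ •
    (balanced ((coind k ε).obj G) M (DubOrd.fin t)).liftQ (sumCross G M m n t)
      (sumCross_balanced G M m n t)

lemma wallCo_mkQ (m n t : ℕ) (z) :
    wallCo G M m n t ((balanced ((coind k ε).obj G) M (DubOrd.fin t)).mkQ z) =
      ((m.factorial * n.factorial : ℕ) : k)⁻¹ • sumCross G M m n t z := rfl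

/-- The sum over all morphisms `m ⨿ n ⟶ t` of degree one. -/
def sumCrossOne (m n t : ℕ) : Ten ((coind k ε).obj G) M (DubOrd.fin t) →ₗ[k]
    Co G ((res k (dUpsilon k (-ε))).obj M) (UwbOrd.fin m n) :=
  ∑ g : (Fin m ⊕ Fin n) ⊕ (Fin 2 × Fin 1) ≃ Fin t, crossTen G M
    (DubOrd.unwOne (A := UwbOrd.fin m n) (X := DubOrd.fin t) g)

lemma sumCrossOne_apply (m n t : ℕ) (z) : sumCrossOne G M m n t z =
    ∑ g : (Fin m ⊕ Fin n) ⊕ (Fin 2 × Fin 1) ≃ Fin t, crossTen G M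
      (DubOrd.unwOne (A := UwbOrd.fin m n) (X := DubOrd.fin t) g) z :=
  LinearMap.sum_apply _ _ _

lemma sumCross_opMap (m n : ℕ) {t : ℕ} {X : DubOrd} (f : DubOrd.fin t ⟶ X) (x y) :
    sumCross G M m n t (opMap ((coind k ε).obj G).obj f x ⊗ₜ[k] opMap M.obj f y) =
      ∑ e : Fin m ⊕ Fin n ≃ Fin t, crossTen G M ((finIso e).hom ≫ f) (x ⊗ₜ[k] y) :=
  (sumCross_apply G M m n t _).trans
    (Finset.sum_congr rfl fun e _ => (crossTen_comp G M (finIso e).hom f x y).symm)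

/-- For fixed `p`, putting the bijection of `β_p` in front of `e` is a one-to-one correspondence
from the `e` to the bijections `(m ⨿ n) ⨿ 2 ≃ s`. Hence the sum does not depend on `p`. -/
lemma sum_opTen_beta (m n s : ℕ) (p : Fin (m + 1) × Fin (n + 1)) (x y) :
    ∑ e : Fin (m + 1) ⊕ Fin (n + 1) ≃ Fin s,
        opTen G ((res k (dUpsilon k (-ε))).obj M) (UwbOrd.beta p)
          (evalCoind G (finIso e).hom x ⊗ₜ[k] opMap M.obj (finIso e).hom y) =
      sumCrossOne G M m n s (x ⊗ₜ[k] y) := by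
  rw [sumCrossOne_apply]
  refine Fintype.sum_equiv ((UwbOrd.unwEquiv (UwbOrd.betaEquiv p.1)
    (UwbOrd.betaEquiv p.2)).symm.equivCongr (Equiv.refl _)) _ _ fun e => ?_
  refine (crossTen_unW G M (UwbOrd.beta p) _ x y).symm.trans ?_
  rw [UwbOrd.beta, finIso, DubOrd.unW_one_comp]
  rfl

variable [CharZero k]

/-- A bijection `m ⨿ n ≃ t` followed by a generator `α_(ij)` gives every degree one morphism exactly
once (`alphaEquiv_bijective`), so the coefficient is unchanged. -/
lemma wallCo_dirD (m n : ℕ) {t s : ℕ} (h : t + 2 = s) (x y) :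
    wallCo G M m n t (dirD ((coind k ε).obj G) M h
      ((balanced ((coind k ε).obj G) M (DubOrd.fin s)).mkQ (x ⊗ₜ[k] y))) =
      ((m.factorial * n.factorial : ℕ) : k)⁻¹ • sumCrossOne G M m n s (x ⊗ₜ[k] y) := by
  rw [dirD_mkQ, map_sum]
  simp only [opTen_tmul, wallCo_mkQ, sumCross_opMap]
  rw [← Finset.smul_sum]
  refine congrArg _ ?_
  rw [sumCrossOne_apply, Finset.sum_comm, ← Fintype.sum_prod_type', ← Equiv.sum_comp
    (Equiv.ofBijective _ (DubOrd.alphaEquiv_bijective (A := Fin m ⊕ Fin n) h))]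
  refine Finset.sum_congr rfl fun q _ => ?_
  rw [DubOrd.alpha, finIso, DubOrd.unwIso_comp_one]
  rfl

/-- Every generator `β_(i,j)` produces the same full sum, so that sum is counted `(m+1)(n+1)` times.
-/
lemma walD_wallCo (m n s : ℕ) (x y) :
    walD G ((res k (dUpsilon k (-ε))).obj M) m n (wallCo G M (m + 1) (n + 1) s
      ((balanced ((coind k ε).obj G) M (DubOrd.fin s)).mkQ (x ⊗ₜ[k] y))) =
      ((m.factorial * n.factorial : ℕ) : k)⁻¹ • sumCrossOne G M m n s (x ⊗ₜ[k] y) := by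
  have h : ∀ e : Fin (m + 1) ⊕ Fin (n + 1) ≃ Fin s,
      walD G ((res k (dUpsilon k (-ε))).obj M) m n (crossTen G M (finIso e).hom (x ⊗ₜ[k] y)) =
        ∑ p, opTen G ((res k (dUpsilon k (-ε))).obj M) (UwbOrd.beta p)
          (evalCoind G (finIso e).hom x ⊗ₜ[k] opMap M.obj (finIso e).hom y) :=
    fun e => walD_mkQ _ _ _ _ _
  rw [wallCo_mkQ, map_smul, sumCross_apply, map_sum, Finset.sum_congr rfl fun e _ => h e,
    Finset.sum_comm, Finset.sum_congr rfl fun p _ => sum_opTen_beta G M m n s p x y,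
    Finset.sum_const, Finset.card_univ, ← Nat.cast_smul_eq_nsmul k, smul_smul]
  -- It remains to see that `(m+1)(n+1) / ((m+1)! (n+1)!) = 1 / (m! n!)`; characteristic `0` makes
  -- the denominators invertible.
  refine congrArg (fun c : k => c • sumCrossOne G M m n s (x ⊗ₜ[k] y)) ?_
  have h1 : ∀ r : ℕ, ((r.factorial : ℕ) : k) ≠ 0 := fun r => Nat.cast_ne_zero.2 r.factorial_ne_zero
  have h2 : ∀ r : ℕ, ((r : k) + 1) ≠ 0 := fun r => Nat.cast_add_one_ne_zero r
  simp only [Fintype.card_prod, Fintype.card_fin, Nat.factorial_succ]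
  push_cast
  field_simp [h1 m, h1 n, h2 m, h2 n]

lemma walD_wallCo_eq (m n : ℕ) {t s : ℕ} (h : t + 2 = s) (w) :
    walD G ((res k (dUpsilon k (-ε))).obj M) m n (wallCo G M (m + 1) (n + 1) s w) =
      wallCo G M m n t (dirD ((coind k ε).obj G) M h w) := by
  obtain ⟨z, rfl⟩ := Submodule.mkQ_surjective _ w
  induction z using TensorProduct.induction_on with
  | zero => simp only [map_zero]
  | add z z' hz hz' => rw [map_add, map_add, map_add, map_add, map_add, hz, hz']
  | tmul x y => rw [walD_wallCo, wallCo_dirD]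

end Unwalling

/-- A bijection of disjoint unions that respects the parts is a disjoint union of bijections. -/
lemma exists_sumCongr {A B C D : Type*} (h : A ⊕ B ≃ C ⊕ D) (hl : ∀ a, ∃ c, h (Sum.inl a) = Sum.inl c)
    (hr : ∀ b, ∃ d, h (Sum.inr b) = Sum.inr d) :
    ∃ (σ : A ≃ C) (τ : B ≃ D), h = σ.sumCongr τ := by
  choose f hf using hl
  choose g hg using hr
  have hfg : Function.Bijective (Sum.map f g) := by
    have : Sum.map f g = h := funext fun z => by
      rcases z with a | b
      · exact (hf a).symm
      · exact (hg b).symm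
    rw [this]
    exact h.bijective
  obtain ⟨hi, hs⟩ := hfg
  rw [Sum.map_injective] at hi
  rw [Sum.map_surjective] at hs
  refine ⟨Equiv.ofBijective f ⟨hi.1, hs.1⟩, Equiv.ofBijective g ⟨hi.2, hs.2⟩, Equiv.ext fun z => ?_⟩
  rcases z with a | b
  · exact hf a
  · exact hg b

/-! ### Inclusion of a single component into the coinduced module -/

section Unwalling

variable {k : Type u} [Field k] {ε : ℤˣ} (G : LMod.{u, v} k (Dwb k ε))
  (M : LMod.{u, v} k (Ddb k (-ε)))

open Classical in
-- The component at `p'` of the image reads the component at `f.push p'`. Since `p'` is recovered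
-- from its push by restriction along `f`, only `p' = p` reads the component at `q`.
lemma coindMap_single {X Y : DubOrd} (f : DubOrd.Hom X.carrier Y.carrier) {p : X.carrier → Fin 2}
    {q : Y.carrier → Fin 2} (h : f.IsPush p q) (a) :
    coindMap G f (LinearMap.single k _ q a) =
      LinearMap.single k
        (fun p : X.carrier → Fin 2 => G.obj.obj (op ((Twisted.of k (UwbOrd.twist ε)).obj (decomp p)))) p
        (opMap G.obj (X := decomp p) (Y := decomp q) (f.lift h) a) := by
  funext p'
  by_cases hp : p' = p
  · subst hp
    rw [coindMap_apply G f _ _ _ h]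
    simp
  · have h' := f.isPush_push p'
    rw [coindMap_apply G f _ _ _ h']
    have hne : f.push p' ≠ q := fun hq => hp (funext fun x => by
      rw [hq] at h'
      exact (h' (Sum.inl x)).symm.trans (h (Sum.inl x)))
    simp [hne, hp]

open Classical in
lemma coindMap_single_of_not {X Y : DubOrd} (f : DubOrd.Hom X.carrier Y.carrier)
    {p : X.carrier → Fin 2} {q : Y.carrier → Fin 2} (h : ¬ f.IsPush p q) (a) :
    coindMap G f (LinearMap.single k _ q a) p = 0 := by
  have hne : f.push p ≠ q := fun hq => h (hq ▸ f.isPush_push p)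
  rw [coindMap_apply G f _ _ _ (f.isPush_push p)]
  simp [hne]

/-- The isomorphism of `A` with the pair associated to its disjoint union. -/
def jIso (A : UwbOrd) : A ≅ decomp (X := unW.obj A) (inlInr A.left A.right) :=
  UwbOrd.isoOfEquiv (B := decomp (X := unW.obj A) (inlInr A.left A.right))
    (pieceInl A.left A.right) (pieceInr A.left A.right)

open Classical in
/-- The inclusion of `G A` into the coinduced module, as the component of `(A₁, A₂)`. -/
def inclCoind (A : UwbOrd) : G.obj.obj (op ((Twisted.of k (UwbOrd.twist ε)).obj A)) →ₗ[k]
    ((coind k ε).obj G).obj.obj (op ((Twisted.of k (DubOrd.twist ε)).obj (unW.obj A))) :=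
  (LinearMap.single k (fun p : (unW.obj A).carrier → Fin 2 =>
    G.obj.obj (op ((Twisted.of k (UwbOrd.twist ε)).obj (decomp p)))) (inlInr A.left A.right)).comp
      (opMap G.obj (jIso A).inv)

lemma counitApp_inclCoind (A : UwbOrd) (x) : counitApp G A (inclCoind G A x) = x := by
  classical
  refine (congrArg (opMap G.obj (jIso A).hom) (Pi.single_eq_same (M := fun p : (unW.obj A).carrier →
    Fin 2 => G.obj.obj (op ((Twisted.of k (UwbOrd.twist ε)).obj (decomp p))))
      (inlInr A.left A.right) (opMap G.obj (jIso A).inv x))).trans ?_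
  rw [← opMap_comp, Iso.hom_inv_id, opMap_id]

/-- A walled morphism pushes the decomposition of `A₁ ⨿ A₂` to that of `B₁ ⨿ B₂` (`isPush_unW`), so
it relates these two components and creates no others. The inclusion is thus a section of the counit
that is natural for walled morphisms. -/
lemma opMap_inclCoind {A B : UwbOrd} (b : A ⟶ B) (x) :
    opMap ((coind k ε).obj G).obj (unW.map b) (inclCoind G B x) =
      inclCoind G A (opMap G.obj b x) := by
  classical
  refine (opMap_coind G _ _).trans ((coindMap_single G _ (isPush_unW b) _).trans ?_)
  refine congrArg (LinearMap.single k (fun p : (unW.obj A).carrier → Fin 2 =>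
    G.obj.obj (op ((Twisted.of k (UwbOrd.twist ε)).obj (decomp p)))) (inlInr A.left A.right)) ?_
  refine (opMap_comp G.obj (DubOrd.Hom.lift (unW.map b) (isPush_unW b)) (jIso B).inv x).symm.trans
    (Eq.trans ?_ (opMap_comp G.obj (jIso A).inv b x))
  refine congrArg (fun c => opMap G.obj c x) ?_
  -- This is `jHom_comp` with the identifications `jIso` moved to the opposite sides.
  exact (Iso.eq_inv_comp _).2 ((Category.assoc _ _ _).symm.trans
    ((Iso.comp_inv_eq _).2 (jHom_comp b)))

lemma evalCoind_unW_inclCoind {A B : UwbOrd} (b : A ⟶ B) (x) :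
    evalCoind G (unW.map b) (inclCoind G B x) = opMap G.obj b x :=
  (congrArg (counitApp G A) (opMap_inclCoind G b x)).trans (counitApp_inclCoind G A _)

/-- The counit reads the component of the standard decomposition of `A₁ ⨿ A₂`. That component comes
from the pushed decomposition of `B₁ ⨿ B₂`, where the included element is zero. -/
lemma evalCoind_inclCoind_of_not {A B : UwbOrd} (f : unW.obj A ⟶ unW.obj B)
    (h : ¬ DubOrd.Hom.IsPush f (inlInr A.left A.right) (inlInr B.left B.right)) (x) :
    evalCoind G f (inclCoind G B x) = 0 := by
  classical
  refine (congrArg (counitApp G A) (opMap_coind G f _)).trans ?_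
  exact (congrArg (opMap G.obj (jIso A).hom) (coindMap_single_of_not G f h _)).trans (map_zero _)

/-- The map `x ⊗ y ↦ x [f] ⊗ [fᵒᵖ] y`, for `x` in the component of `(A₁, A₂)`. -/
def inclTen {A : UwbOrd} {X : DubOrd} (f : X ⟶ unW.obj A) :
    Ten G ((res k (dUpsilon k (-ε))).obj M) A →ₗ[k] Co ((coind k ε).obj G) M X :=
  (balanced ((coind k ε).obj G) M X).mkQ.comp (TensorProduct.map
    ((opMap ((coind k ε).obj G).obj f).comp (inclCoind G A)) (opMap M.obj f))

lemma inclTen_tmul {A : UwbOrd} {X : DubOrd} (f : X ⟶ unW.obj A) (x y) :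
    inclTen G M f (x ⊗ₜ[k] y) = opTen ((coind k ε).obj G) M f (inclCoind G A x ⊗ₜ[k] y) := rfl

lemma inclTen_iso_comp {A : UwbOrd} {X : DubOrd} (s : X ≅ X) (f : X ⟶ unW.obj A) (x y) :
    inclTen G M (s.hom ≫ f) (x ⊗ₜ[k] y) = inclTen G M f (x ⊗ₜ[k] y) := by
  rw [inclTen_tmul, opTen_iso_comp]
  rfl

lemma inclTen_comp_unW {A B : UwbOrd} {X : DubOrd} (f : X ⟶ unW.obj A) (b : A ⟶ B) (x y) :
    inclTen G M (f ≫ unW.map b) (x ⊗ₜ[k] y) = inclTen G M f (opMap G.obj b x ⊗ₜ[k]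
      opMap ((res k (dUpsilon k (-ε))).obj M).obj b y) := by
  refine congrArg₂ (fun a c => (balanced ((coind k ε).obj G) M X).mkQ (a ⊗ₜ[k] c)) ?_ ?_
  · refine (opMap_comp ((coind k ε).obj G).obj f (unW.map b) _).trans ?_
    exact congrArg (opMap ((coind k ε).obj G).obj f) (opMap_inclCoind G b x)
  · refine (opMap_comp M.obj f (unW.map b) _).trans ?_
    exact congrArg (opMap M.obj f) (opMap_res M b y).symm

/-- All isomorphisms `A₁ ⨿ A₂ ≅ X` induce the same map. -/
lemma inclTen_iso {A : UwbOrd} {X : DubOrd} (f g : X ≅ unW.obj A) (x y) :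
    inclTen G M f.hom (x ⊗ₜ[k] y) = inclTen G M g.hom (x ⊗ₜ[k] y) := by
  -- The two isomorphisms differ by an automorphism of `X`, which the relations absorb.
  have : f.hom = (f ≪≫ g.symm).hom ≫ g.hom := by simp
  rw [this, inclTen_iso_comp]

/-- An automorphism of `A` induces one of `A₁ ⨿ A₂`, and composing `f` with it does not change the
map. -/
lemma inclTen_balanced {A : UwbOrd} {X : DubOrd} (f : X ≅ unW.obj A) :
    balanced G ((res k (dUpsilon k (-ε))).obj M) A ≤ LinearMap.ker (inclTen G M f.hom) := by
  refine Submodule.span_le.2 ?_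
  rintro _ ⟨s, x, y, rfl⟩
  rw [SetLike.mem_coe, LinearMap.mem_ker, map_sub, sub_eq_zero]
  -- Writing `y` as `s` acting on its inverse image lets `s` act on both factors, as
  -- `inclTen_comp_unW` requires.
  have h : y = opMap ((res k (dUpsilon k (-ε))).obj M).obj s.hom
      (opMap ((res k (dUpsilon k (-ε))).obj M).obj s.inv y) := by
    rw [← opMap_comp, Iso.hom_inv_id, opMap_id]
  refine (congrArg (fun c => inclTen G M f.hom (opMap G.obj s.hom x ⊗ₜ[k] c)) h).trans ?_
  refine (inclTen_comp_unW G M f.hom s.hom _ _).symm.trans ?_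
  exact inclTen_iso G M (f ≪≫ unW.mapIso s) f x _

/-- The map from the walled tensor product to that with the coinduced module. -/
def inclCo {A : UwbOrd} {X : DubOrd} (f : X ≅ unW.obj A) :
    Co G ((res k (dUpsilon k (-ε))).obj M) A →ₗ[k] Co ((coind k ε).obj G) M X :=
  (balanced G ((res k (dUpsilon k (-ε))).obj M) A).liftQ _ (inclTen_balanced G M f)

lemma inclCo_mkQ {A : UwbOrd} {X : DubOrd} (f : X ≅ unW.obj A) (z) :
    inclCo G M f ((balanced G ((res k (dUpsilon k (-ε))).obj M) A).mkQ z) = inclTen G M f.hom z :=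
  rfl

end Unwalling

/-! ### The averaged map and the inclusions are inverse to each other -/

section Unwalling

variable {k : Type u} [Field k] {ε : ℤˣ} (G : LMod.{u, v} k (Dwb k ε))
  (M : LMod.{u, v} k (Ddb k (-ε)))

lemma opMap_inv_opMap_hom {C : Type w} [Category.{w'} C] {T : Twist C}
    (F : (Twisted k T)ᵒᵖ ⥤ ModuleCat.{v} k) {X Y : C} (s : X ≅ Y) (y) :
    opMap F s.inv (opMap F s.hom y) = y := by
  rw [← opMap_comp, Iso.inv_hom_id, opMap_id]

lemma crossTen_eq_zero {A : UwbOrd} {X : DubOrd} (f : unW.obj A ⟶ X) {x}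
    (h : evalCoind G f x = 0) (y) : crossTen G M f (x ⊗ₜ[k] y) = 0 := by
  rw [crossTen_tmul, h]
  exact (congrArg _ (TensorProduct.zero_tmul _ _)).trans (map_zero _)

/-- If the term did not vanish, `h` would carry the decomposition of the source to that of the
target, and so split as a disjoint union of bijections. -/
lemma crossTen_inclCoind_of_not {A B : UwbOrd} (h : A.left ⊕ A.right ≃ B.left ⊕ B.right)
    (hn : ¬ ∃ (σ : A.left ≃ B.left) (τ : A.right ≃ B.right), σ.sumCongr τ = h) (x y) :
    crossTen G M (DubOrd.unwIso (A := A) (X := unW.obj B) h).hom (inclCoind G B x ⊗ₜ[k] y) = 0 := by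
  refine crossTen_eq_zero G M _ (evalCoind_inclCoind_of_not G _ (fun hp => ?_) x) y
  refine hn ?_
  suffices hs : ∃ (σ : A.left ≃ B.left) (τ : A.right ≃ B.right), h = σ.sumCongr τ by
    obtain ⟨σ, τ, e⟩ := hs
    exact ⟨σ, τ, e.symm⟩
  refine exists_sumCongr h (fun a => ?_) (fun b => ?_)
  · have h1 : inlInr B.left B.right (h (Sum.inl a)) = 0 := hp (Sum.inl (Sum.inl a))
    rcases hc : h (Sum.inl a) with c | c
    · exact ⟨c, rfl⟩
    · simp [hc, inlInr] at h1
  · have h1 : inlInr B.left B.right (h (Sum.inr b)) = 1 := hp (Sum.inl (Sum.inr b))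
    rcases hc : h (Sum.inr b) with c | c
    · simp [hc, inlInr] at h1
    · exact ⟨c, rfl⟩

/-- Such a bijection comes from an automorphism of `A` in the walled category. It acts on both
factors, and the relation moves one action across the tensor sign, where it cancels the other. -/
lemma crossTen_inclCoind_sumCongr {A : UwbOrd} (σ : A.left ≃ A.left) (τ : A.right ≃ A.right) (x y) :
    crossTen G M (DubOrd.unwIso (A := A) (X := unW.obj A) (σ.sumCongr τ)).hom
      (inclCoind G A x ⊗ₜ[k] y) =
        (balanced G ((res k (dUpsilon k (-ε))).obj M) A).mkQ (x ⊗ₜ[k] y) := by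
  have h : (DubOrd.unwIso (A := A) (X := unW.obj A) (σ.sumCongr τ)).hom =
      unW.map (UwbOrd.isoOfEquiv (A := A) (B := A) σ τ).hom := by
    refine DubOrd.Hom.ext' rfl (fun a => ?_) (fun _ i => i.elim0)
    rcases a with a | a <;> rfl
  rw [h, crossTen_tmul, evalCoind_unW_inclCoind]
  refine (congrArg (fun c => (balanced G ((res k (dUpsilon k (-ε))).obj M) A).mkQ
    (opMap G.obj (UwbOrd.isoOfEquiv (A := A) (B := A) σ τ).hom x ⊗ₜ[k] c))
      (opMap_res M (UwbOrd.isoOfEquiv (A := A) (B := A) σ τ).hom y).symm).trans ?_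
  refine (mkQ_balanced G ((res k (dUpsilon k (-ε))).obj M) _ _ _).trans ?_
  exact congrArg (fun c => (balanced G ((res k (dUpsilon k (-ε))).obj M) A).mkQ (x ⊗ₜ[k] c))
    (opMap_inv_opMap_hom ((res k (dUpsilon k (-ε))).obj M).obj _ y)

/-- Following each bijection `m' ⨿ n' ≃ t` by the inverse of `e` reindexes the sum, which removes
`t` and the choice of `e`. -/
lemma wallCo_inclTen {m n t : ℕ} (m' n' : ℕ) (e : Fin m ⊕ Fin n ≃ Fin t) (x y) :
    wallCo G M m' n' t (inclTen G M (finIso e).symm.hom (x ⊗ₜ[k] y)) =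
      ((m'.factorial * n'.factorial : ℕ) : k)⁻¹ •
        ∑ h : Fin m' ⊕ Fin n' ≃ Fin m ⊕ Fin n, crossTen G M
          (DubOrd.unwIso (A := UwbOrd.fin m' n') (X := unW.obj (UwbOrd.fin m n)) h).hom
          (inclCoind G (UwbOrd.fin m n) x ⊗ₜ[k] y) := by
  refine congrArg (fun c : Co G ((res k (dUpsilon k (-ε))).obj M) (UwbOrd.fin m' n') =>
    ((m'.factorial * n'.factorial : ℕ) : k)⁻¹ • c) ?_
  refine (sumCross_opMap G M m' n' (finIso e).symm.hom (inclCoind G (UwbOrd.fin m n) x) y).trans ?_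
  refine Fintype.sum_equiv ((Equiv.refl _).equivCongr e.symm) _ _ fun e' => ?_
  exact congrArg (fun f => crossTen G M f (inclCoind G (UwbOrd.fin m n) x ⊗ₜ[k] y))
    (DubOrd.unwIso_comp (A := UwbOrd.fin m' n') (X := DubOrd.fin t)
      (Y := unW.obj (UwbOrd.fin m n)) e' e.symm)

/-- A bijection respecting the parts would force equal sizes, so every term vanishes. -/
lemma wallCo_inclCo_of_ne {m n m' n' t : ℕ} (h : ¬ (m' = m ∧ n' = n)) (e : Fin m ⊕ Fin n ≃ Fin t)
    (w) : wallCo G M m' n' t (inclCo G M (finIso e).symm w) = 0 := by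
  obtain ⟨z, rfl⟩ := Submodule.mkQ_surjective _ w
  rw [inclCo_mkQ]
  induction z using TensorProduct.induction_on with
  | zero => simp only [map_zero]
  | add z z' hz hz' => rw [map_add, map_add, hz, hz', add_zero]
  | tmul x y =>
    rw [wallCo_inclTen, Finset.sum_eq_zero, smul_zero]
    intro f _
    refine crossTen_inclCoind_of_not G M (A := UwbOrd.fin m' n') (B := UwbOrd.fin m n) f ?_ x y
    rintro ⟨σ, τ, -⟩
    exact h ⟨by simpa using Fintype.card_congr σ, by simpa using Fintype.card_congr τ⟩

lemma wallCo_inclCo [CharZero k] {m n t : ℕ} (e : Fin m ⊕ Fin n ≃ Fin t) (w) :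
    wallCo G M m n t (inclCo G M (finIso e).symm w) = w := by
  obtain ⟨z, rfl⟩ := Submodule.mkQ_surjective _ w
  rw [inclCo_mkQ]
  induction z using TensorProduct.induction_on with
  | zero => simp only [map_zero]
  | add z z' hz hz' => rw [map_add, map_add, hz, hz', map_add]
  | tmul x y =>
    rw [wallCo_inclTen]
    -- The surviving terms are indexed by `𝔖_m × 𝔖_n` and are all equal, so there are `m! n!` copies
    -- of the class, cancelling the normalization.
    have h1 := Fintype.sum_of_injective
      (fun q : Equiv.Perm (Fin m) × Equiv.Perm (Fin n) => Equiv.sumCongr q.1 q.2)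
      (fun q q' h => Prod.ext
        (Equiv.ext fun a => Sum.inl_injective (congrArg (fun f : _ ≃ _ => f (Sum.inl a)) h))
        (Equiv.ext fun a => Sum.inr_injective (congrArg (fun f : _ ≃ _ => f (Sum.inr a)) h)))
      (fun _ => (balanced G ((res k (dUpsilon k (-ε))).obj M) (UwbOrd.fin m n)).mkQ (x ⊗ₜ[k] y))
      (fun h => crossTen G M
          (DubOrd.unwIso (A := UwbOrd.fin m n) (X := unW.obj (UwbOrd.fin m n)) h).hom
          (inclCoind G (UwbOrd.fin m n) x ⊗ₜ[k] y))
      (fun h hh => crossTen_inclCoind_of_not G M (A := UwbOrd.fin m n) (B := UwbOrd.fin m n) h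
        (fun ⟨σ, τ, hs⟩ => hh ⟨(σ, τ), hs⟩) x y)
      (fun q => (crossTen_inclCoind_sumCongr G M (A := UwbOrd.fin m n) q.1 q.2 x y).symm)
    rw [← h1, Finset.sum_const, Finset.card_univ, ← Nat.cast_smul_eq_nsmul k, smul_smul,
      Fintype.card_prod, Fintype.card_perm, Fintype.card_perm, Fintype.card_fin, Fintype.card_fin,
      inv_mul_cancel₀ (Nat.cast_ne_zero.2 (mul_ne_zero m.factorial_ne_zero n.factorial_ne_zero)),
      one_smul]

/-- The isomorphism `X₁ ⨿ X₂ ≅ X`. -/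
def eIso {X : DubOrd} (p : X.carrier → Fin 2) : unW.obj (decomp p) ≅ X :=
  DubOrd.isoOfEquiv (A := unW.obj (decomp p)) (pieceEquiv p)

open Classical in
/-- The inclusion of the component of a decomposition. -/
def singleCoind {X : DubOrd} (p : X.carrier → Fin 2)
    (a : G.obj.obj (op ((Twisted.of k (UwbOrd.twist ε)).obj (decomp p)))) :
    ((coind k ε).obj G).obj.obj (op ((Twisted.of k (DubOrd.twist ε)).obj X)) :=
  LinearMap.single k (fun p : X.carrier → Fin 2 =>
    G.obj.obj (op ((Twisted.of k (UwbOrd.twist ε)).obj (decomp p)))) p a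

lemma sum_singleCoind {X : DubOrd} [Fintype (X.carrier → Fin 2)]
    (x : ((coind k ε).obj G).obj.obj (op ((Twisted.of k (DubOrd.twist ε)).obj X))) :
    ∑ p : X.carrier → Fin 2, singleCoind G p (x p) = x := by
  classical
  exact Finset.univ_sum_single (M := fun p : X.carrier → Fin 2 =>
    G.obj.obj (op ((Twisted.of k (UwbOrd.twist ε)).obj (decomp p)))) x

/-- Along `X₁ ⨿ X₂ ≅ X`, the component of an arbitrary decomposition becomes that of the standard
decomposition of a disjoint union. The two identifications agree because the lift of `eHom p` is
inverse to `jHom` (`jHom_lift`). -/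
lemma opMap_singleCoind {X : DubOrd} (p : X.carrier → Fin 2) (a) :
    opMap ((coind k ε).obj G).obj (eIso p).hom (singleCoind G p a) = inclCoind G (decomp p) a := by
  classical
  refine (opMap_coind G _ _).trans ((coindMap_single G _ (isPush_eHom p) a).trans ?_)
  exact congrArg (fun f => LinearMap.single k (fun p : (unW.obj (decomp p)).carrier → Fin 2 =>
    G.obj.obj (op ((Twisted.of k (UwbOrd.twist ε)).obj (decomp p)))) (inlInr _ _) (opMap G.obj f a))
      (Iso.inv_ext (f := jIso (decomp p)) (jHom_lift p)).symm

/-- After `opMap_singleCoind`, the isomorphism `s` replaces `(X₁, X₂)` by the chosen representative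
`A`. The resulting isomorphism with `X` need not be `f`, but all of them induce the same map. -/
lemma mkQ_singleCoind {A : UwbOrd} {X : DubOrd} (p : X.carrier → Fin 2) (f : X ≅ unW.obj A)
    (s : A ≅ decomp p) (a y) :
    (balanced ((coind k ε).obj G) M X).mkQ (singleCoind G p a ⊗ₜ[k] y) ∈
      LinearMap.range (inclCo G M f) := by
  have h1 : (balanced ((coind k ε).obj G) M X).mkQ (singleCoind G p a ⊗ₜ[k] y) =
      inclTen G M (eIso p).symm.hom (a ⊗ₜ[k] opMap M.obj (eIso p).hom y) := by
    refine congrArg₂ (fun b c => (balanced ((coind k ε).obj G) M X).mkQ (b ⊗ₜ[k] c)) ?_ ?_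
    · exact (opMap_inv_opMap_hom ((coind k ε).obj G).obj (eIso p) _).symm.trans
        (congrArg (opMap ((coind k ε).obj G).obj (eIso p).inv) (opMap_singleCoind G p a))
    · exact (opMap_inv_opMap_hom M.obj (eIso p) y).symm
  refine ⟨(balanced G ((res k (dUpsilon k (-ε))).obj M) A).mkQ (opMap G.obj s.hom a ⊗ₜ[k]
    opMap ((res k (dUpsilon k (-ε))).obj M).obj s.hom (opMap M.obj (eIso p).hom y)),
    Eq.trans ?_ h1.symm⟩
  exact Eq.trans (inclTen_comp_unW G M f.hom s.hom a _).symm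
    (inclTen_iso G M (f ≪≫ unW.mapIso s) (eIso p).symm _ _)

/-! ### The sum over all pairs of sizes -/

section Total

variable (t : ℕ)

instance : Finite {p : ℕ × ℕ // p.1 + p.2 = t} :=
  ((Finset.HasAntidiagonal.antidiagonal t).finite_toSet.subset fun _ h => Finset.mem_coe.2
    (Finset.HasAntidiagonal.mem_antidiagonal.2 h)).to_subtype

instance : Fintype {p : ℕ × ℕ // p.1 + p.2 = t} := Fintype.ofFinite _

/-- The components of the isomorphism of complexes. -/
def wallPi : Co ((coind k ε).obj G) M (DubOrd.fin t) →ₗ[k]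
    WalCo G ((res k (dUpsilon k (-ε))).obj M) t :=
  LinearMap.pi fun p => wallCo G M p.1.1 p.1.2 t

/-- The standard isomorphism `m ⨿ n ≅ t`, for `m + n = t`. -/
def stdIso {t : ℕ} (p : {p : ℕ × ℕ // p.1 + p.2 = t}) :
    DubOrd.fin t ≅ unW.obj (UwbOrd.fin p.1.1 p.1.2) :=
  (finIso (finSumFinEquiv.trans (finCongr p.2))).symm

/-- The components of the inverse isomorphism. -/
def inclSum : WalCo G ((res k (dUpsilon k (-ε))).obj M) t →ₗ[k]
    Co ((coind k ε).obj G) M (DubOrd.fin t) :=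
  ∑ p, (inclCo G M (stdIso p)).comp (LinearMap.proj p)

lemma inclSum_apply (z) : inclSum G M t z = ∑ p, inclCo G M (stdIso p) (z p) :=
  LinearMap.sum_apply _ _ _

lemma inclSum_single [DecidableEq {p : ℕ × ℕ // p.1 + p.2 = t}] (p) (w) :
    inclSum G M t (Pi.single p w) = inclCo G M (stdIso p) w := by
  rw [inclSum_apply, Finset.sum_eq_single p, Pi.single_eq_same]
  · intro q _ hq
    rw [Pi.single_eq_of_ne hq, map_zero]
  · intro h
    exact absurd (Finset.mem_univ p) h

lemma wallPi_inclSum [CharZero k] (z) : wallPi G M t (inclSum G M t z) = z := by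
  funext q
  change wallCo G M q.1.1 q.1.2 t (inclSum G M t z) = z q
  rw [inclSum_apply, map_sum, Finset.sum_eq_single q]
  · exact wallCo_inclCo G M _ _
  · intro p _ hp
    exact wallCo_inclCo_of_ne G M (fun h => hp (Subtype.ext (Prod.ext h.1.symm h.2.symm))) _ _
  · intro h
    exact absurd (Finset.mem_univ q) h

/-- An element of the coinduced module is the sum of its components, and the component of a
decomposition lies in the image for the sizes of its two parts. -/
lemma inclSum_surjective : Function.Surjective (inclSum G M t) := by
  classical
  rw [← LinearMap.range_eq_top, eq_top_iff]
  rintro w -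
  obtain ⟨z, rfl⟩ := Submodule.mkQ_surjective _ w
  have h : ∀ p, LinearMap.range (inclCo G M (stdIso p)) ≤ LinearMap.range (inclSum G M t) := by
    rintro p _ ⟨w, rfl⟩
    exact ⟨Pi.single p w, inclSum_single G M t p w⟩
  induction z using TensorProduct.induction_on with
  | zero => rw [map_zero]; exact zero_mem _
  | add z z' hz hz' => rw [map_add]; exact add_mem hz hz'
  | tmul x y =>
    have hx : x = ∑ p, singleCoind G (X := DubOrd.fin t) p (x p) := (sum_singleCoind G x).symm
    rw [hx, TensorProduct.sum_tmul, map_sum]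
    refine sum_mem fun p _ => ?_
    have hp : Nat.card (piece p 0) + Nat.card (piece p 1) = t := by
      rw [← Nat.card_sum, Nat.card_congr (pieceEquiv p), Nat.card_fin]
    exact h ⟨(_, _), hp⟩ (mkQ_singleCoind G M p (stdIso ⟨(_, _), hp⟩)
      (UwbOrd.isoOfEquiv (A := UwbOrd.fin _ _) (B := decomp (X := DubOrd.fin t) p)
        (Finite.equivFin (piece p 0)).symm (Finite.equivFin (piece p 1)).symm) (x p) y)

/-- The tensor product with the coinduced module is the direct sum of walled tensor products. -/
def wallEquiv [CharZero k] : Co ((coind k ε).obj G) M (DubOrd.fin t) ≃ₗ[k]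
    WalCo G ((res k (dUpsilon k (-ε))).obj M) t :=
  LinearEquiv.ofLinearMap (wallPi G M t) (inclSum G M t)
    (LinearMap.ext (wallPi_inclSum G M t))
    -- The map `inclSum` has the left inverse `wallPi` and is surjective, so the other composite is
    -- the identity too.
    (LinearMap.ext fun w => by
      obtain ⟨z, rfl⟩ := inclSum_surjective G M t w
      exact congrArg (inclSum G M t) (wallPi_inclSum G M t z))

end Total

/-! ### Naturality and the isomorphism of complexes -/

variable {G M} {G' : LMod.{u, v} k (Dwb k ε)} {M' : LMod.{u, v} k (Ddb k (-ε))}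
  (τ : G ⟶ G') (ρ : M ⟶ M')

/-- Both ingredients of the evaluation, the action of `f` and the counit, commute with morphisms of
modules. -/
lemma evalCoind_app {A : UwbOrd} {X : DubOrd} (f : unW.obj A ⟶ X) (x) :
    evalCoind G' f ((((coind k ε).map τ).hom.app (op ((Twisted.of k (DubOrd.twist ε)).obj X))).hom x) =
      (τ.hom.app (op ((Twisted.of k (UwbOrd.twist ε)).obj A))).hom (evalCoind G f x) :=
  (congrArg (counitApp G' A) (opMap_app ((coind k ε).map τ) f x).symm).trans
    (opMap_app τ (jHom A) _).symm

lemma crossTen_tenFun {A : UwbOrd} {X : DubOrd} (f : unW.obj A ⟶ X) (x y) :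
    crossTen G' M' f (tenFun ((coind k ε).map τ) ρ X (x ⊗ₜ[k] y)) =
      coFun τ ((res k (dUpsilon k (-ε))).map ρ) A (crossTen G M f (x ⊗ₜ[k] y)) :=
  congrArg₂ (fun b c => (balanced G' ((res k (dUpsilon k (-ε))).obj M') A).mkQ (b ⊗ₜ[k] c))
    (evalCoind_app τ f x) (opMap_app ρ f y).symm

lemma wallCo_coFun (m n t : ℕ) (w) :
    wallCo G' M' m n t (coFun ((coind k ε).map τ) ρ (DubOrd.fin t) w) =
      coFun τ ((res k (dUpsilon k (-ε))).map ρ) (UwbOrd.fin m n) (wallCo G M m n t w) := by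
  obtain ⟨z, rfl⟩ := Submodule.mkQ_surjective _ w
  induction z using TensorProduct.induction_on with
  | zero => simp only [map_zero]
  | add z z' hz hz' => rw [map_add, map_add, map_add, map_add, map_add, hz, hz']
  | tmul x y =>
    refine (wallCo_mkQ G' M' m n t (tenFun ((coind k ε).map τ) ρ _ (x ⊗ₜ[k] y))).trans ?_
    rw [wallCo_mkQ, map_smul, sumCross_apply, sumCross_apply, map_sum]
    exact congrArg _ (Finset.sum_congr rfl fun e _ => crossTen_tenFun τ ρ (finIso e).hom x y)

end Unwalling

variable (k : Type u) [Field k] [CharZero k] (ε : ℤˣ)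

/-- The isomorphism between the walled and the directed Koszul complexes. -/
def koszulUnwallingIso :
    (𝟭 (LMod.{u, v} k (Dwb k ε))).prod (res k (dUpsilon k (-ε))) ⋙ koszulWal k ε ≅
      (coind k ε).prod (𝟭 (LMod.{u, v} k (Ddb k (-ε)))) ⋙ koszulDir k ε :=
  -- The isomorphism is built from the directed side, since the choice-free averages are the maps
  -- shown to commute with the differentials; then it is inverted.
  (cxNatIso
    (K := (coind k ε).prod (𝟭 (LMod.{u, v} k (Ddb k (-ε)))) ⋙ koszulDir k ε)
    (L := (𝟭 (LMod.{u, v} k (Dwb k ε))).prod (res k (dUpsilon k (-ε))) ⋙ koszulWal k ε)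
    (fun P t => (wallEquiv P.1 P.2 t).toModuleIso)
    (fun P n N h => by
      have h1 := koszulWal_d k ε (((𝟭 _).prod (res k (dUpsilon k (-ε)))).obj P) h
      have h2 := koszulDir_d k ε (((coind k ε).prod (𝟭 _)).obj P) h
      refine ModuleCat.hom_ext (LinearMap.ext fun w => ?_)
      refine (LinearMap.congr_fun (congrArg ModuleCat.Hom.hom h1) _).trans ?_
      refine Eq.trans ?_ (congrArg (wallEquiv P.1 P.2 n)
        (LinearMap.congr_fun (congrArg ModuleCat.Hom.hom h2) w)).symm
      -- The component at `(m, n)` of the walled differential depends only on that at `(m+1, n+1)`,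
      -- so the equation is checked one component at a time.
      exact funext fun p => walD_wallCo_eq P.1 P.2 p.1.1 p.1.2 h w)
    (fun τ t => ModuleCat.hom_ext (LinearMap.ext fun w => funext fun p =>
      wallCo_coFun τ.1 τ.2 p.1.1 p.1.2 t w))).symm

end Brauer

end

theorem mainTheorem9 (k : Type u) [Field k] [CharZero k] (δ ε : ℤˣ) :
    Nonempty ((𝟭 (LMod.{u, v} k (Dwb k ε))).prod (res k (dUpsilon k (-ε))) ⋙ koszulWal k ε ≅
      (coind k ε).prod (𝟭 (LMod.{u, v} k (Ddb k (-ε)))) ⋙ koszulDir k ε) ∧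
    Nonempty ((𝟭 (LMod.{u, v} k (Ddb k ε))).prod (res k (dmp k δ (-ε))) ⋙ koszulDir k ε ≅
      (res k (dTr k δ ε)).prod (𝟭 (LMod.{u, v} k (Db k δ (-ε)))) ⋙ koszulUnd k δ ε) ∧
    Nonempty ((dJ k δ ε).prod (𝟭 (LMod.{u, v} k (Db k δ (-ε)))) ⋙ koszulUnd k δ ε ≅
      (𝟭 (LMod.{u, v} k (Dwb k ε))).prod (res k (dups k δ (-ε))) ⋙ koszulWal k ε) :=
  ⟨⟨koszulUnwallingIso k ε⟩, ⟨koszulTransferIso k δ ε⟩,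
    ⟨koszulCompositeIso k δ ε (koszulUnwallingIso k ε)⟩⟩
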